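/- **Setting.** All manifolds are real, finite dimensional, Hausdorff, second countable, smooth ($C^\infty$) and without boundary. Let $(\tau,\nu,\rho,L)$ be a geometric optimal control structure: smooth fibre bundles $\tau:M\to\mathbb R$ and $\nu:U\to M$, a smooth bundle map $\rho:U\to J^1\tau$ over the identity of $M$, and a smooth function $L:U\to\mathbb R$. Let $\mathbf T:J^1\tau\to TM$, $\mathbf T(j^1_tc)=Tc(\partial/\partial t)$, let $V\tau=\ker T\tau$ with dual bundle $V^*\tau$, and let $\mathcal D$ be the family of vector fields $\mathbf T\circ\rho\circ\sigma$, where $\sigma$ is a smooth section of $\nu$ over an open subset of $M$. A *control* is a piecewise smooth (left continuous, and right continuous at $a$) section $u:[a,b]\to U$ of $\tau\circ\nu$, $a<b$, whose base section $c=\nu\circ u$ is continuous and which satisfies $\rho\circ u=j^1c$ on each smooth piece. Put $m=c(a)$, $n=c(b)$. *Vertical cone.* Let $(\Phi,T)$ be a composite flow determining $u$: a subdivision $a=a_0<\dots<a_\ell=b$, sections $\sigma_1,\dots,\sigma_\ell$ of $\nu$ over open sets such that $c([a_{i-1},a_i])$ lies in the domain of $\sigma_i$ and $c$ is an integral curve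 of $X_i=\mathbf T\circ\rho\circ\sigma_i$ on $[a_{i-1},a_i]$, and $u(t)=\sigma_i(c(t))$ for $t\in\,]a_{i-1},a_i]$. With $\{\phi^i_s\}$ the flow of $X_i$, put $\Phi_t^b=\phi^\ell_{a_\ell-a_{\ell-1}}\circ\dots\circ\phi^{i+1}_{a_{i+1}-a_i}\circ\phi^i_{a_i-t}$ for $t\in\,]a_{i-1},a_i]$. Then $$V_nR_m(\Phi,T)=\Big\{\sum_{j=1}^s\delta^j\,T\Phi_{t^j}^b\big(Y^j(c(t^j))-\dot c(t^j)\big)\ \Big|\ s\in\mathbb N,\ \delta^j\ge0,\ t^j\in\,]a,b],\ Y^j\in\mathcal D \text{ defined at } c(t^j)\Big\}\subset V_n\tau ,$$ where $\dot c=\mathbf T\circ\rho\circ u$ (the left derivative of $c$). *Extended structure.* On $\overline M=M\times\mathbb R$, with points $(m,J)$, and $\overline U=U\times\mathbb R$, put $\overline\tau(m,J)=\tau(m)$, $\overline\nu(u,J)=(\nu(u),J)$, and $\overline\rho(u,J)=(\rho(u),J,L(u))$ under $J^1\overline\tau\cong J^1\tau\times\mathbb R^2$. For $J_0\in\mathbb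 R$, the control $u$ induces the control $\overline u(t)=(u(t),J_0+\int_a^tL(u(s))\,ds)$ of the extended structure. It has end points $\overline m=(m,J_0)$ and $\overline n=(n,J_0+\int_a^bL(u(s))\,ds)$. For a composite flow $(\overline\Phi,\overline T)$ determining $\overline u$, let $V_{\overline n}R_{\overline m}(\overline\Phi,\overline T)\subset V_{\overline n}\overline\tau$ be the corresponding vertical cone. *Multipliers and extremals.* For $\lambda\in\mathbb R$, $u'\in U$ and $\eta\in V^*_{\nu(u')}\tau$, let $H_\lambda(u',\eta)=(u',\alpha)$, where $\alpha\in T^*_{\nu(u')}M$ is the covector with $\alpha|_{V\tau}=\eta$ and $\langle\alpha,\mathbf T(\rho(u'))\rangle+\lambda L(u')=0$. Let $\omega_\lambda$ be the pull-back by $H_\lambda$ to $U\times_MV^*\tau$ of the canonical symplectic form of $T^*M$ (pulled back to $U\times_MT^*M$). A *multiplier* of $u$ is a pair $(\eta,\lambda)$ of a continuous, piecewise smooth section $\eta$ of $V^*\tau$ along $c$ and a number $\lambda\in\mathbb R$ such that 1. $i_{(\dot u(t),\dot\eta(t))}\omega_\lambda=0$ on every smooth part of $(u,\eta)$; 2.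 for every $t\in[a,b]$, with $H_\lambda(u(t),\eta(t))=(u(t),\alpha)$, the function $u'\mapsto\langle\alpha,\mathbf T(\rho(u'))\rangle+\lambda L(u')$ on $\nu^{-1}(c(t))$ attains its global maximum at $u'=u(t)$; 3. $(\eta(t),\lambda)\ne(0,0)$ for all $t\in[a,b]$. The control $u$ is an *extremal* if it has a multiplier with $\lambda\le0$. An extremal is *normal* if it has a multiplier with $\lambda<0$, *abnormal* if it has one with $\lambda=0$, and *strictly abnormal* if it is abnormal but not normal. **Proposition 7.5 (characterization of abnormal extremals).** Let $u:[a,b]\to U$ be a control. (i) For every composite flow $(\Phi,T)$ determining $u$: $u$ is an abnormal extremal if and only if $\operatorname{cl}\big(V_nR_m(\Phi,T)\big)\ne V_n\tau$. (ii) For every $J_0\in\mathbb R$ and every composite flow $(\overline\Phi,\overline T)$ determining $\overline u$: $u$ is a strictly abnormal extremal if and only if $-\partial/\partial J|_{\overline n}$ lies on the boundary of $\operatorname{cl}\big(V_{\overline n}R_{\overline m}(\overline\Phi,\overline T)\big)$, the boundary being taken in the vector space $V_{\overline n}\overline\tau$. -/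

import Mathlib

open Set Manifold
open scoped ContDiff Topology

noncomputable section

namespace GeomControl

/-! ### Fibre bundles, vertical vectors, first jets -/

section Basic

variable {EB HB EX HX EF HF : Type*}
  [NormedAddCommGroup EB] [NormedSpace ℝ EB] [TopologicalSpace HB]
  [NormedAddCommGroup EX] [NormedSpace ℝ EX] [TopologicalSpace HX]
  [NormedAddCommGroup EF] [NormedSpace ℝ EF] [TopologicalSpace HF]

/-- `π : X → B` is a smooth fibre bundle with typical fibre `F`: it is smooth and surjective, and
every point of `B` has an open neighbourhood `W` over which `π` is trivial, that is,
`x ↦ (π x, φ x)` is a diffeomorphism of `π ⁻¹ W` onto `W × F`, with inverse `ψ`. -/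
structure IsSmoothFibreBundle (IB : ModelWithCorners ℝ EB HB) (IX : ModelWithCorners ℝ EX HX)
    (IF : ModelWithCorners ℝ EF HF) {B X : Type*} (F : Type*)
    [TopologicalSpace B] [ChartedSpace HB B] [TopologicalSpace X] [ChartedSpace HX X]
    [TopologicalSpace F] [ChartedSpace HF F] (π : X → B) : Prop where
  contMDiff : ContMDiff IX IB ∞ π
  surjective : Function.Surjective π
  locallyTrivial : ∀ b : B, ∃ W : Set B, IsOpen W ∧ b ∈ W ∧
    ∃ (φ : X → F) (ψ : B × F → X),
      ContMDiffOn IX IF ∞ φ (π ⁻¹' W) ∧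
      ContMDiffOn (IB.prod IF) IX ∞ ψ (W ×ˢ univ) ∧
      (∀ x, π x ∈ W → ψ (π x, φ x) = x) ∧
      (∀ b' ∈ W, ∀ f, π (ψ (b', f)) = b' ∧ φ (ψ (b', f)) = f)

variable (I : ModelWithCorners ℝ EX HX) {M : Type*} [TopologicalSpace M] [ChartedSpace HX M]

/-- The differential of a real-valued function at a point, as a linear form. -/
def dAt (τ : M → ℝ) (m : M) : TangentSpace I m →L[ℝ] ℝ := mfderiv I 𝓘(ℝ, ℝ) τ m

/-- The vertical tangent space `V_m τ = ker T_m τ`. -/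
abbrev Vert (τ : M → ℝ) (m : M) : Submodule ℝ (TangentSpace I m) :=
  LinearMap.ker (dAt I τ m : TangentSpace I m →ₗ[ℝ] ℝ)

/-- The dual `V*_m τ` of the vertical tangent space. -/
abbrev CoVert (τ : M → ℝ) (m : M) : Type _ := Vert I τ m →L[ℝ] ℝ

/-- The fibre over `m` of the first jet bundle `J¹τ → M` of `τ : M → ℝ`. The 1-jet at `t = τ m` of
a local section `c` with `c t = m` is given by the velocity `T c (∂/∂t) ∈ T_m M`, and the vectors
that arise in this way are those which `T τ` maps to `∂/∂t`. The total time derivative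
`𝐓 : J¹τ → TM` is the inclusion `Subtype.val`; it is an embedding onto an affine subbundle
of `TM`. -/
abbrev JetFibre (τ : M → ℝ) (m : M) : Type _ := {w : TangentSpace I m // dAt I τ m w = 1}

/-- The cotangent bundle `T*M`. -/
abbrev Cotangent (M : Type*) [TopologicalSpace M] [ChartedSpace HX M] [IsManifold I 1 M] : Type _ :=
  Bundle.TotalSpace (EX →L[ℝ] ℝ) (fun m : M ↦ TangentSpace I m →L[ℝ] ℝ)

/-- The canonical symplectic form `∑ dpᵢ ∧ dxⁱ` of `T*M`. By construction of the charts of a vector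
bundle, the tangent space of `T*M` at `p` is identified with `E × E*` through the canonical
coordinates `(x, p)` induced by the chart of `M` at the base point of `p`. -/
def sympl [IsManifold I 1 M] (p : Cotangent I M)
    (w₁ w₂ : TangentSpace (I.prod 𝓘(ℝ, EX →L[ℝ] ℝ)) p) : ℝ :=
  let v₁ : EX × (EX →L[ℝ] ℝ) := w₁
  let v₂ : EX × (EX →L[ℝ] ℝ) := w₂
  v₁.2 v₂.1 - v₂.2 v₁.1

/-- Smoothness on `s` of a section `η` of `V*τ` along a curve `c` in `M`. As `V*τ` is the quotient of
`T*M` by the line bundle spanned by `dτ`, this means that `η` is the restriction to vertical vectors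
of a smooth section of `T*M` along `c`. (On a closed interval, smooth up to the end points is the
same as having a smooth extension to a larger open interval.) -/
def SmoothCovOn [IsManifold I 1 M] (τ : M → ℝ) (c : ℝ → M) (η : ∀ t, CoVert I τ (c t))
    (s : Set ℝ) : Prop :=
  ∃ A : ∀ t : ℝ, TangentSpace I (c t) →L[ℝ] ℝ,
    ContMDiffOn 𝓘(ℝ, ℝ) (I.prod 𝓘(ℝ, EX →L[ℝ] ℝ)) ∞
      (fun t ↦ (⟨c t, A t⟩ : Cotangent I M)) s ∧
    ∀ t ∈ s, ∀ v : Vert I τ (c t), A t v = η t v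

open Classical in
/-- The flow at time `t` of the vector field `X` with domain `W`: a point `x` goes to `γ t`, where
`γ` is the integral curve of `X` inside `W` that starts at `x`. Where there is no such curve the
value is junk. -/
def flowMap (X : ∀ m : M, TangentSpace I m) (W : Set M) (t : ℝ) (x : M) : M :=
  if h : ∃ γ : ℝ → M, γ 0 = x ∧ (∀ s ∈ uIcc 0 t, γ s ∈ W) ∧
      IsMIntegralCurveOn (I := I) γ X (uIcc 0 t)
  then h.choose t else x

end Basic

/-- A finite subdivision `a = a₀ < a₁ < ⋯ < a_ℓ = b`. -/
structure Subdivision (a b : ℝ) where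
  len : ℕ
  pt : Fin (len + 1) → ℝ
  strictMono : StrictMono pt
  first : pt 0 = a
  last : pt (Fin.last len) = b

/-! ### Geometric (optimal) control structures -/

section Control

variable {EM HM EU HU EQ HQ EK HK : Type*}
  [NormedAddCommGroup EM] [NormedSpace ℝ EM] [TopologicalSpace HM]
  [NormedAddCommGroup EU] [NormedSpace ℝ EU] [TopologicalSpace HU]
  [NormedAddCommGroup EQ] [NormedSpace ℝ EQ] [TopologicalSpace HQ]
  [NormedAddCommGroup EK] [NormedSpace ℝ EK] [TopologicalSpace HK]
  (IM : ModelWithCorners ℝ EM HM) (IU : ModelWithCorners ℝ EU HU)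
  (IQ : ModelWithCorners ℝ EQ HQ) (IK : ModelWithCorners ℝ EK HK)
  (M U Q K : Type*)
  [TopologicalSpace M] [ChartedSpace HM M] [IsManifold IM ∞ M]
  [TopologicalSpace U] [ChartedSpace HU U]
  [TopologicalSpace Q] [ChartedSpace HQ Q]
  [TopologicalSpace K] [ChartedSpace HK K]

/-- A geometric control structure `(τ, ν, ρ)`: a fibre bundle `τ : M → ℝ` with typical fibre `Q`, a
fibre bundle `ν : U → M` with typical fibre `K`, and a smooth bundle morphism `ρ : U → J¹τ` over the
identity of `M`. Since `𝐓 : J¹τ → TM` is an embedding, smoothness of `ρ` is smoothness of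
`𝐓 ∘ ρ : U → TM`. -/
structure ControlStructure where
  τ : M → ℝ
  ν : U → M
  bundle_τ : IsSmoothFibreBundle 𝓘(ℝ, ℝ) IM IQ Q τ
  bundle_ν : IsSmoothFibreBundle IM IU IK K ν
  ρ : ∀ u : U, JetFibre IM τ (ν u)
  contMDiff_ρ : ContMDiff IU IM.tangent ∞ (fun u ↦ (⟨ν u, (ρ u).1⟩ : TangentBundle IM M))

/-- A geometric optimal control structure `(τ, ν, ρ, L)`: a geometric control structure with a
smooth cost function `L` on `U`. -/
structure OptimalControlStructure extends ControlStructure IM IU IQ IK M U Q K where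
  L : U → ℝ
  contMDiff_L : ContMDiff IU 𝓘(ℝ, ℝ) ∞ L

variable {IM IU IQ IK M U Q K}

namespace ControlStructure

variable (G : ControlStructure IM IU IQ IK M U Q K)

/-- A smooth local section of `ν`, with open domain `dom` (values outside `dom` are junk). -/
structure LocalSection where
  dom : Set M
  isOpen_dom : IsOpen dom
  σ : M → U
  contMDiffOn : ContMDiffOn IM IU ∞ σ dom
  ν_σ : ∀ m ∈ dom, G.ν (σ m) = m

/-- The vector `𝐓 (ρ u)`, seen as a tangent vector at `m`; it is used only when `ν u = m`. (All
tangent spaces of `M` have the same underlying type, so that no transport is needed.) -/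
def vel (m : M) (u : U) : TangentSpace IM m := (G.ρ u).1

/-- The vector field `𝐓 ∘ ρ ∘ σ` on the domain of the local section `σ`. The family `𝓓` consists of
these vector fields. -/
def field (s : G.LocalSection) (m : M) : TangentSpace IM m := G.vel m (s.σ m)

/-- `u : [a, b] → U` is a control (values outside `[a, b]` are junk): a piecewise section of `τ ∘ ν`
with continuous base section `ν ∘ u`, induced by finitely many smooth controls `w i`. Each `w i` is a
smooth section of `τ ∘ ν` on an open set containing the closed subinterval, satisfies `ρ ∘ w = j¹ (ν ∘ w)`
on that subinterval, and agrees with `u` there except possibly at the left end point. -/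
structure IsControl (a b : ℝ) (u : ℝ → U) : Prop where
  isSection : ∀ t ∈ Icc a b, G.τ (G.ν (u t)) = t
  continuousOn : ContinuousOn (fun t ↦ G.ν (u t)) (Icc a b)
  piecewise : ∃ (S : Subdivision a b) (w : Fin S.len → ℝ → U), ∀ i : Fin S.len,
    (∃ O : Set ℝ, IsOpen O ∧ Icc (S.pt i.castSucc) (S.pt i.succ) ⊆ O ∧
      ContMDiffOn 𝓘(ℝ, ℝ) IU ∞ (w i) O ∧ ∀ t ∈ O, G.τ (G.ν (w i t)) = t) ∧
    (∀ t ∈ Icc (S.pt i.castSucc) (S.pt i.succ),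
      HasMFDerivAt 𝓘(ℝ, ℝ) IM (fun t ↦ G.ν (w i t)) t
        ((1 : ℝ →L[ℝ] ℝ).smulRight (G.vel (G.ν (w i t)) (w i t)))) ∧
    (∀ t ∈ Ioc (S.pt i.castSucc) (S.pt i.succ), u t = w i t) ∧
    (S.pt i.castSucc = a → u a = w i a)

/-- A composite flow determining the control `u`: an ordered set of vector fields
`Xᵢ = 𝐓 ∘ ρ ∘ σᵢ` in `𝓓`, with flow times `aᵢ - aᵢ₋₁`, such that the base section `c = ν ∘ u` is the
corresponding concatenation of integral curves and `u t = σᵢ (c t)` on `]aᵢ₋₁, aᵢ]`. -/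
structure FlowData (a b : ℝ) (u : ℝ → U) extends Subdivision a b where
  sec : Fin len → G.LocalSection
  mem_dom : ∀ i, ∀ t ∈ Icc (pt i.castSucc) (pt i.succ), G.ν (u t) ∈ (sec i).dom
  integral : ∀ i, IsMIntegralCurveOn (I := IM) (fun t ↦ G.ν (u t)) (G.field (sec i))
    (Icc (pt i.castSucc) (pt i.succ))
  control : ∀ i, ∀ t ∈ Ioc (pt i.castSucc) (pt i.succ), u t = (sec i).σ (G.ν (u t))

variable {G} {a b : ℝ} {u : ℝ → U}

/-- The composite flow `Φ_t^b` from the instant `t` to the final instant `b`; the flow of `Xᵢ` is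
followed for a time equal to the length of the part of `[aᵢ₋₁, aᵢ]` after `t`. If
`t ∈ ]aᵢ₋₁, aᵢ]` this is `φ^ℓ_{a_ℓ - a_{ℓ-1}} ∘ ⋯ ∘ φ^{i+1}_{a_{i+1} - a_i} ∘ φ^i_{a_i - t}`. -/
def FlowData.flowFrom (P : G.FlowData a b u) (t : ℝ) (x : M) : M :=
  Fin.foldl P.len
    (fun y i ↦ flowMap IM (G.field (P.sec i)) (P.sec i).dom
      (max 0 (P.pt i.succ - max (P.pt i.castSucc) t)) y) x

/-- The tangent map `T Φ_t^b : T_{c(t)} M → T_{c(b)} M` (note that `Φ_t^b (c t) = c b`). -/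
def FlowData.transport (P : G.FlowData a b u) (t : ℝ) :
    TangentSpace IM (G.ν (u t)) →L[ℝ] TangentSpace IM (G.ν (u b)) :=
  mfderiv IM IM (P.flowFrom t) (G.ν (u t))

/-- The vertical variational cone `V_n R_m(Φ, T)` at `n = c(b)`, as a subset of `V_n τ`: all finite
sums `∑ δⁱ T Φ_{tⁱ}^b (Yⁱ(c(tⁱ)) - ċ(tⁱ))` with `δⁱ ≥ 0`, `tⁱ ∈ ]a, b]` and `Yⁱ ∈ 𝓓` defined
at `c(tⁱ)`. Here `ċ = 𝐓 ∘ ρ ∘ u` since `u` is a control. -/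
def FlowData.verticalCone (P : G.FlowData a b u) : Set (Vert IM G.τ (G.ν (u b))) :=
  {w | ∃ (s : ℕ) (δ : Fin s → ℝ) (t : Fin s → ℝ) (Y : Fin s → G.LocalSection),
    (∀ i, 0 ≤ δ i) ∧ (∀ i, t i ∈ Ioc a b) ∧ (∀ i, G.ν (u (t i)) ∈ (Y i).dom) ∧
    (w : TangentSpace IM (G.ν (u b))) =
      ∑ i, δ i • P.transport (t i)
        (G.field (Y i) (G.ν (u (t i))) - G.vel (G.ν (u (t i))) (u (t i)))}

end ControlStructure

namespace OptimalControlStructure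

variable (G : OptimalControlStructure IM IU IQ IK M U Q K)

/-! ### Multipliers and extremals -/

/-- The projection of `T_{ν(u)} M` onto the vertical subspace along `𝐓 (ρ u)`. -/
def vertProj (u : U) : TangentSpace IM (G.ν u) →L[ℝ] Vert IM G.τ (G.ν u) :=
  (ContinuousLinearMap.id ℝ (TangentSpace IM (G.ν u)) -
    (dAt IM G.τ (G.ν u)).smulRight (G.ρ u).1).codRestrict _ (fun v ↦ by
      have h := (G.ρ u).2
      simp [LinearMap.mem_ker, h])

/-- The section `H_λ`, on the covector part: the covector `α ∈ T*_{ν(u)} M` which restricts to `η` on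
vertical vectors and satisfies `⟨α, 𝐓 (ρ u)⟩ + λ L(u) = 0`. -/
def hCov (lam : ℝ) (u : U) (η : CoVert IM G.τ (G.ν u)) : TangentSpace IM (G.ν u) →L[ℝ] ℝ :=
  η.comp (G.vertProj u) - (lam * G.L u) • dAt IM G.τ (G.ν u)

/-- A point of the fibred product `U ×_M V*τ`. -/
abbrev Phase : Type _ := Σ u : U, CoVert IM G.τ (G.ν u)

/-- The map `H_λ : U ×_M V*τ → U ×_M T*M`, followed by the projection to `T*M`. -/
def hMap (lam : ℝ) (p : G.Phase) : Cotangent IM M := ⟨G.ν p.1, G.hCov lam p.1 p.2⟩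

/-- A curve in `U ×_M V*τ` is smooth on `s`. -/
def SmoothPhaseOn (p : ℝ → G.Phase) (s : Set ℝ) : Prop :=
  ContMDiffOn 𝓘(ℝ, ℝ) IU ∞ (fun t ↦ (p t).1) s ∧
    SmoothCovOn IM G.τ (fun t ↦ G.ν (p t).1) (fun t ↦ (p t).2) s

/-- The velocity of the image in `T*M` of a curve in `U ×_M V*τ` under `H_λ`. -/
def hVel (lam : ℝ) (p : ℝ → G.Phase) (t : ℝ) :
    TangentSpace (IM.prod 𝓘(ℝ, EM →L[ℝ] ℝ)) (G.hMap lam (p t)) :=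
  mfderiv 𝓘(ℝ, ℝ) (IM.prod 𝓘(ℝ, EM →L[ℝ] ℝ)) (fun r ↦ G.hMap lam (p r)) t (1 : ℝ)

/-- `i_{ṗ(t)} ω_λ = 0`, where `ω_λ` is the pull-back under `H_λ` of the canonical symplectic form of
`T*M`: `ω_λ` vanishes on the pair formed by `ṗ(t)` and any tangent vector of `U ×_M V*τ` at `p(t)`,
the latter being the velocity at `0` of a smooth curve `q` in `U ×_M V*τ` with `q(0) = p(t)`. -/
def ContractionZero (lam : ℝ) (p : ℝ → G.Phase) (t : ℝ) : Prop :=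
  ∀ (q : ℝ → G.Phase) (r : ℝ), 0 < r → G.SmoothPhaseOn q (Ioo (-r) r) → q 0 = p t →
    sympl IM (G.hMap lam (p t)) (G.hVel lam p t) (G.hVel lam q 0) = 0

/-- `(η, λ)` is a multiplier of the control `u : [a, b] → U`. -/
structure IsMultiplier (a b : ℝ) (u : ℝ → U) (η : ∀ t, CoVert IM G.τ (G.ν (u t))) (lam : ℝ) :
    Prop where
  /-- `η` is a continuous piecewise section of `V*τ` along `ν ∘ u`. -/
  piecewise : ∃ S : Subdivision a b, ∀ i : Fin S.len,
    SmoothCovOn IM G.τ (fun t ↦ G.ν (u t)) η (Icc (S.pt i.castSucc) (S.pt i.succ))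
  /-- The contraction condition holds on every smooth part of the curve `(u, η)`. -/
  characteristic : ∀ r s : ℝ, Ioo r s ⊆ Icc a b →
    G.SmoothPhaseOn (fun t ↦ ⟨u t, η t⟩) (Ioo r s) →
    ∀ t ∈ Ioo r s, G.ContractionZero lam (fun t ↦ ⟨u t, η t⟩) t
  maximum : ∀ t ∈ Icc a b, ∀ u' : U, G.ν u' = G.ν (u t) →
    G.hCov lam (u t) (η t) (G.vel (G.ν (u t)) u') + lam * G.L u' ≤
      G.hCov lam (u t) (η t) (G.vel (G.ν (u t)) (u t)) + lam * G.L (u t)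
  ne_zero : ∀ t ∈ Icc a b, ¬ (η t = 0 ∧ lam = 0)

/-- An extremal: a control with a multiplier `(η, λ)` such that `λ ≤ 0`. -/
def IsExtremal (a b : ℝ) (u : ℝ → U) : Prop :=
  G.IsControl a b u ∧ ∃ η lam, G.IsMultiplier a b u η lam ∧ lam ≤ 0

/-- A normal extremal: an extremal that has a multiplier with `λ < 0`. -/
def IsNormal (a b : ℝ) (u : ℝ → U) : Prop :=
  G.IsExtremal a b u ∧ ∃ η lam, G.IsMultiplier a b u η lam ∧ lam < 0

/-- An abnormal extremal: an extremal that has a multiplier with `λ = 0`. -/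
def IsAbnormal (a b : ℝ) (u : ℝ → U) : Prop :=
  G.IsExtremal a b u ∧ ∃ η lam, G.IsMultiplier a b u η lam ∧ lam = 0

/-- A strictly abnormal extremal: abnormal, but not normal. -/
def IsStrictlyAbnormal (a b : ℝ) (u : ℝ → U) : Prop :=
  G.IsAbnormal a b u ∧ ¬ G.IsNormal a b u

/-! ### The extended control structure on `M × ℝ` -/

lemma mdifferentiable_τ : MDifferentiable IM 𝓘(ℝ, ℝ) G.τ :=
  G.bundle_τ.contMDiff.mdifferentiable (by simp)

/-- The vertical part of the differential of `τ̄ (m, J) = τ m`. -/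
lemma dAt_extended (p : M × ℝ) (w : EM × ℝ) :
    dAt (IM.prod 𝓘(ℝ, ℝ)) (fun q : M × ℝ ↦ G.τ q.1) p w = dAt IM G.τ p.1 w.1 := by
  have h : HasMFDerivAt (IM.prod 𝓘(ℝ, ℝ)) 𝓘(ℝ, ℝ) (fun q : M × ℝ ↦ G.τ q.1) p
      ((mfderiv IM 𝓘(ℝ, ℝ) G.τ p.1).comp
        (ContinuousLinearMap.fst ℝ (TangentSpace IM p.1) (TangentSpace 𝓘(ℝ, ℝ) p.2))) :=
    HasMFDerivAt.comp p (G.mdifferentiable_τ p.1).hasMFDerivAt (hasMFDerivAt_fst p)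
  unfold dAt
  rw [h.mfderiv]
  rfl

/-- The extended control structure `(τ̄, ν̄, ρ̄)` on `M̄ = M × ℝ`, with control bundle `Ū = U × ℝ`:
`τ̄ (m, J) = τ m`, `ν̄ (u, J) = (ν u, J)` and `ρ̄ (u, J) = (ρ u, J, L u)`, where a 1-jet of a section
`(c, J)` of `τ̄` is identified with the 1-jet of `c` together with `J` and `dJ/dt`. -/
def extended : ControlStructure (IM.prod 𝓘(ℝ, ℝ)) (IU.prod 𝓘(ℝ, ℝ)) (IQ.prod 𝓘(ℝ, ℝ)) IK
    (M × ℝ) (U × ℝ) (Q × ℝ) K where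
  τ := fun q ↦ G.τ q.1
  ν := fun q ↦ (G.ν q.1, q.2)
  bundle_τ :=
    { contMDiff := G.bundle_τ.contMDiff.comp contMDiff_fst
      surjective := fun t ↦ (G.bundle_τ.surjective t).elim fun m hm ↦ ⟨(m, 0), hm⟩
      locallyTrivial := fun t ↦ by
        obtain ⟨W, hW, ht, φ, ψ, hφ, hψ, h₁, h₂⟩ := G.bundle_τ.locallyTrivial t
        refine ⟨W, hW, ht, fun q ↦ (φ q.1, q.2), fun q ↦ (ψ (q.1, q.2.1), q.2.2), ?_, ?_, ?_, ?_⟩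
        · exact (hφ.comp contMDiffOn_fst fun q hq ↦ hq).prodMk contMDiffOn_snd
        · refine ContMDiffOn.prodMk (hψ.comp (t := W ×ˢ univ)
            (f := fun q : ℝ × Q × ℝ ↦ (q.1, q.2.1)) ?_ fun q hq ↦ ⟨hq.1, trivial⟩) ?_
          · exact (contMDiff_fst.prodMk (contMDiff_fst.comp contMDiff_snd)).contMDiffOn
          · exact (contMDiff_snd.comp contMDiff_snd).contMDiffOn
        · intro q hq
          exact Prod.ext (h₁ q.1 hq) rfl
        · intro t' ht' f
          exact ⟨(h₂ t' ht' f.1).1, Prod.ext (h₂ t' ht' f.1).2 rfl⟩ }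
  bundle_ν :=
    { contMDiff := (G.bundle_ν.contMDiff.comp contMDiff_fst).prodMk contMDiff_snd
      surjective := fun p ↦ (G.bundle_ν.surjective p.1).elim fun u hu ↦ ⟨(u, p.2), Prod.ext hu rfl⟩
      locallyTrivial := fun p ↦ by
        obtain ⟨W, hW, hp, φ, ψ, hφ, hψ, h₁, h₂⟩ := G.bundle_ν.locallyTrivial p.1
        refine ⟨W ×ˢ univ, hW.prod isOpen_univ, ⟨hp, trivial⟩, fun q ↦ φ q.1,
          fun q ↦ (ψ (q.1.1, q.2), q.1.2), ?_, ?_, ?_, ?_⟩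
        · exact hφ.comp contMDiffOn_fst fun q hq ↦ hq.1
        · refine ContMDiffOn.prodMk (hψ.comp (t := W ×ˢ univ)
            (f := fun q : (M × ℝ) × K ↦ (q.1.1, q.2)) ?_ fun q hq ↦ ⟨hq.1.1, trivial⟩) ?_
          · exact ((contMDiff_fst.comp contMDiff_fst).prodMk contMDiff_snd).contMDiffOn
          · exact (contMDiff_snd.comp contMDiff_fst).contMDiffOn
        · intro q hq
          exact Prod.ext (h₁ q.1 hq.1) rfl
        · intro p' hp' f
          exact ⟨Prod.ext (h₂ p'.1 hp'.1 f).1 rfl, (h₂ p'.1 hp'.1 f).2⟩ }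
  ρ := fun q ↦ ⟨((G.ρ q.1).1, G.L q.1), by
    rw [dAt_extended]
    exact (G.ρ q.1).2⟩
  contMDiff_ρ := by
    have h₁ : ContMDiff (IU.prod 𝓘(ℝ, ℝ)) IM.tangent ∞
        (fun q : U × ℝ ↦ (⟨G.ν q.1, (G.ρ q.1).1⟩ : TangentBundle IM M)) :=
      G.contMDiff_ρ.comp contMDiff_fst
    have h₂ : ContMDiff (IU.prod 𝓘(ℝ, ℝ)) 𝓘(ℝ, ℝ).tangent ∞
        (fun q : U × ℝ ↦ (⟨q.2, G.L q.1⟩ : TangentBundle 𝓘(ℝ, ℝ) ℝ)) := by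
      intro q
      rw [Bundle.contMDiffAt_totalSpace]
      refine ⟨contMDiff_snd q, ?_⟩
      simpa [Function.comp_def] using (G.contMDiff_L.comp contMDiff_fst) q
    exact (contMDiff_equivTangentBundleProd_symm (I := IM) (M := M) (I' := 𝓘(ℝ, ℝ)) (M' := ℝ)).comp
      (h₁.prodMk h₂)

/-- The control `ū(t) = (u(t), J₀ + ∫_a^t L(u))` of the extended structure induced by `u`. -/
def lift (a : ℝ) (u : ℝ → U) (J₀ : ℝ) (t : ℝ) : U × ℝ := (u t, J₀ + ∫ s in a..t, G.L (u s))

/-- The vertical tangent vector `-∂/∂J` of `τ̄` at a point of `M × ℝ`. -/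
def negDJ (p : M × ℝ) : Vert (IM.prod 𝓘(ℝ, ℝ)) G.extended.τ p :=
  ⟨((0 : EM), (-1 : ℝ)), by
    change dAt (IM.prod 𝓘(ℝ, ℝ)) (fun q : M × ℝ ↦ G.τ q.1) p _ = 0
    rw [dAt_extended]
    exact map_zero (dAt IM G.τ p.1)⟩

end OptimalControlStructure
end Control
end GeomControl

end

noncomputable section

/-! The vertical cone is a convex cone, so Hahn–Banach describes its closure by the linear forms
that are nonpositive on it (`closure_cone_ne_univ_iff`, `notMem_closure_cone_iff`,
`mem_frontier_closure_cone_iff`). The theorem is a dictionary between such forms at the end point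
`n` and multipliers along the whole curve.

From a form to a multiplier: extend the form to a covector `κ` at `n` and pull it back, `α(t) = κ ∘
TΦ_t^b`. In coordinates `TΦ_t^b` is a constant isomorphism times the fundamental solution `Z(t)` of
the equation adjoint to the variational equation (`exists_local_flow`, `exists_transport_eq`), so
`α` solves the adjoint equation of the fields `Xᵢ`. Nonpositivity on the generators `TΦ_t^b(Y - ċ)`
is the maximum condition for `t > a`, since every point of `U` lies on a local section; the instant
`a` follows by continuity (`max_of_cone_left`). At a maximum the Hamiltonian has zero derivative
along the fibres of `ν`, so its derivative in any direction of `U` can be computed along `σᵢ`; this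
upgrades the equation of `Xᵢ` to an equation in all directions of `U` (`adjointAt_comp_transport`).
The normalization `⟨α, ċ⟩ = 0` costs a multiple of `dτ` that is constant on each piece, because `Xᵢ`
is invariant under its own flow (`transport_field_eq`).

From a multiplier to a form: the pairing of `η` with a transported vertical vector is continuous and
has zero derivative off a countable set, hence is constant (`eq_apply_transport`). The maximum
condition then says that `η(b)` is nonpositive on each generator (`le_zero_of_mem_verticalCone`).

The contraction condition enters through `contractionZero_iff`. On the image of `H_λ` the function
`⟨α, 𝐓ρ⟩ + λL` vanishes; differentiating this constraint turns `ω_λ(ṗ, q̇)` into `α'(Tν w) + dH(w)`,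
where `w` is the `U`-component of `q̇` and `H` is the Hamiltonian with the coordinates of the
covector frozen.

For the second part the extended structure is given zero cost. Its Hamiltonian at `α + λ dJ` is that
of the original structure with the number `λ`, and since nothing depends on `J`, `λ` is constant
along solutions (`adjointAt_extendedZero_iff`). So nonzero forms `η(b) + λ dJ` that are nonpositive
on the extended cone correspond to pairs `(η, λ)`. Their value at `-∂/∂J` is `-λ`: normality means
that `-∂/∂J` is outside the closure, abnormality that some nonzero form of this kind vanishes at it.
-/

namespace GeomControl

/-! ### Local flows in a vector space and their linearization -/

section LinearODE

variable {E : Type*} [NormedAddCommGroup E] [NormedSpace ℝ E]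

/-- The augmented vector field for `x' = F x`, `Z' = -Z ∘ DF(x)`, `V' = DF(x) ∘ V`. -/
def variationalField (F : E → E) (q : E × (E →L[ℝ] E) × (E →L[ℝ] E)) :
    E × (E →L[ℝ] E) × (E →L[ℝ] E) :=
  (F q.1, -(q.2.1 * fderiv ℝ F q.1), fderiv ℝ F q.1 * q.2.2)

lemma contDiffOn_variationalField {F : E → E} {O : Set E} (hO : IsOpen O)
    (hF : ContDiffOn ℝ ∞ F O) : ContDiffOn ℝ ∞ (variationalField F) (O ×ˢ univ) := by
  have h1 : ContDiffOn ℝ ∞ (fun q : E × (E →L[ℝ] E) × (E →L[ℝ] E) ↦ F q.1) (O ×ˢ univ) :=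
    hF.comp contDiff_fst.contDiffOn fun q hq ↦ hq.1
  have h2 : ContDiffOn ℝ ∞ (fun q : E × (E →L[ℝ] E) × (E →L[ℝ] E) ↦ fderiv ℝ F q.1)
      (O ×ˢ univ) :=
    (hF.fderiv_of_isOpen hO (m := ∞) (by simp)).comp contDiff_fst.contDiffOn fun q hq ↦ hq.1
  exact h1.prodMk ((((contDiff_fst.comp contDiff_snd).contDiffOn).clm_comp h2).neg.prodMk
    (h2.clm_comp ((contDiff_snd.comp contDiff_snd).contDiffOn)))

/-- Solutions of a smooth autonomous equation on an open interval are smooth. -/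
lemma contDiffOn_of_hasDerivAt_autonomous [CompleteSpace E] {G : E → E} {S : Set E} (hG : ContDiffOn ℝ ∞ G S)
    {ε : ℝ} {y : ℝ → E} (hy : ∀ t ∈ Ioo (-ε) ε, y t ∈ S ∧ HasDerivAt y (G (y t)) t) :
    ContDiffOn ℝ ∞ y (Ioo (-ε) ε) := by
  intro t ht
  obtain ⟨p, hp1, hp2⟩ := exists_between ht.1
  obtain ⟨q, hq1, hq2⟩ := exists_between ht.2
  have hsub : Icc p q ⊆ Ioo (-ε) ε := fun r hr ↦ ⟨hp1.trans_le hr.1, hr.2.trans_lt hq2⟩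
  have key : ContDiffOn ℝ ∞ y (Icc p q) := by
    refine ODE.contDiffOn_enat_Icc_of_hasDerivWithinAt (n := ⊤) (f := fun _ ↦ G) (u := S) ?_
      (fun r hr ↦ (hy r (hsub hr)).2.hasDerivWithinAt) (fun r hr ↦ (hy r (hsub hr)).1)
    exact hG.comp contDiff_snd.contDiffOn fun q hq ↦ hq.2
  exact ((key t ⟨hp2.le, hq1.le⟩).contDiffAt (Icc_mem_nhds hp2 hq1)).contDiffWithinAt

/-- The second order Taylor estimate for a map with Lipschitz derivative on a ball. -/
lemma norm_taylor_le_of_lipschitzOnWith_fderiv {F : E → E} {x₀ : E} {R : ℝ} {K : NNReal}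
    (hF : DifferentiableOn ℝ F (Metric.ball x₀ R))
    (hK : LipschitzOnWith K (fderiv ℝ F) (Metric.ball x₀ R)) {x y : E}
    (hx : x ∈ Metric.ball x₀ R) (hy : y ∈ Metric.ball x₀ R) :
    ‖F y - F x - fderiv ℝ F x (y - x)‖ ≤ K * ‖y - x‖ ^ 2 := by
  have hseg : segment ℝ x y ⊆ Metric.ball x₀ R := (convex_ball x₀ R).segment_subset hx hy
  have h := (convex_segment x y).norm_image_sub_le_of_norm_hasFDerivWithin_le'
    (f := F) (f' := fderiv ℝ F) (φ := fderiv ℝ F x) (C := K * ‖y - x‖)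
    (fun z hz ↦ ((hF z (hseg hz)).differentiableAt
      (Metric.isOpen_ball.mem_nhds (hseg hz))).hasFDerivAt.hasFDerivWithinAt)
    (fun z hz ↦ by
      refine (hK.norm_sub_le (hseg hz) hx).trans ?_
      gcongr
      exact norm_sub_le_of_mem_segment hz)
    (left_mem_segment ℝ x y) (right_mem_segment ℝ x y)
  calc _ ≤ _ := h
    _ = _ := by ring

/-- Grönwall and uniqueness theorems ask for derivatives within a half-line; for `r < q` the
interval `[p, q]` contains a right neighbourhood of `r`. -/
lemma hasDerivWithinAt_Icc_Ici {y : ℝ → E} {y' : E} {p q r : ℝ} (hr : r ∈ Ico p q)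
    (h : HasDerivWithinAt y y' (Icc p q) r) : HasDerivWithinAt y y' (Ici r) r :=
  h.mono_of_mem_nhdsWithin
    (mem_nhdsWithin.2 ⟨Iio q, isOpen_Iio, hr.2, fun _ hz ↦ ⟨hr.1.trans hz.2, le_of_lt hz.1⟩⟩)

lemma hasDerivWithinAt_Icc_Iic {y : ℝ → E} {y' : E} {p q r : ℝ} (hr : r ∈ Ioc p q)
    (h : HasDerivWithinAt y y' (Icc p q) r) : HasDerivWithinAt y y' (Iic r) r :=
  h.mono_of_mem_nhdsWithin
    (mem_nhdsWithin.2 ⟨Ioi p, isOpen_Ioi, hr.1, fun _ hz ↦ ⟨le_of_lt hz.1, hz.2.trans hr.2⟩⟩)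

/-- Along a solution `x` of `x' = F x`, with `Z` and `V` the mutually inverse solutions of the
adjoint and of the linearized equation, a nearby solution deviates from the solution of the
linearized equation by a quadratic error. -/
lemma norm_sub_linearized_le {F : E → E} {x₀ : E} {R : ℝ} {K K' : NNReal}
    (hF : DifferentiableOn ℝ F (Metric.ball x₀ R))
    (hK : LipschitzOnWith K F (Metric.ball x₀ R))
    (hK' : LipschitzOnWith K' (fderiv ℝ F) (Metric.ball x₀ R))
    {s t : ℝ} (hst : s ≤ t) {x g : ℝ → E} {Z : ℝ → E →L[ℝ] E} {V : E →L[ℝ] E}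
    (hx : ∀ r ∈ Icc s t, x r ∈ Metric.ball x₀ R ∧ HasDerivAt x (F (x r)) r)
    (hZ : ∀ r ∈ Icc s t, HasDerivAt Z (-(Z r * fderiv ℝ F (x r))) r)
    (hVZ : V * Z t = 1) {C : ℝ} (hC : ∀ r ∈ Icc s t, ‖Z r‖ ≤ C)
    (hg : ∀ r ∈ Icc s t, g r ∈ Metric.ball x₀ R ∧ HasDerivWithinAt g (F (g r)) (Icc s t) r) :
    ‖g t - x t - (V * Z s) (g s - x s)‖ ≤
      ‖V‖ * (C * (K' * Real.exp (K * (t - s)) ^ 2) * (t - s)) * ‖g s - x s‖ ^ 2 := by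
  have hC0 : 0 ≤ C := (norm_nonneg _).trans (hC s ⟨le_rfl, hst⟩)
  -- Grönwall: two solutions separate at most by the factor `exp (K (t - s))`.
  have hD : ∀ r ∈ Icc s t, ‖g r - x r‖ ≤ ‖g s - x s‖ * Real.exp (K * (t - s)) := by
    intro r hr
    have h := dist_le_of_trajectories_ODE_of_mem (v := fun _ ↦ F) (f := g) (g := x)
      (s := fun _ ↦ Metric.ball x₀ R) (a := s) (b := t) (K := K) (δ := ‖g s - x s‖)
      (fun _ _ ↦ hK) (fun r hr ↦ (hg r hr).2.continuousWithinAt)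
      (fun r hr ↦ hasDerivWithinAt_Icc_Ici hr (hg r (Ico_subset_Icc_self hr)).2)
      (fun r hr ↦ (hg r (Ico_subset_Icc_self hr)).1)
      (fun r hr ↦ (hx r hr).2.continuousAt.continuousWithinAt)
      (fun r hr ↦ (hx r (Ico_subset_Icc_self hr)).2.hasDerivWithinAt)
      (fun r hr ↦ (hx r (Ico_subset_Icc_self hr)).1) (dist_eq_norm _ _).le r hr
    rw [dist_eq_norm] at h
    refine h.trans ?_
    gcongr
    exact hr.2
  -- Applying `Z` cancels the linear part of the equation for `g - x`; only the second order Taylor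
  -- remainder of `F` is left.
  have hh : ∀ r ∈ Icc s t, HasDerivWithinAt (fun r ↦ Z r (g r - x r))
      (Z r (F (g r) - F (x r) - fderiv ℝ F (x r) (g r - x r))) (Icc s t) r := by
    intro r hr
    have h1 := (hZ r hr).hasDerivWithinAt.clm_apply
      ((hg r hr).2.sub (hx r hr).2.hasDerivWithinAt)
    refine h1.congr_deriv ?_
    simp only [neg_apply, mul_apply_eq_comp, Pi.sub_apply, map_sub]
    abel
  have hb := norm_image_sub_le_of_norm_deriv_le_segment' hh
    (C := C * (K' * Real.exp (K * (t - s)) ^ 2) * ‖g s - x s‖ ^ 2) (fun r hr ↦ by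
      have hr' := Ico_subset_Icc_self hr
      calc _ ≤ ‖Z r‖ * ‖F (g r) - F (x r) - fderiv ℝ F (x r) (g r - x r)‖ :=
            ContinuousLinearMap.le_opNorm _ _
        _ ≤ C * (K' * (‖g s - x s‖ * Real.exp (K * (t - s))) ^ 2) := by
            gcongr
            · exact hC r hr'
            · refine (norm_taylor_le_of_lipschitzOnWith_fderiv hF hK' (hx r hr').1
                (hg r hr').1).trans ?_
              gcongr
              exact hD r hr'
        _ = _ := by ring) t ⟨hst, le_rfl⟩
  have he : g t - x t - (V * Z s) (g s - x s) = V (Z t (g t - x t) - Z s (g s - x s)) := by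
    have h1 : V (Z t (g t - x t)) = g t - x t := congrArg (fun B : E →L[ℝ] E ↦ B (g t - x t)) hVZ
    rw [map_sub V, h1]
    rfl
  rw [he]
  calc _ ≤ ‖V‖ * ‖Z t (g t - x t) - Z s (g s - x s)‖ := ContinuousLinearMap.le_opNorm _ _
    _ ≤ _ := by
      refine (mul_le_mul_of_nonneg_left hb (norm_nonneg _)).trans (le_of_eq ?_)
      ring

/-- Local flow of a smooth vector field `F` near the trajectory `x` through `x₀`, together with the
solutions `Z`, `V` of the adjoint and of the linearized equation along `x`: the derivative of the
flow from time `s` to time `t` at `x s` is `V t * Z s`. -/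
lemma exists_local_flow [FiniteDimensional ℝ E] {F : E → E} {O : Set E} (hO : IsOpen O)
    (hF : ContDiffOn ℝ ∞ F O) {x₀ : E} (hx₀ : x₀ ∈ O) :
    ∃ ε > 0, ∃ (x : ℝ → E) (Z V : ℝ → E →L[ℝ] E), x 0 = x₀ ∧ Z 0 = 1 ∧ V 0 = 1 ∧
      ContDiffOn ℝ ∞ x (Ioo (-ε) ε) ∧ ContDiffOn ℝ ∞ Z (Ioo (-ε) ε) ∧
      (∀ t ∈ Ioo (-ε) ε, x t ∈ O ∧ HasDerivAt x (F (x t)) t ∧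
        HasDerivAt Z (-(Z t * fderiv ℝ F (x t))) t ∧ HasDerivAt V (fderiv ℝ F (x t) * V t) t ∧
        Z t * V t = 1 ∧ V t * Z t = 1) ∧
      ∀ s t, -ε < s → s ≤ t → t < ε → ∃ φ : E → E, HasFDerivAt φ (V t * Z s) (x s) ∧
        ∀ᶠ y in 𝓝 (x s), ∃ g : ℝ → E, g 0 = y ∧ g (t - s) = φ y ∧
          ∀ r ∈ Icc 0 (t - s), g r ∈ O ∧ HasDerivWithinAt g (F (g r)) (Icc 0 (t - s)) r := by
  have := FiniteDimensional.complete ℝ E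
  have hFx : ContDiffAt ℝ ∞ F x₀ := hF.contDiffAt (hO.mem_nhds hx₀)
  obtain ⟨K, S, hS, hK⟩ := (hFx.of_le (n := ∞) (m := 1) (by simp)).exists_lipschitzOnWith
  have hF' : ContDiffOn ℝ ∞ (fderiv ℝ F) O := hF.fderiv_of_isOpen hO (m := ∞) (by simp)
  obtain ⟨K', S', hS', hK'⟩ :=
    ((hF'.contDiffAt (hO.mem_nhds hx₀)).of_le (n := ∞) (m := 1) (by simp)).exists_lipschitzOnWith
  obtain ⟨R, hR, hball⟩ := Metric.mem_nhds_iff.1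
    (Filter.inter_mem (hO.mem_nhds hx₀) (Filter.inter_mem hS hS'))
  have hdiff : DifferentiableOn ℝ F (Metric.ball x₀ R) :=
    (hF.differentiableOn (by simp)).mono fun z hz ↦ (hball hz).1
  replace hK := hK.mono fun z hz ↦ (hball hz).2.1
  replace hK' := hK'.mono fun z hz ↦ (hball hz).2.2
  set q₀ : E × (E →L[ℝ] E) × (E →L[ℝ] E) := (x₀, 1, 1) with hq₀
  have hG := contDiffOn_variationalField hO hF
  have hGat : ContDiffAt ℝ 1 (variationalField F) q₀ :=
    (hG.contDiffAt ((hO.prod isOpen_univ).mem_nhds ⟨hx₀, mem_univ _⟩)).of_le (by simp)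
  -- Picard–Lindelöf for the augmented field yields `x`, `Z` and `V` at once; the neighbouring
  -- trajectories are the first components of the solutions from `(y, 1, 1)`.
  obtain ⟨ε₀, hε₀, a, r, L, K₁, hr, hpl⟩ := IsPicardLindelof.of_contDiffAt_one hGat
  obtain ⟨β, hβ, L', hL'⟩ :=
    (hpl 0).exists_forall_mem_closedBall_eq_hasDerivWithinAt_lipschitzOnWith
  simp only [zero_sub, zero_add] at hβ hL'
  have hq₀r : q₀ ∈ Metric.closedBall q₀ (r : ℝ) := Metric.mem_closedBall_self r.2
  have hβd : ∀ q ∈ Metric.closedBall q₀ (r : ℝ), ∀ t ∈ Ioo (-ε₀) ε₀,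
      HasDerivAt (β q) (variationalField F (β q t)) t := fun q hq t ht ↦
    ((hβ q hq).2 t (Ioo_subset_Icc_self ht)).hasDerivAt (Icc_mem_nhds ht.1 ht.2)
  have h0 : (0 : ℝ) ∈ Ioo (-ε₀) ε₀ := ⟨by linarith, hε₀⟩
  set x : ℝ → E := fun t ↦ (β q₀ t).1 with hx
  set Z : ℝ → E →L[ℝ] E := fun t ↦ (β q₀ t).2.1 with hZ
  set V : ℝ → E →L[ℝ] E := fun t ↦ (β q₀ t).2.2 with hV
  have hx0 : x 0 = x₀ := by simp only [hx]; rw [(hβ q₀ hq₀r).1]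
  have hZ0 : Z 0 = 1 := by simp only [hZ]; rw [(hβ q₀ hq₀r).1]
  have hV0 : V 0 = 1 := by simp only [hV]; rw [(hβ q₀ hq₀r).1]
  have hxc : ContinuousAt x 0 := (hβd q₀ hq₀r 0 h0).continuousAt.fst
  -- `L'` is the Lipschitz constant in the initial value, so trajectories from the `ρ`-ball stay
  -- within `R / 2` of `x`, and `x` stays within `R / 2` of `x₀`: all remain in the ball where `K`
  -- and `K'` are valid.
  set ρ : ℝ := min r (R / (2 * (L' + 1))) with hρ
  have hρ0 : 0 < ρ := lt_min hr (by positivity)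
  have hLρ : L' * ρ ≤ R / 2 := by
    calc (L' : ℝ) * ρ ≤ (L' + 1) * (R / (2 * (L' + 1))) := by
          gcongr
          · linarith
          · exact min_le_right _ _
      _ = R / 2 := by field_simp
  obtain ⟨ε₁, hε₁, hxb⟩ := Metric.continuousAt_iff.1 hxc (R / 2) (by positivity)
  obtain ⟨ε₂, hε₂, hxρ⟩ := Metric.continuousAt_iff.1 hxc ρ hρ0
  simp only [hx0, dist_zero_right, Real.norm_eq_abs] at hxb hxρ
  -- The flow from time `s` to time `t` runs for the time `t - s`, which can come close to `2 * ε`.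
  set ε : ℝ := min (min ε₀ ε₁) ε₂ / 2 with hε
  have hεpos : 0 < ε := by positivity
  have hε0' : 2 * ε ≤ ε₀ := by
    rw [hε]; linarith [min_le_left (min ε₀ ε₁) ε₂, min_le_left ε₀ ε₁]
  have hε1' : 2 * ε ≤ ε₁ := by
    rw [hε]; linarith [min_le_left (min ε₀ ε₁) ε₂, min_le_right ε₀ ε₁]
  have hε2' : 2 * ε ≤ ε₂ := by
    rw [hε]; linarith [min_le_right (min ε₀ ε₁) ε₂]
  have hsub : Ioo (-ε) ε ⊆ Ioo (-ε₀) ε₀ := fun t ht ↦ ⟨by linarith [ht.1], by linarith [ht.2]⟩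
  have hxball : ∀ t, |t| < 2 * ε → x t ∈ Metric.ball x₀ (R / 2) := fun t ht ↦
    hxb (ht.trans_le hε1')
  have hxR : ∀ t, |t| < 2 * ε → x t ∈ Metric.ball x₀ R := fun t ht ↦
    Metric.ball_subset_ball (by linarith) (hxball t ht)
  have habs : ∀ t ∈ Ioo (-ε) ε, |t| < 2 * ε := fun t ht ↦
    (abs_lt.2 ⟨ht.1, ht.2⟩).trans (by linarith)
  have hxd : ∀ t ∈ Ioo (-ε) ε, HasDerivAt x (F (x t)) t := fun t ht ↦
    (hβd q₀ hq₀r t (hsub ht)).fst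
  have hZd : ∀ t ∈ Ioo (-ε) ε, HasDerivAt Z (-(Z t * fderiv ℝ F (x t))) t := fun t ht ↦
    (hβd q₀ hq₀r t (hsub ht)).snd.fst
  have hVd : ∀ t ∈ Ioo (-ε) ε, HasDerivAt V (fderiv ℝ F (x t) * V t) t := fun t ht ↦
    (hβd q₀ hq₀r t (hsub ht)).snd.snd
  have h0ε : (0 : ℝ) ∈ Ioo (-ε) ε := ⟨by linarith, hεpos⟩
  have hZV : ∀ t ∈ Ioo (-ε) ε, Z t * V t = 1 := by
    intro t ht
    have hd : ∀ r ∈ Ioo (-ε) ε, HasDerivAt (fun r ↦ Z r * V r) 0 r := fun r hr ↦ by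
      have := (hZd r hr).mul (hVd r hr)
      refine this.congr_deriv ?_
      rw [neg_mul, mul_assoc, neg_add_cancel]
    have := (convex_Ioo (-ε) ε).is_const_of_fderivWithin_eq_zero (𝕜 := ℝ)
      (f := fun r ↦ Z r * V r)
      (fun r hr ↦ (hd r hr).differentiableAt.differentiableWithinAt)
      (fun r hr ↦ by
        rw [fderivWithin_of_isOpen isOpen_Ioo hr, (hd r hr).hasFDerivAt.fderiv]
        ext; simp) ht h0ε
    simpa [hZ0, hV0] using this
  have hβ_smooth : ContDiffOn ℝ ∞ (β q₀) (Ioo (-ε) ε) :=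
    contDiffOn_of_hasDerivAt_autonomous hG fun t ht ↦
      ⟨⟨(hball (hxR t (habs t ht))).1, mem_univ _⟩, hβd q₀ hq₀r t (hsub ht)⟩
  refine ⟨ε, hεpos, x, Z, V, hx0, hZ0, hV0, hβ_smooth.fst, hβ_smooth.snd.fst, ?_, ?_⟩
  · intro t ht
    have h1 := hZV t ht
    refine ⟨(hball (hxR t (habs t ht))).1, hxd t ht, hZd t ht, hVd t ht, h1, ?_⟩
    -- In finite dimension a one-sided inverse of an endomorphism is two-sided.
    have h2 : (Z t : E →ₗ[ℝ] E) * (V t : E →ₗ[ℝ] E) = 1 := by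
      ext v
      exact congrArg (fun B : E →L[ℝ] E ↦ B v) h1
    ext v
    exact congrArg (fun B : E →ₗ[ℝ] E ↦ B v) (mul_eq_one_comm.1 h2)
  · intro s t hs hst ht
    have hsI : s ∈ Ioo (-ε) ε := ⟨hs, hst.trans_lt ht⟩
    have htI : t ∈ Ioo (-ε) ε := ⟨hs.trans_le hst, ht⟩
    have hsubI : Icc s t ⊆ Ioo (-ε) ε := fun r hr ↦ ⟨hs.trans_le hr.1, hr.2.trans_lt ht⟩
    have hxs : Metric.ball x₀ ρ ∈ 𝓝 (x s) :=
      Metric.isOpen_ball.mem_nhds (hxρ ((habs s hsI).trans_le hε2'))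
    -- the trajectory starting at `y`
    set g : E → ℝ → E := fun y r ↦ (β (y, 1, 1) r).1 with hg
    have hyr : ∀ y ∈ Metric.ball x₀ ρ, (y, 1, 1) ∈ Metric.closedBall q₀ (r : ℝ) := by
      intro y hy
      rw [Metric.mem_closedBall, hq₀, Prod.dist_eq, dist_self]
      exact max_le ((Metric.mem_ball.1 hy).le.trans (min_le_left _ _)) r.2
    have hg0 : ∀ y ∈ Metric.ball x₀ ρ, g y 0 = y := fun y hy ↦ by
      simp [hg, (hβ _ (hyr y hy)).1]
    have htime : ∀ r ∈ Icc 0 (t - s), r ∈ Ioo (-ε₀) ε₀ ∧ |r| < 2 * ε := fun r hr ↦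
      ⟨⟨by linarith [hr.1], by linarith [hr.2, hsI.1, htI.2]⟩,
        abs_lt.2 ⟨by linarith [hr.1], by linarith [hr.2, hsI.1, htI.2]⟩⟩
    have hgR : ∀ y ∈ Metric.ball x₀ ρ, ∀ r ∈ Icc 0 (t - s), g y r ∈ Metric.ball x₀ R := by
      intro y hy r hr
      have h1 := (hL' r (Ioo_subset_Icc_self (htime r hr).1)).dist_le_mul _ (hyr y hy) _ hq₀r
      have h2 : dist (g y r) (x r) ≤ L' * dist y x₀ := by
        refine (le_max_left _ _ : dist (g y r) (x r) ≤ dist (β (y, 1, 1) r) (β q₀ r)).trans ?_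
        refine h1.trans (le_of_eq ?_)
        rw [hq₀, Prod.dist_eq, dist_self, max_eq_left dist_nonneg]
      have h3 : dist y x₀ ≤ ρ := (Metric.mem_ball.1 hy).le
      have h4 := Metric.mem_ball.1 (hxball r (htime r hr).2)
      rw [Metric.mem_ball]
      calc _ ≤ dist (g y r) (x r) + dist (x r) x₀ := dist_triangle _ _ _
        _ < L' * ρ + R / 2 := by
          refine add_lt_add_of_le_of_lt (h2.trans ?_) h4
          gcongr
        _ ≤ R := by linarith
    have hgd : ∀ y ∈ Metric.ball x₀ ρ, ∀ r ∈ Icc 0 (t - s),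
        HasDerivAt (g y) (F (g y r)) r := fun y hy r hr ↦
      (hβd _ (hyr y hy) r (htime r hr).1).fst
    obtain ⟨C, hC⟩ := (isCompact_Icc (a := s) (b := t)).exists_bound_of_continuousOn (f := Z)
      (fun r hr ↦ (hZd r (hsubI hr)).continuousAt.continuousWithinAt)
    have hquad : ∀ y ∈ Metric.ball x₀ ρ, ‖g y (t - s) - x t - (V t * Z s) (y - x s)‖ ≤
        ‖V t‖ * (C * (K' * Real.exp (K * (t - s)) ^ 2) * (t - s)) * ‖y - x s‖ ^ 2 := by
      intro y hy
      have hVZ : V t * Z t = 1 := by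
        have h2 : (Z t : E →ₗ[ℝ] E) * (V t : E →ₗ[ℝ] E) = 1 := by
          ext v
          exact congrArg (fun B : E →L[ℝ] E ↦ B v) (hZV t htI)
        ext v
        exact congrArg (fun B : E →ₗ[ℝ] E ↦ B v) (mul_eq_one_comm.1 h2)
      have hmem : ∀ r ∈ Icc s t, r - s ∈ Icc 0 (t - s) := fun r hr ↦
        ⟨by linarith [hr.1], by linarith [hr.2]⟩
      have := norm_sub_linearized_le hdiff hK hK' hst (x := x) (g := fun r ↦ g y (r - s))
        (Z := Z) (V := V t) (fun r hr ↦ ⟨hxR r (habs r (hsubI hr)), hxd r (hsubI hr)⟩)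
        (fun r hr ↦ hZd r (hsubI hr)) hVZ (C := C) hC
        (fun r hr ↦ ⟨hgR y hy _ (hmem r hr),
          ((hgd y hy _ (hmem r hr)).comp_sub_const r s).hasDerivWithinAt⟩)
      simpa [hg0 y hy] using this
    -- The quadratic estimate at `y = x s` has right hand side zero.
    have hxt : g (x s) (t - s) = x t := by
      have := hquad (x s) (mem_of_mem_nhds hxs)
      simp only [sub_self, map_zero, norm_zero, sub_zero] at this
      simpa [sub_eq_zero] using this
    refine ⟨fun y ↦ g y (t - s), ?_, ?_⟩
    -- The error is of second order in `y - x s`, so its derivative at `x s` is zero.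
    · have h1 : HasFDerivAt (fun y ↦ g y (t - s) - x t - (V t * Z s) (y - x s))
          (0 : E →L[ℝ] E) (x s) := by
        refine Asymptotics.IsBigO.hasFDerivAt (𝕜 := ℝ) (n := 2) ?_ (by norm_num)
        refine Asymptotics.isBigO_iff.2 ⟨
          (‖V t‖ * (C * (K' * Real.exp (K * (t - s)) ^ 2) * (t - s))), ?_⟩
        filter_upwards [hxs] with y hy
        simpa using hquad y hy
      have h2 : HasFDerivAt (fun y ↦ (V t * Z s) (y - x s)) (V t * Z s) (x s) := by
        simpa using (V t * Z s).hasFDerivAt.sub_const ((V t * Z s) (x s))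
      have h3 := (h1.add h2).add_const (x t)
      rw [zero_add] at h3
      refine h3.congr_of_eventuallyEq (Filter.Eventually.of_forall fun y ↦ ?_)
      simp only [Pi.add_apply]
      abel
    · filter_upwards [hxs] with y hy
      exact ⟨g y, hg0 y hy, rfl, fun r hr ↦ ⟨(hball (hgR y hy r hr)).1,
        (hgd y hy r hr).hasDerivWithinAt⟩⟩

end LinearODE

/-! ### Tangent vectors, vector fields and covectors in charts -/

section Coordinates

variable {E H : Type*} [NormedAddCommGroup E] [NormedSpace ℝ E] [TopologicalSpace H]
  (I : ModelWithCorners ℝ E H) {M : Type*} [TopologicalSpace M] [ChartedSpace H M]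
  [IsManifold I ∞ M]

/-- The coordinates of tangent vectors at `x` in the chart centred at `x₀`. -/
def toCoord (x₀ x : M) : TangentSpace I x →L[ℝ] E :=
  (trivializationAt E (TangentSpace I) x₀).continuousLinearMapAt ℝ x

/-- The tangent vector at `x` with given coordinates in the chart centred at `x₀`. -/
def ofCoord (x₀ x : M) : E →L[ℝ] TangentSpace I x :=
  (trivializationAt E (TangentSpace I) x₀).symmL ℝ x

variable {x₀ x : M}

lemma toCoord_ofCoord (hx : x ∈ (chartAt H x₀).source) (v : E) :
    toCoord I x₀ x (ofCoord I x₀ x v) = v :=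
  (trivializationAt E (TangentSpace I) x₀).continuousLinearMapAt_symmL (by simpa using hx) v

lemma ofCoord_toCoord (hx : x ∈ (chartAt H x₀).source) (v : TangentSpace I x) :
    ofCoord I x₀ x (toCoord I x₀ x v) = v :=
  (trivializationAt E (TangentSpace I) x₀).symmL_continuousLinearMapAt (by simpa using hx) v

lemma toCoord_eq_mfderiv (hx : x ∈ (chartAt H x₀).source) :
    toCoord I x₀ x = mfderiv I 𝓘(ℝ, E) (extChartAt I x₀) x :=
  TangentBundle.continuousLinearMapAt_trivializationAt hx

/-- The tangent space at `x` is the model space by definition, and the chart centred at `x` realizes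
this identification. It allows vectors at the base point to be used as their own coordinates. -/
lemma toCoord_self (v : TangentSpace I x) : toCoord I x x v = v := by
  rw [toCoord_eq_mfderiv I (mem_chart_source H x), mfderiv_extChartAt_self]
  rfl

lemma ofCoord_self (v : E) : ofCoord I x x v = (v : TangentSpace I x) := by
  rw [← toCoord_self I (ofCoord I x x v), toCoord_ofCoord I (mem_chart_source H x)]

lemma hasMFDerivAt_extChartAt_toCoord (hx : x ∈ (chartAt H x₀).source) :
    HasMFDerivAt I 𝓘(ℝ, E) (extChartAt I x₀) x (toCoord I x₀ x) := by
  rw [toCoord_eq_mfderiv I hx]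
  exact (mdifferentiableAt_extChartAt hx).hasMFDerivAt

/-- Without boundary the range of the model is the whole space, so the derivative within the range
is a full derivative. -/
lemma hasMFDerivAt_extChartAt_symm_ofCoord [I.Boundaryless] {y : E}
    (hy : y ∈ (extChartAt I x₀).target) :
    HasMFDerivAt 𝓘(ℝ, E) I (extChartAt I x₀).symm y (ofCoord I x₀ ((extChartAt I x₀).symm y)) := by
  have hx : (extChartAt I x₀).symm y ∈ (chartAt H x₀).source := by
    rw [← extChartAt_source I]; exact (extChartAt I x₀).map_target hy
  have h := (mdifferentiableWithinAt_extChartAt_symm hy).hasMFDerivWithinAt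
  have h2 := TangentBundle.symmL_trivializationAt (I := I) hx
  rw [(extChartAt I x₀).right_inv hy] at h2
  rw [ofCoord, h2]
  rw [I.range_eq_univ] at h ⊢
  rwa [hasMFDerivWithinAt_univ] at h

/-- A curve has a velocity iff it has one in a chart. -/
lemma hasDerivWithinAt_extChartAt_comp {γ : ℝ → M} {s : Set ℝ} {t : ℝ} {v : TangentSpace I (γ t)}
    (hsrc : γ t ∈ (chartAt H x₀).source)
    (h : HasMFDerivWithinAt 𝓘(ℝ, ℝ) I γ s t ((1 : ℝ →L[ℝ] ℝ).smulRight v)) :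
    HasDerivWithinAt (extChartAt I x₀ ∘ γ) (toCoord I x₀ (γ t) v) s t := by
  have h1 := (hasMFDerivAt_extChartAt_toCoord I hsrc).comp_hasMFDerivWithinAt t h
  rw [hasDerivWithinAt_iff_hasFDerivWithinAt]
  refine h1.hasFDerivWithinAt.congr_fderiv ?_
  ext
  change toCoord I x₀ (γ t) ((1 : ℝ) • v) = (1 : ℝ) • toCoord I x₀ (γ t) v
  simp

lemma hasMFDerivWithinAt_extChartAt_symm_comp [I.Boundaryless] {y : ℝ → E} {y' : E} {s : Set ℝ}
    {t : ℝ} (hy : y t ∈ (extChartAt I x₀).target) (h : HasDerivWithinAt y y' s t) :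
    HasMFDerivWithinAt 𝓘(ℝ, ℝ) I ((extChartAt I x₀).symm ∘ y) s t
      ((1 : ℝ →L[ℝ] ℝ).smulRight (ofCoord I x₀ ((extChartAt I x₀).symm (y t)) y')) := by
  have h1 := (hasMFDerivAt_extChartAt_symm_ofCoord I hy).comp_hasMFDerivWithinAt t
    (hasDerivWithinAt_iff_hasFDerivWithinAt.1 h).hasMFDerivWithinAt
  refine h1.congr_mfderiv ?_
  ext
  change ofCoord I x₀ ((extChartAt I x₀).symm (y t)) ((1 : ℝ) • y') =
    (1 : ℝ) • ofCoord I x₀ ((extChartAt I x₀).symm (y t)) y'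
  rw [one_smul]
  exact (one_smul ℝ _).symm

/-- A vector field in the chart centred at `x₀`. -/
def coordField (v : ∀ x : M, TangentSpace I x) (x₀ : M) (y : E) : E :=
  toCoord I x₀ ((extChartAt I x₀).symm y) (v ((extChartAt I x₀).symm y))

lemma coordField_extChartAt (v : ∀ x : M, TangentSpace I x) (hx : x ∈ (chartAt H x₀).source) :
    coordField I v x₀ (extChartAt I x₀ x) = toCoord I x₀ x (v x) := by
  rw [← extChartAt_source I] at hx
  rw [coordField, (extChartAt I x₀).left_inv hx]

/-- The part of the chart domain at `x₀` that corresponds to an open set `W`. -/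
def coordDom (W : Set M) (x₀ : M) : Set E :=
  (extChartAt I x₀).target ∩ (extChartAt I x₀).symm ⁻¹' W

omit [IsManifold I ∞ M] in
lemma isOpen_coordDom [I.Boundaryless] {W : Set M} (hW : IsOpen W) (x₀ : M) :
    IsOpen (coordDom I W x₀) :=
  (continuousOn_extChartAt_symm x₀).isOpen_inter_preimage (isOpen_extChartAt_target x₀) hW

omit [IsManifold I ∞ M] in
lemma extChartAt_mem_coordDom {W : Set M} (hx : x ∈ (chartAt H x₀).source) (hxW : x ∈ W) :
    extChartAt I x₀ x ∈ coordDom I W x₀ := by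
  rw [← extChartAt_source I] at hx
  refine ⟨(extChartAt I x₀).map_source hx, ?_⟩
  rwa [mem_preimage, (extChartAt I x₀).left_inv hx]

lemma contMDiffAt_toCoord {N EN HN : Type*} [NormedAddCommGroup EN] [NormedSpace ℝ EN]
    [TopologicalSpace HN] {J : ModelWithCorners ℝ EN HN} [TopologicalSpace N] [ChartedSpace HN N]
    {f : N → TangentBundle I M} {n : N} {s : Set N} (hf : ContMDiffWithinAt J I.tangent ∞ f s n)
    (hn : (f n).1 ∈ (chartAt H x₀).source) :
    ContMDiffWithinAt J 𝓘(ℝ, E) ∞ (fun z ↦ toCoord I x₀ (f z).1 (f z).2) s n := by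
  set e := trivializationAt E (TangentSpace I : M → Type _) x₀ with he
  have h := ((e.contMDiffWithinAt_iff (IB := I) (by rw [e.mem_source]; simpa [he] using hn)).1 hf)
  have hmem : ∀ z, (f z).1 ∈ (chartAt H x₀).source →
      toCoord I x₀ (f z).1 (f z).2 = (e (f z)).2 := by
    intro z hz
    change e.linearMapAt ℝ (f z).1 (f z).2 = _
    rw [e.linearMapAt_apply, if_pos (by simpa [he] using hz)]
  refine h.2.congr_of_eventuallyEq ?_ (hmem n hn)
  filter_upwards [h.1.continuousWithinAt.preimage_mem_nhdsWithin
    ((chartAt H x₀).open_source.mem_nhds hn)] with z hz using hmem z hz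

lemma contDiffOn_coordField [I.Boundaryless] {v : ∀ x : M, TangentSpace I x} {W : Set M}
    (hv : ContMDiffOn I I.tangent ∞ (fun x ↦ (⟨x, v x⟩ : TangentBundle I M)) W) (x₀ : M) :
    ContDiffOn ℝ ∞ (coordField I v x₀) (coordDom I W x₀) := by
  intro y hy
  have hx : (extChartAt I x₀).symm y ∈ (chartAt H x₀).source := by
    rw [← extChartAt_source I]; exact (extChartAt I x₀).map_target hy.1
  have h1 := contMDiffAt_toCoord I (hv _ hy.2) hx
  have h2 := (contMDiffOn_extChartAt_symm (n := ∞) (I := I) x₀).mono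
    (inter_subset_left : coordDom I W x₀ ⊆ _) y hy
  exact (h1.comp y h2 fun z hz ↦ hz.2).contDiffWithinAt

/-- Covectors in coordinates. -/
lemma inCoordinates_covector (x₀ x : M) (α : TangentSpace I x →L[ℝ] ℝ) :
    ContinuousLinearMap.inCoordinates E (TangentSpace I : M → Type _) ℝ (fun _ : M ↦ ℝ)
      x₀ x x₀ x α = α.comp (ofCoord I x₀ x) := by
  ext v
  simp [ContinuousLinearMap.inCoordinates, ofCoord]

/-- The trivialization of `T*M` centred at the base point of `f t` reads a covector by composing it
with `ofCoord`, which reduces smoothness to that of a curve in a fixed vector space. -/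
lemma contMDiffWithinAt_cotangent_iff {f : ℝ → Cotangent I M} {s : Set ℝ} {t : ℝ} :
    ContMDiffWithinAt 𝓘(ℝ, ℝ) (I.prod 𝓘(ℝ, E →L[ℝ] ℝ)) ∞ f s t ↔
      ContMDiffWithinAt 𝓘(ℝ, ℝ) I ∞ (fun r ↦ (f r).1) s t ∧
      ContDiffWithinAt ℝ ∞ (fun r ↦ (f r).2.comp (ofCoord I (f t).1 (f r).1)) s t := by
  rw [contMDiffWithinAt_hom_bundle, ← contMDiffWithinAt_iff_contDiffWithinAt]
  simp only [inCoordinates_covector]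

end Coordinates

/-! ### Integral curves on a manifold: uniqueness, concatenation, flow maps -/

section Flow

variable {E H : Type*} [NormedAddCommGroup E] [NormedSpace ℝ E] [TopologicalSpace H]
  {I : ModelWithCorners ℝ E H} {M : Type*} [TopologicalSpace M] [ChartedSpace H M]
  [IsManifold I ∞ M] {v : ∀ x : M, TangentSpace I x} {W : Set M}

lemma hasDerivWithinAt_coordField {γ : ℝ → M} {s : Set ℝ} {t : ℝ} {x₀ : M}
    (hγ : IsMIntegralCurveOn (I := I) γ v s) (ht : t ∈ s) (hsrc : γ t ∈ (chartAt H x₀).source) :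
    HasDerivWithinAt (extChartAt I x₀ ∘ γ) (coordField I v x₀ (extChartAt I x₀ (γ t))) s t := by
  rw [coordField_extChartAt I v hsrc]
  exact hasDerivWithinAt_extChartAt_comp I hsrc (hγ t ht)

lemma isMIntegralCurveOn_extChartAt_symm [I.Boundaryless] {y : ℝ → E} {s : Set ℝ} {x₀ : M}
    (hy : ∀ t ∈ s, y t ∈ coordDom I W x₀ ∧ HasDerivWithinAt y (coordField I v x₀ (y t)) s t) :
    IsMIntegralCurveOn (I := I) ((extChartAt I x₀).symm ∘ y) v s := by
  intro t ht
  have h := hasMFDerivWithinAt_extChartAt_symm_comp I (hy t ht).1.1 (hy t ht).2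
  have hx : (extChartAt I x₀).symm (y t) ∈ (chartAt H x₀).source := by
    rw [← extChartAt_source I]; exact (extChartAt I x₀).map_target (hy t ht).1.1
  rw [coordField, ofCoord_toCoord I hx] at h
  exact h

/-- Uniqueness of integral curves on closed intervals. -/
lemma isMIntegralCurveOn_Icc_eqOn [I.Boundaryless] [CompleteSpace E] [T2Space M] (hW : IsOpen W)
    (hv : ContMDiffOn I I.tangent ∞ (fun x ↦ (⟨x, v x⟩ : TangentBundle I M)) W)
    {γ₁ γ₂ : ℝ → M} {h : ℝ}
    (h₁ : IsMIntegralCurveOn (I := I) γ₁ v (Icc 0 h)) (w₁ : ∀ r ∈ Icc 0 h, γ₁ r ∈ W)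
    (h₂ : IsMIntegralCurveOn (I := I) γ₂ v (Icc 0 h))
    (h0 : γ₁ 0 = γ₂ 0) : EqOn γ₁ γ₂ (Icc 0 h) := by
  -- The agreement set is closed as `M` is Hausdorff; from an instant of agreement, Lipschitz
  -- uniqueness in a chart extends agreement to the right.
  refine IsClosed.Icc_subset_of_forall_exists_gt (s := {r | γ₁ r = γ₂ r}) ?_ h0 ?_
  · have := (h₁.continuousOn.prodMk h₂.continuousOn).preimage_isClosed_of_isClosed isClosed_Icc
      (isClosed_diagonal (X := M))
    rw [inter_comm]
    exact this
  · rintro t ⟨ht, ht0, hth⟩ y hy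
    set x₀ := γ₁ t with hx₀
    have htI : t ∈ Icc 0 h := ⟨ht0, hth.le⟩
    have hO := isOpen_coordDom I hW x₀
    have hF := contDiffOn_coordField I hv x₀
    have hy₀ : extChartAt I x₀ x₀ ∈ coordDom I W x₀ :=
      extChartAt_mem_coordDom I (mem_chart_source H x₀) (w₁ t htI)
    obtain ⟨K, S, hS, hK⟩ := ((hF.contDiffAt (hO.mem_nhds hy₀)).of_le (n := ∞) (m := 1)
      (by simp)).exists_lipschitzOnWith
    have key : ∀ γ : ℝ → M, IsMIntegralCurveOn (I := I) γ v (Icc 0 h) → γ t = x₀ →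
        {r | γ r ∈ (chartAt H x₀).source ∧ extChartAt I x₀ (γ r) ∈ S} ∈ 𝓝[≥] t := by
      intro γ hγ hγt
      have hc : ContinuousWithinAt γ (Icc t h) t :=
        (hγ.continuousOn t htI).mono (Icc_subset_Icc_left ht0)
      rw [← nhdsWithin_Icc_eq_nhdsGE hth]
      have h1 : (chartAt H x₀).source ∩ extChartAt I x₀ ⁻¹' S ∈ 𝓝 (γ t) := by
        rw [hγt]
        exact Filter.inter_mem ((chartAt H x₀).open_source.mem_nhds (mem_chart_source H x₀))
          ((continuousAt_extChartAt x₀).preimage_mem_nhds hS)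
      exact hc.preimage_mem_nhdsWithin h1
    obtain ⟨q, hq, hsub⟩ := mem_nhdsGE_iff_exists_Icc_subset.1
      (Filter.inter_mem (key γ₁ h₁ rfl) (key γ₂ h₂ ht.symm))
    set p := min q (min y h) with hp
    have htp : t < p := lt_min hq (lt_min hy hth)
    have hpq : p ≤ q := min_le_left _ _
    have hph : p ≤ h := (min_le_right _ _).trans (min_le_right _ _)
    have hpy : p ≤ y := (min_le_right _ _).trans (min_le_left _ _)
    have hI : Icc t p ⊆ Icc 0 h := Icc_subset_Icc ht0 hph
    have hder : ∀ γ : ℝ → M, IsMIntegralCurveOn (I := I) γ v (Icc 0 h) →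
        (∀ r ∈ Icc t p, γ r ∈ (chartAt H x₀).source) → ∀ r ∈ Icc t p,
        HasDerivWithinAt (extChartAt I x₀ ∘ γ) (coordField I v x₀ (extChartAt I x₀ (γ r)))
          (Icc t p) r := fun γ hγ hs r hr ↦
      (hasDerivWithinAt_coordField hγ (hI hr) (hs r hr)).mono hI
    have s₁ : ∀ r ∈ Icc t p, γ₁ r ∈ (chartAt H x₀).source := fun r hr ↦
      (hsub ⟨hr.1, hr.2.trans hpq⟩).1.1
    have s₂ : ∀ r ∈ Icc t p, γ₂ r ∈ (chartAt H x₀).source := fun r hr ↦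
      (hsub ⟨hr.1, hr.2.trans hpq⟩).2.1
    have heq := ODE_solution_unique_of_mem_Icc_right (v := fun _ ↦ coordField I v x₀)
      (s := fun _ ↦ S) (K := K) (f := extChartAt I x₀ ∘ γ₁) (g := extChartAt I x₀ ∘ γ₂)
      (a := t) (b := p) (fun _ _ ↦ hK)
      (fun r hr ↦ (hder γ₁ h₁ s₁ r hr).continuousWithinAt)
      (fun r hr ↦ hasDerivWithinAt_Icc_Ici hr (hder γ₁ h₁ s₁ r (Ico_subset_Icc_self hr)))
      (fun r hr ↦ (hsub ⟨hr.1, hr.2.le.trans hpq⟩).1.2)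
      (fun r hr ↦ (hder γ₂ h₂ s₂ r hr).continuousWithinAt)
      (fun r hr ↦ hasDerivWithinAt_Icc_Ici hr (hder γ₂ h₂ s₂ r (Ico_subset_Icc_self hr)))
      (fun r hr ↦ (hsub ⟨hr.1, hr.2.le.trans hpq⟩).2.2)
      (congrArg (extChartAt I x₀) ht) ⟨htp.le, le_rfl⟩
    refine ⟨p, ?_, htp, hpy⟩
    refine (extChartAt I x₀).injOn ?_ ?_ heq
    · rw [extChartAt_source]; exact s₁ p ⟨htp.le, le_rfl⟩
    · rw [extChartAt_source]; exact s₂ p ⟨htp.le, le_rfl⟩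

/-- `flowMap` picks an integral curve by choice; uniqueness makes the pick irrelevant. -/
lemma flowMap_eq [I.Boundaryless] [CompleteSpace E] [T2Space M] (hW : IsOpen W)
    (hv : ContMDiffOn I I.tangent ∞ (fun x ↦ (⟨x, v x⟩ : TangentBundle I M)) W)
    {γ : ℝ → M} {h : ℝ} (hh : 0 ≤ h)
    (hγ : IsMIntegralCurveOn (I := I) γ v (Icc 0 h)) (hw : ∀ r ∈ Icc 0 h, γ r ∈ W) :
    flowMap I v W h (γ 0) = γ h := by
  have hex : ∃ γ' : ℝ → M, γ' 0 = γ 0 ∧ (∀ s ∈ uIcc 0 h, γ' s ∈ W) ∧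
      IsMIntegralCurveOn (I := I) γ' v (uIcc 0 h) := by
    rw [uIcc_of_le hh]; exact ⟨γ, rfl, hw, hγ⟩
  rw [flowMap, dif_pos hex]
  obtain ⟨e1, e2, e3⟩ := hex.choose_spec
  have hI : Icc 0 h ⊆ uIcc 0 h := Icc_subset_uIcc
  exact isMIntegralCurveOn_Icc_eqOn hW hv (e3.mono hI) (fun r hr ↦ e2 r (hI hr)) hγ e1 ⟨hh, le_rfl⟩

omit [IsManifold I ∞ M] in
-- It holds outside `W` too, where the junk value is `x` itself. Hence pieces of zero duration drop
-- out of a composite flow unconditionally.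
lemma flowMap_zero (x : M) : flowMap I v W 0 x = x := by
  unfold flowMap
  split_ifs with h
  · exact h.choose_spec.1
  · rfl

omit [IsManifold I ∞ M] in
/-- Concatenation of integral curves. -/
lemma exists_isMIntegralCurveOn_concat {γ₁ γ₂ : ℝ → M} {h₁ h₂ : ℝ} (hh₁ : 0 ≤ h₁) (hh₂ : 0 ≤ h₂)
    (c₁ : IsMIntegralCurveOn (I := I) γ₁ v (Icc 0 h₁)) (w₁ : ∀ r ∈ Icc 0 h₁, γ₁ r ∈ W)
    (c₂ : IsMIntegralCurveOn (I := I) γ₂ v (Icc 0 h₂)) (w₂ : ∀ r ∈ Icc 0 h₂, γ₂ r ∈ W)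
    (h0 : γ₂ 0 = γ₁ h₁) :
    ∃ γ : ℝ → M, γ 0 = γ₁ 0 ∧ γ (h₁ + h₂) = γ₂ h₂ ∧ (∀ r ∈ Icc 0 (h₁ + h₂), γ r ∈ W) ∧
      IsMIntegralCurveOn (I := I) γ v (Icc 0 (h₁ + h₂)) := by
  classical
  set γ : ℝ → M := fun r ↦ if r ≤ h₁ then γ₁ r else γ₂ (r - h₁) with hγ
  have e₁ : EqOn γ γ₁ (Iic h₁) := fun r hr ↦ if_pos hr
  have e₂ : EqOn γ (γ₂ ∘ (· + -h₁)) (Ici h₁) := by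
    intro r hr
    rcases eq_or_lt_of_le (show h₁ ≤ r from hr) with rfl | hr
    · simp [hγ, h0]
    · simp only [hγ, if_neg (not_le.2 hr)]
      rfl
  have c₂' : IsMIntegralCurveOn (I := I) (γ₂ ∘ (· + -h₁)) v (Icc h₁ (h₁ + h₂)) := by
    have := c₂.comp_add (-h₁)
    convert! this using 1
    ext r
    simp only [mem_Icc, mem_ofPred_eq]
    constructor <;> rintro ⟨h1, h2⟩ <;> constructor <;> linarith
  have d₁ : IsMIntegralCurveOn (I := I) γ v (Icc 0 h₁) := by
    intro r hr
    rw [e₁ hr.2]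
    exact HasMFDerivWithinAt.congr_mono (c₁ r hr) (fun z hz ↦ e₁ hz.2) (e₁ hr.2) subset_rfl
  have d₂ : IsMIntegralCurveOn (I := I) γ v (Icc h₁ (h₁ + h₂)) := by
    intro r hr
    rw [e₂ hr.1]
    exact HasMFDerivWithinAt.congr_mono (c₂' r hr) (fun z hz ↦ e₂ hz.1) (e₂ hr.1) subset_rfl
  refine ⟨γ, e₁ hh₁, ?_, ?_, ?_⟩
  · rw [e₂ (by simpa using hh₂)]
    simp
  · intro r hr
    rcases le_total r h₁ with h | h
    · rw [e₁ h]; exact w₁ r ⟨hr.1, h⟩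
    · rw [e₂ h]; exact w₂ _ ⟨by linarith, by linarith [hr.2]⟩
  · intro r hr
    rcases lt_trichotomy r h₁ with h | h | h
    · refine (d₁ r ⟨hr.1, h.le⟩).mono_of_mem_nhdsWithin ?_
      exact mem_nhdsWithin.2 ⟨Iio h₁, isOpen_Iio, h, fun z hz ↦ ⟨hz.2.1, le_of_lt hz.1⟩⟩
    · have := (d₁ r ⟨hr.1, h.le⟩).union (d₂ r ⟨h.ge, hr.2⟩)
      rwa [Icc_union_Icc_eq_Icc hh₁ (by linarith)] at this
    · refine (d₂ r ⟨h.le, hr.2⟩).mono_of_mem_nhdsWithin ?_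
      exact mem_nhdsWithin.2 ⟨Ioi h₁, isOpen_Ioi, h, fun z hz ↦ ⟨le_of_lt hz.1, hz.2.2⟩⟩

/-- The flow of `v` inside `W` for the time `h ≥ 0` is defined near `p`, takes `p` to `q`, and has
the invertible derivative `A` at `p`. -/
structure HasFlowDeriv (v : ∀ x : M, TangentSpace I x) (W : Set M) (h : ℝ) (p q : M)
    (A : TangentSpace I p →L[ℝ] TangentSpace I q) : Prop where
  nonneg : 0 ≤ h
  curves : ∀ᶠ y in 𝓝 p, ∃ γ : ℝ → M, γ 0 = y ∧ (∀ r ∈ Icc 0 h, γ r ∈ W) ∧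
    IsMIntegralCurveOn (I := I) γ v (Icc 0 h)
  map_eq : flowMap I v W h p = q
  deriv : HasMFDerivAt I I (flowMap I v W h) p A
  bijective : Function.Bijective A

/-- The semigroup law near `p`: by continuity points near `p` are carried near `q`, where curves of
duration `h₂` exist, and the concatenated curve computes the flow for the total time. -/
lemma HasFlowDeriv.eventually_comp [I.Boundaryless] [CompleteSpace E] [T2Space M] (hW : IsOpen W)
    (hv : ContMDiffOn I I.tangent ∞ (fun x ↦ (⟨x, v x⟩ : TangentBundle I M)) W)
    {h₁ h₂ : ℝ} {p q r : M} {A : TangentSpace I p →L[ℝ] TangentSpace I q}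
    {B : TangentSpace I q →L[ℝ] TangentSpace I r}
    (H₁ : HasFlowDeriv v W h₁ p q A) (H₂ : HasFlowDeriv v W h₂ q r B) :
    ∀ᶠ y in 𝓝 p, (∃ γ : ℝ → M, γ 0 = y ∧ (∀ r ∈ Icc 0 (h₁ + h₂), γ r ∈ W) ∧
      IsMIntegralCurveOn (I := I) γ v (Icc 0 (h₁ + h₂))) ∧
      flowMap I v W (h₁ + h₂) y = flowMap I v W h₂ (flowMap I v W h₁ y) := by
  have hc := H₁.deriv.continuousAt
  have h2 := H₂.curves
  rw [← H₁.map_eq] at h2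
  filter_upwards [H₁.curves, hc.eventually h2] with y ⟨γ₁, hγ₁, w₁, c₁⟩ ⟨γ₂, hγ₂, w₂, c₂⟩
  have f₁ := flowMap_eq hW hv H₁.nonneg c₁ w₁
  have f₂ := flowMap_eq hW hv H₂.nonneg c₂ w₂
  rw [hγ₁] at f₁
  obtain ⟨γ, g0, g1, gw, gc⟩ := exists_isMIntegralCurveOn_concat H₁.nonneg H₂.nonneg c₁ w₁ c₂ w₂
    (hγ₂.trans f₁)
  have f := flowMap_eq hW hv (add_nonneg H₁.nonneg H₂.nonneg) gc gw
  refine ⟨⟨γ, g0.trans hγ₁, gw, gc⟩, ?_⟩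
  rw [g0, hγ₁] at f
  rw [f, g1, ← f₂, hγ₂]

lemma HasFlowDeriv.comp [I.Boundaryless] [CompleteSpace E] [T2Space M] (hW : IsOpen W)
    (hv : ContMDiffOn I I.tangent ∞ (fun x ↦ (⟨x, v x⟩ : TangentBundle I M)) W)
    {h₁ h₂ : ℝ} {p q r : M} {A : TangentSpace I p →L[ℝ] TangentSpace I q}
    {B : TangentSpace I q →L[ℝ] TangentSpace I r}
    (H₁ : HasFlowDeriv v W h₁ p q A) (H₂ : HasFlowDeriv v W h₂ q r B) :
    HasFlowDeriv v W (h₁ + h₂) p r (B.comp A) := by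
  have hev := H₁.eventually_comp hW hv H₂
  have hq := H₁.map_eq
  subst hq
  refine ⟨add_nonneg H₁.nonneg H₂.nonneg, hev.mono fun y hy ↦ hy.1, ?_, ?_,
    H₂.bijective.comp H₁.bijective⟩
  · rw [hev.self_of_nhds.2, H₂.map_eq]
  · exact (H₂.deriv.comp p H₁.deriv).congr_of_eventuallyEq (hev.mono fun y hy ↦ hy.2)

end Flow

/-! ### Differentiability of the flow along an integral curve -/

section LocalFlow

variable {E H : Type*} [NormedAddCommGroup E] [NormedSpace ℝ E] [TopologicalSpace H]
  {I : ModelWithCorners ℝ E H} {M : Type*} [TopologicalSpace M] [ChartedSpace H M]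
  [IsManifold I ∞ M] {v : ∀ x : M, TangentSpace I x} {W : Set M}

/-- The linearization of the flow of `v` along the integral curve `γ` near `t₀`, in the chart
centred at `γ t₀`. -/
structure IsLocalLinearization (v : ∀ x : M, TangentSpace I x) (W : Set M) (γ : ℝ → M)
    (α β t₀ ε : ℝ) (x : ℝ → E) (Z V : ℝ → E →L[ℝ] E) : Prop where
  pos : 0 < ε
  Z_base : Z t₀ = 1
  V_base : V t₀ = 1
  contDiffOn_x : ContDiffOn ℝ ∞ x (Ioo (t₀ - ε) (t₀ + ε))
  contDiffOn_Z : ContDiffOn ℝ ∞ Z (Ioo (t₀ - ε) (t₀ + ε))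
  mem : ∀ t ∈ Ioo (t₀ - ε) (t₀ + ε), x t ∈ coordDom I W (γ t₀)
  deriv_x : ∀ t ∈ Ioo (t₀ - ε) (t₀ + ε), HasDerivAt x (coordField I v (γ t₀) (x t)) t
  deriv_Z : ∀ t ∈ Ioo (t₀ - ε) (t₀ + ε),
    HasDerivAt Z (-(Z t * fderiv ℝ (coordField I v (γ t₀)) (x t))) t
  deriv_V : ∀ t ∈ Ioo (t₀ - ε) (t₀ + ε),
    HasDerivAt V (fderiv ℝ (coordField I v (γ t₀)) (x t) * V t) t
  ZV : ∀ t ∈ Ioo (t₀ - ε) (t₀ + ε), Z t * V t = 1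
  VZ : ∀ t ∈ Ioo (t₀ - ε) (t₀ + ε), V t * Z t = 1
  eq_symm : ∀ t ∈ Icc α β ∩ Ioo (t₀ - ε) (t₀ + ε), γ t = (extChartAt I (γ t₀)).symm (x t)
  flow : ∀ s ∈ Icc α β ∩ Ioo (t₀ - ε) (t₀ + ε), ∀ t ∈ Icc α β ∩ Ioo (t₀ - ε) (t₀ + ε), s ≤ t →
    HasFlowDeriv v W (t - s) (γ s) (γ t)
      ((ofCoord I (γ t₀) (γ t)).comp ((V t * Z s).comp (toCoord I (γ t₀) (γ s))))

/-- A smooth solution in a chart, with the same initial value, agrees with an integral curve. -/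
lemma extChartAt_comp_eq_of_solution [I.Boundaryless] (hW : IsOpen W)
    (hv : ContMDiffOn I I.tangent ∞ (fun x ↦ (⟨x, v x⟩ : TangentBundle I M)) W)
    {γ : ℝ → M} {α β : ℝ} (hγ : IsMIntegralCurveOn (I := I) γ v (Icc α β))
    {t₀ : ℝ} (ht₀ : t₀ ∈ Icc α β) (hmem : γ t₀ ∈ W) {ε₁ : ℝ} (hε₁ : 0 < ε₁) {x : ℝ → E}
    (hx0 : x t₀ = extChartAt I (γ t₀) (γ t₀))
    (hx : ∀ t ∈ Ioo (t₀ - ε₁) (t₀ + ε₁), HasDerivAt x (coordField I v (γ t₀) (x t)) t) :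
    ∃ ε > 0, ε ≤ ε₁ ∧ ∀ t ∈ Icc α β ∩ Ioo (t₀ - ε) (t₀ + ε),
      γ t ∈ (chartAt H (γ t₀)).source ∧ x t = extChartAt I (γ t₀) (γ t) := by
  set x₀ := γ t₀ with hx₀
  have hO := isOpen_coordDom I hW x₀
  have hF := contDiffOn_coordField I hv x₀
  have hy₀ : extChartAt I x₀ x₀ ∈ coordDom I W x₀ :=
    extChartAt_mem_coordDom I (mem_chart_source H x₀) hmem
  obtain ⟨K, S, hS, hK⟩ := ((hF.contDiffAt (hO.mem_nhds hy₀)).of_le (n := ∞) (m := 1)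
    (by simp)).exists_lipschitzOnWith
  have h1 : {r | γ r ∈ (chartAt H x₀).source ∧ extChartAt I x₀ (γ r) ∈ S} ∈ 𝓝[Icc α β] t₀ :=
    (hγ.continuousOn t₀ ht₀).preimage_mem_nhdsWithin (Filter.inter_mem
      ((chartAt H x₀).open_source.mem_nhds (mem_chart_source H x₀))
      ((continuousAt_extChartAt x₀).preimage_mem_nhds hS))
  have h2 : {r | x r ∈ S} ∈ 𝓝 t₀ :=
    (hx t₀ ⟨by linarith, by linarith⟩).continuousAt.preimage_mem_nhds (by rwa [hx0])
  obtain ⟨ε₂, hε₂, hs₂⟩ := Metric.mem_nhdsWithin_iff.1 h1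
  obtain ⟨ε₃, hε₃, hs₃⟩ := Metric.mem_nhds_iff.1 h2
  set ε := min ε₁ (min ε₂ ε₃) with hε
  have hle1 : ε ≤ ε₁ := min_le_left _ _
  have hle2 : ε ≤ ε₂ := (min_le_right _ _).trans (min_le_left _ _)
  have hle3 : ε ≤ ε₃ := (min_le_right _ _).trans (min_le_right _ _)
  have g2 : ∀ r ∈ Icc α β ∩ Ioo (t₀ - ε) (t₀ + ε),
      γ r ∈ (chartAt H x₀).source ∧ extChartAt I x₀ (γ r) ∈ S := fun r hr ↦
    hs₂ ⟨by rw [Real.ball_eq_Ioo]; exact ⟨by linarith [hr.2.1], by linarith [hr.2.2]⟩, hr.1⟩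
  have g3 : ∀ r ∈ Ioo (t₀ - ε) (t₀ + ε), x r ∈ S := fun r hr ↦
    hs₃ (by rw [Real.ball_eq_Ioo]; exact ⟨by linarith [hr.1], by linarith [hr.2]⟩)
  have gx : ∀ r ∈ Ioo (t₀ - ε) (t₀ + ε), HasDerivAt x (coordField I v x₀ (x r)) r := fun r hr ↦
    hx r ⟨by linarith [hr.1], by linarith [hr.2]⟩
  have gγ : ∀ r ∈ Icc α β ∩ Ioo (t₀ - ε) (t₀ + ε), HasDerivWithinAt (extChartAt I x₀ ∘ γ)
      (coordField I v x₀ (extChartAt I x₀ (γ r))) (Icc α β) r := fun r hr ↦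
    hasDerivWithinAt_coordField hγ hr.1 (g2 r hr).1
  refine ⟨ε, lt_min hε₁ (lt_min hε₂ hε₃), hle1, fun t ht ↦ ⟨(g2 t ht).1, ?_⟩⟩
  rcases le_total t₀ t with h | h
  · have hI : ∀ r ∈ Icc t₀ t, r ∈ Icc α β ∩ Ioo (t₀ - ε) (t₀ + ε) := fun r hr ↦
      ⟨⟨ht₀.1.trans hr.1, hr.2.trans ht.1.2⟩, by linarith [hr.1, ht.2.1, ht.2.2], by
        linarith [hr.2, ht.2.2]⟩
    have hsub : Icc t₀ t ⊆ Icc α β := fun r hr ↦ (hI r hr).1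
    exact ODE_solution_unique_of_mem_Icc_right (v := fun _ ↦ coordField I v x₀)
      (s := fun _ ↦ S) (K := K) (f := x) (g := extChartAt I x₀ ∘ γ)
      (fun _ _ ↦ hK) (fun r hr ↦ (gx r (hI r hr).2).continuousAt.continuousWithinAt)
      (fun r hr ↦ (gx r (hI r (Ico_subset_Icc_self hr)).2).hasDerivWithinAt)
      (fun r hr ↦ g3 r (hI r (Ico_subset_Icc_self hr)).2)
      (fun r hr ↦ ((gγ r (hI r hr)).mono hsub).continuousWithinAt)
      (fun r hr ↦ hasDerivWithinAt_Icc_Ici hr ((gγ r (hI r (Ico_subset_Icc_self hr))).mono hsub))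
      (fun r hr ↦ (g2 r (hI r (Ico_subset_Icc_self hr))).2) hx0 ⟨h, le_rfl⟩
  · have hI : ∀ r ∈ Icc t t₀, r ∈ Icc α β ∩ Ioo (t₀ - ε) (t₀ + ε) := fun r hr ↦
      ⟨⟨ht.1.1.trans hr.1, hr.2.trans ht₀.2⟩, by linarith [hr.1, ht.2.1], by
        linarith [hr.2, ht.2.1, ht.2.2]⟩
    have hsub : Icc t t₀ ⊆ Icc α β := fun r hr ↦ (hI r hr).1
    exact ODE_solution_unique_of_mem_Icc_left (v := fun _ ↦ coordField I v x₀)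
      (s := fun _ ↦ S) (K := K) (f := x) (g := extChartAt I x₀ ∘ γ)
      (fun _ _ ↦ hK) (fun r hr ↦ (gx r (hI r hr).2).continuousAt.continuousWithinAt)
      (fun r hr ↦ (gx r (hI r (Ioc_subset_Icc_self hr)).2).hasDerivWithinAt)
      (fun r hr ↦ g3 r (hI r (Ioc_subset_Icc_self hr)).2)
      (fun r hr ↦ ((gγ r (hI r hr)).mono hsub).continuousWithinAt)
      (fun r hr ↦ hasDerivWithinAt_Icc_Iic hr ((gγ r (hI r (Ioc_subset_Icc_self hr))).mono hsub))
      (fun r hr ↦ (g2 r (hI r (Ioc_subset_Icc_self hr))).2) hx0 ⟨le_rfl, h⟩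

lemma toCoord_bijective {x₀ x : M} (hx : x ∈ (chartAt H x₀).source) :
    Function.Bijective (toCoord I x₀ x) :=
  ⟨Function.LeftInverse.injective (g := ofCoord I x₀ x) (ofCoord_toCoord I hx),
    Function.RightInverse.surjective (g := ofCoord I x₀ x) (toCoord_ofCoord I hx)⟩

lemma ofCoord_bijective {x₀ x : M} (hx : x ∈ (chartAt H x₀).source) :
    Function.Bijective (ofCoord I x₀ x) :=
  ⟨Function.LeftInverse.injective (g := toCoord I x₀ x) (toCoord_ofCoord I hx),
    Function.RightInverse.surjective (g := toCoord I x₀ x) (ofCoord_toCoord I hx)⟩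

lemma bijective_of_mul_eq_one {A B : E →L[ℝ] E} (h₁ : A * B = 1) (h₂ : B * A = 1) :
    Function.Bijective A :=
  ⟨Function.LeftInverse.injective (g := B) fun w ↦ congrArg (fun C : E →L[ℝ] E ↦ C w) h₂,
    Function.RightInverse.surjective (g := B) fun w ↦ congrArg (fun C : E →L[ℝ] E ↦ C w) h₁⟩

/-- Transfers `exists_local_flow` through the chart centred at `γ t₀`, with `ε` shrunk until the
solution in the chart is the image of `γ`. -/
lemma exists_isLocalLinearization [I.Boundaryless] [FiniteDimensional ℝ E] [T2Space M]
    (hW : IsOpen W)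
    (hv : ContMDiffOn I I.tangent ∞ (fun x ↦ (⟨x, v x⟩ : TangentBundle I M)) W)
    {γ : ℝ → M} {α β : ℝ} (hγ : IsMIntegralCurveOn (I := I) γ v (Icc α β))
    (hmem : ∀ t ∈ Icc α β, γ t ∈ W) {t₀ : ℝ} (ht₀ : t₀ ∈ Icc α β) :
    ∃ ε x Z V, IsLocalLinearization v W γ α β t₀ ε x Z V := by
  have := FiniteDimensional.complete ℝ E
  obtain ⟨ε₁, hε₁, x, Z, V, hx0, hZ0, hV0, hxs, hZs, hd, hflow⟩ := exists_local_flow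
    (isOpen_coordDom I hW (γ t₀)) (contDiffOn_coordField I hv (γ t₀))
    (extChartAt_mem_coordDom I (mem_chart_source H (γ t₀)) (hmem t₀ ht₀))
  have hsh : ∀ t ∈ Ioo (t₀ - ε₁) (t₀ + ε₁), t - t₀ ∈ Ioo (-ε₁) ε₁ := fun t ht ↦
    ⟨by linarith [ht.1], by linarith [ht.2]⟩
  obtain ⟨ε, hε, hle, heq⟩ := extChartAt_comp_eq_of_solution hW hv hγ ht₀ (hmem t₀ ht₀) hε₁
    (x := fun t ↦ x (t - t₀)) (by simpa using hx0)
    (fun t ht ↦ (hd _ (hsh t ht)).2.1.comp_sub_const t t₀)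
  have hsub : Ioo (t₀ - ε) (t₀ + ε) ⊆ Ioo (t₀ - ε₁) (t₀ + ε₁) := fun t ht ↦
    ⟨by linarith [ht.1], by linarith [ht.2]⟩
  have hshc : ContDiff ℝ ∞ (fun t : ℝ ↦ t - t₀) := contDiff_id.sub contDiff_const
  have hsymm : ∀ t ∈ Icc α β ∩ Ioo (t₀ - ε) (t₀ + ε),
      γ t = (extChartAt I (γ t₀)).symm (x (t - t₀)) := fun t ht ↦ by
    rw [(heq t ht).2, (extChartAt I (γ t₀)).left_inv]
    rw [extChartAt_source]; exact (heq t ht).1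
  refine ⟨ε, fun t ↦ x (t - t₀), fun t ↦ Z (t - t₀), fun t ↦ V (t - t₀), hε, by simpa using hZ0,
    by simpa using hV0, hxs.comp hshc.contDiffOn fun t ht ↦ hsh t (hsub ht),
    hZs.comp hshc.contDiffOn fun t ht ↦ hsh t (hsub ht), fun t ht ↦ (hd _ (hsh t (hsub ht))).1,
    fun t ht ↦ (hd _ (hsh t (hsub ht))).2.1.comp_sub_const t t₀,
    fun t ht ↦ (hd _ (hsh t (hsub ht))).2.2.1.comp_sub_const t t₀,
    fun t ht ↦ (hd _ (hsh t (hsub ht))).2.2.2.1.comp_sub_const t t₀,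
    fun t ht ↦ (hd _ (hsh t (hsub ht))).2.2.2.2.1,
    fun t ht ↦ (hd _ (hsh t (hsub ht))).2.2.2.2.2, hsymm, ?_⟩
  intro s hs t ht hst
  obtain ⟨φ, hφ, hev⟩ := hflow (s - t₀) (t - t₀) (hsh s (hsub hs.2)).1 (by linarith)
    (hsh t (hsub ht.2)).2
  rw [sub_sub_sub_cancel_right] at hev
  have hh : 0 ≤ t - s := by linarith
  have hxs' : x (s - t₀) = extChartAt I (γ t₀) (γ s) := (heq s hs).2
  have hxt' : x (t - t₀) = extChartAt I (γ t₀) (γ t) := (heq t ht).2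
  have hsrc : (chartAt H (γ t₀)).source ∈ 𝓝 (γ s) :=
    (chartAt H (γ t₀)).open_source.mem_nhds (heq s hs).1
  have hcont : ContinuousAt (extChartAt I (γ t₀)) (γ s) :=
    continuousAt_extChartAt' (by rw [extChartAt_source]; exact (heq s hs).1)
  -- Near `γ s` the flow is the chart conjugate of `φ`, so its derivative is the conjugate of `V *
  -- Z`.
  have key : ∀ᶠ y in 𝓝 (γ s), (∃ g : ℝ → M, g 0 = y ∧ (∀ r ∈ Icc 0 (t - s), g r ∈ W) ∧
      IsMIntegralCurveOn (I := I) g v (Icc 0 (t - s))) ∧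
      flowMap I v W (t - s) y = (extChartAt I (γ t₀)).symm (φ (extChartAt I (γ t₀) y)) ∧
      φ (extChartAt I (γ t₀) y) ∈ (extChartAt I (γ t₀)).target := by
    rw [hxs'] at hev
    filter_upwards [hsrc, hcont.eventually hev] with y hy ⟨g, hg0, hgt, hg⟩
    have hgc := isMIntegralCurveOn_extChartAt_symm (I := I) (v := v) hg
    have hgW : ∀ r ∈ Icc 0 (t - s), ((extChartAt I (γ t₀)).symm ∘ g) r ∈ W :=
      fun r hr ↦ (hg r hr).1.2
    have h0 : ((extChartAt I (γ t₀)).symm ∘ g) 0 = y := by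
      simp only [Function.comp_apply, hg0]
      exact (extChartAt I (γ t₀)).left_inv (by rw [extChartAt_source]; exact hy)
    refine ⟨⟨_, h0, hgW, hgc⟩, ?_, ?_⟩
    · have := flowMap_eq hW hv hh hgc hgW
      rw [h0] at this
      rw [this, ← hgt]
      rfl
    · rw [← hgt]
      exact (hg (t - s) ⟨hh, le_rfl⟩).1.1
  have hγst : flowMap I v W (t - s) (γ s) = γ t := by
    have hc : IsMIntegralCurveOn (I := I) (γ ∘ (· + s)) v (Icc 0 (t - s)) := by
      refine (hγ.comp_add s).mono fun r hr ↦ ?_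
      exact ⟨by linarith [hs.1.1, hr.1], by linarith [ht.1.2, hr.2]⟩
    have := flowMap_eq hW hv hh hc fun r hr ↦
      hmem _ ⟨by linarith [hs.1.1, hr.1], by linarith [ht.1.2, hr.2]⟩
    simpa using this
  have hφx : φ (x (s - t₀)) = x (t - t₀) := by
    have h := key.self_of_nhds.2
    rw [hxs', hxt', ← hγst, h.1, (extChartAt I (γ t₀)).right_inv h.2]
  refine ⟨hh, key.mono fun y hy ↦ hy.1, hγst, ?_, ?_⟩
  · have d1 := hasMFDerivAt_extChartAt_toCoord I (heq s hs).1
    rw [hxs'] at hφ hφx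
    have d2 := hφ.hasMFDerivAt
    have d3 : HasMFDerivAt 𝓘(ℝ, E) I (extChartAt I (γ t₀)).symm (φ (extChartAt I (γ t₀) (γ s)))
        (ofCoord I (γ t₀) (γ t)) := by
      have := hasMFDerivAt_extChartAt_symm_ofCoord I (key.self_of_nhds.2.2)
      have hγt : (extChartAt I (γ t₀)).symm (φ (extChartAt I (γ t₀) (γ s))) = γ t := by
        rw [← key.self_of_nhds.2.1, hγst]
      rw [hγt] at this
      exact this
    exact (d3.comp (γ s) (d2.comp (γ s) d1)).congr_of_eventuallyEq (key.mono fun y hy ↦ hy.2.1)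
  · have hss := hsh s (hsub hs.2)
    have htt := hsh t (hsub ht.2)
    have hVZ : Function.Bijective (V (t - t₀) * Z (s - t₀)) :=
      (bijective_of_mul_eq_one (hd _ htt).2.2.2.2.2 (hd _ htt).2.2.2.2.1).comp
        (bijective_of_mul_eq_one (hd _ hss).2.2.2.2.1 (hd _ hss).2.2.2.2.2)
    exact (ofCoord_bijective (I := I) (heq t ht).1).comp
      (hVZ.comp (toCoord_bijective (I := I) (heq s hs).1))

/-- The flow along an integral curve has an invertible derivative. -/
lemma exists_hasFlowDeriv [I.Boundaryless] [FiniteDimensional ℝ E] [T2Space M] (hW : IsOpen W)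
    (hv : ContMDiffOn I I.tangent ∞ (fun x ↦ (⟨x, v x⟩ : TangentBundle I M)) W)
    {γ : ℝ → M} {α β : ℝ} (hγ : IsMIntegralCurveOn (I := I) γ v (Icc α β))
    (hmem : ∀ t ∈ Icc α β, γ t ∈ W) {s t : ℝ} (hs : α ≤ s) (hst : s ≤ t) (ht : t ≤ β) :
    ∃ A, HasFlowDeriv v W (t - s) (γ s) (γ t) A := by
  have := FiniteDimensional.complete ℝ E
  have hαβ : α ≤ β := hs.trans (hst.trans ht)
  choose! ε x Z V hloc using fun t₀ (ht₀ : t₀ ∈ Icc α β) ↦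
    exists_isLocalLinearization hW hv hγ hmem ht₀
  -- By compactness finitely many linearization neighbourhoods suffice; the derivative is then built
  -- piece by piece with the semigroup law.
  obtain ⟨τ, hτ0, hτm, ⟨N, hN⟩, hτ⟩ := exists_monotone_Icc_subset_open_cover_Icc hαβ
    (c := fun i : Icc α β ↦ {z : Icc α β | (z : ℝ) ∈ Ioo (i - ε i) (i + ε i)})
    (fun i ↦ isOpen_Ioo.preimage continuous_subtype_val)
    (fun z _ ↦ mem_iUnion.2 ⟨z, by
      have := (hloc z z.2).pos
      exact ⟨by linarith, by linarith⟩⟩)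
  have main : ∀ n : ℕ, ∀ s t : ℝ, α ≤ s → s ≤ t → t ≤ τ n →
      ∃ A, HasFlowDeriv v W (t - s) (γ s) (γ t) A := by
    intro n
    have step : ∀ s t : ℝ, ∀ i : Icc α β, s ∈ Icc α β ∩ Ioo (i - ε i) (i + ε i) →
        t ∈ Icc α β ∩ Ioo (i - ε i) (i + ε i) → s ≤ t →
        ∃ A, HasFlowDeriv v W (t - s) (γ s) (γ t) A :=
      fun s t i hs ht hst ↦ ⟨_, (hloc i i.2).flow s hs t ht hst⟩
    induction n with
    | zero =>
      intro s t hs hst ht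
      rw [hτ0] at ht
      have e1 : s = α := le_antisymm (hst.trans ht) hs
      have e2 : t = α := le_antisymm ht (hs.trans hst)
      have hα : α ∈ Icc α β := ⟨le_rfl, hαβ⟩
      have := (hloc α hα).pos
      exact step s t ⟨α, hα⟩ (by rw [e1]; exact ⟨hα, by constructor <;> simp [this]⟩)
        (by rw [e2]; exact ⟨hα, by constructor <;> simp [this]⟩) hst
    | succ n ih =>
      intro s t hs hst ht
      have hτn : (τ n : ℝ) ≤ τ (n + 1) := hτm (Nat.le_succ n)
      obtain ⟨i, hi⟩ := hτ n
      have hi' : ∀ r : ℝ, (τ n : ℝ) ≤ r → r ≤ τ (n + 1) →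
          r ∈ Icc α β ∩ Ioo (i - ε i) (i + ε i) := by
        intro r h1 h2
        have hr : r ∈ Icc α β := ⟨(τ n).2.1.trans h1, h2.trans (τ (n + 1)).2.2⟩
        exact ⟨hr, hi (a := ⟨r, hr⟩) ⟨h1, h2⟩⟩
      rcases le_total t (τ n) with h | h
      · exact ih s t hs hst h
      rcases le_total (τ n : ℝ) s with h' | h'
      · exact step s t i (hi' s h' (hst.trans ht)) (hi' t h ht) hst
      · obtain ⟨A, hA⟩ := ih s (τ n) hs h' le_rfl
        obtain ⟨B, hB⟩ := step (τ n) t i (hi' _ le_rfl hτn) (hi' t h ht) h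
        have := hA.comp hW hv hB
        rw [show (τ n : ℝ) - s + (t - τ n) = t - s by ring] at this
        exact ⟨_, this⟩
  exact main N s t hs hst (by rw [hN N le_rfl]; exact ht)

end LocalFlow

/-! ### Subdivisions and finite compositions of maps -/

section Subdivisions

variable {a b : ℝ} (S : Subdivision a b)

lemma Subdivision.le_pt (j : Fin (S.len + 1)) : a ≤ S.pt j :=
  S.first.symm.le.trans (S.strictMono.monotone (Fin.zero_le j))

lemma Subdivision.pt_le (j : Fin (S.len + 1)) : S.pt j ≤ b :=
  (S.strictMono.monotone (Fin.le_last j)).trans S.last.le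

lemma Subdivision.pt_lt (i : Fin S.len) : S.pt i.castSucc < S.pt i.succ :=
  S.strictMono Fin.castSucc_lt_succ

end Subdivisions

section Folds

lemma foldl_eq_self {M : Type*} : ∀ (n : ℕ) (f : M → Fin n → M), (∀ j y, f y j = y) →
    ∀ x, Fin.foldl n f x = x
  | 0, f, _, x => by simp
  | n + 1, f, hf, x => by
    rw [Fin.foldl_succ_last, foldl_eq_self n _ (fun j y ↦ hf j.castSucc y), hf]

/-- Meant for comparing the composite flows from two instants of the same piece `i`: earlier pieces
have zero duration, later ones are common. -/
lemma foldl_eq_foldl {M : Type*} : ∀ (n : ℕ) (f f' : M → Fin n → M) (i : Fin n) (x x' : M),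
    (∀ j < i, ∀ y, f y j = y ∧ f' y j = y) → f x i = f' x' i →
    (∀ j, i < j → ∀ y, f y j = f' y j) → Fin.foldl n f x = Fin.foldl n f' x'
  | 0, _, _, i, _, _, _, _, _ => i.elim0
  | n + 1, f, f', i, x, x', h₁, h₂, h₃ => by
    rw [Fin.foldl_succ_last, Fin.foldl_succ_last]
    induction i using Fin.lastCases with
    | last =>
      rw [foldl_eq_self n _ (fun j y ↦ (h₁ j.castSucc (Fin.castSucc_lt_last j) y).1),
        foldl_eq_self n _ (fun j y ↦ (h₁ j.castSucc (Fin.castSucc_lt_last j) y).2), h₂]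
    | cast i =>
      rw [foldl_eq_foldl n (fun y j ↦ f y j.castSucc) (fun y j ↦ f' y j.castSucc) i x x'
        (fun j hj y ↦ h₁ j.castSucc (by simpa using hj) y) h₂
        (fun j hj y ↦ h₃ j.castSucc (by simpa using hj) y), h₃ _ (Fin.castSucc_lt_last i)]

variable {E H : Type*} [NormedAddCommGroup E] [NormedSpace ℝ E] [TopologicalSpace H]
  {I : ModelWithCorners ℝ E H} {M : Type*} [TopologicalSpace M] [ChartedSpace H M]

/-- The derivative of a composition of finitely many maps, each with an invertible derivative that
preserves a given family of linear forms. -/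
lemma exists_hasMFDerivAt_foldl (κ : ∀ m : M, TangentSpace I m →L[ℝ] ℝ) :
    ∀ (n : ℕ) (f : M → Fin n → M) (p : Fin (n + 1) → M),
    (∀ i, f (p i.castSucc) i = p i.succ ∧
      ∃ D : TangentSpace I (p i.castSucc) →L[ℝ] TangentSpace I (p i.succ),
        HasMFDerivAt I I (fun y ↦ f y i) (p i.castSucc) D ∧ Function.Bijective D ∧
        ∀ w, κ (p i.succ) (D w) = κ (p i.castSucc) w) →
    Fin.foldl n f (p 0) = p (Fin.last n) ∧
      ∃ D : TangentSpace I (p 0) →L[ℝ] TangentSpace I (p (Fin.last n)),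
        HasMFDerivAt I I (Fin.foldl n f) (p 0) D ∧ Function.Bijective D ∧
        ∀ w, κ (p (Fin.last n)) (D w) = κ (p 0) w
  | 0, f, p, _ => by
    have h0 : (Fin.foldl 0 f : M → M) = id := by ext x; simp
    refine ⟨by simp, ContinuousLinearMap.id ℝ _, ?_, Function.bijective_id, fun w ↦ rfl⟩
    rw [h0]
    exact hasMFDerivAt_id (p 0)
  | n + 1, f, p, h => by
    obtain ⟨h1, D, hD, hb, hκ⟩ := exists_hasMFDerivAt_foldl κ n (fun y j ↦ f y j.castSucc)
      (fun j ↦ p j.castSucc) (fun i ↦ by simpa using h i.castSucc)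
    obtain ⟨h2, D', hD', hb', hκ'⟩ := h (Fin.last n)
    have h0 : (Fin.foldl (n + 1) f : M → M) = (fun y ↦ f y (Fin.last n)) ∘
        Fin.foldl n (fun y j ↦ f y j.castSucc) := by
      ext x; rw [Fin.foldl_succ_last]; rfl
    have h1' : Fin.foldl n (fun y j ↦ f y j.castSucc) (p 0) = p (Fin.last n).castSucc := h1
    refine ⟨?_, D'.comp D, ?_, hb'.comp hb, fun w ↦ (hκ' (D w)).trans (hκ w)⟩
    · rw [Fin.foldl_succ_last, h1', h2]
      rfl
    · rw [h0]
      rw [← h1'] at hD'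
      exact hD'.comp (p 0) hD

end Folds

/-! ### The transport map of a composite flow -/

section Transport

variable {EM HM EU HU EQ HQ EK HK : Type*}
  [NormedAddCommGroup EM] [NormedSpace ℝ EM] [TopologicalSpace HM]
  [NormedAddCommGroup EU] [NormedSpace ℝ EU] [TopologicalSpace HU]
  [NormedAddCommGroup EQ] [NormedSpace ℝ EQ] [TopologicalSpace HQ]
  [NormedAddCommGroup EK] [NormedSpace ℝ EK] [TopologicalSpace HK]
  {IM : ModelWithCorners ℝ EM HM} {IU : ModelWithCorners ℝ EU HU}
  {IQ : ModelWithCorners ℝ EQ HQ} {IK : ModelWithCorners ℝ EK HK}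
  {M U Q K : Type*}
  [TopologicalSpace M] [ChartedSpace HM M] [IsManifold IM ∞ M]
  [TopologicalSpace U] [ChartedSpace HU U]
  [TopologicalSpace Q] [ChartedSpace HQ Q]
  [TopologicalSpace K] [ChartedSpace HK K]

lemma IsLocalLinearization.mono {E H : Type*} [NormedAddCommGroup E] [NormedSpace ℝ E]
    [TopologicalSpace H] {I : ModelWithCorners ℝ E H} {M : Type*} [TopologicalSpace M]
    [ChartedSpace H M] [IsManifold I ∞ M] {v : ∀ x : M, TangentSpace I x} {W : Set M}
    {γ : ℝ → M} {α β t₀ ε ε' : ℝ} {x : ℝ → E} {Z V : ℝ → E →L[ℝ] E}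
    (h : IsLocalLinearization v W γ α β t₀ ε x Z V) (hε' : 0 < ε') (hle : ε' ≤ ε) :
    IsLocalLinearization v W γ α β t₀ ε' x Z V := by
  have hsub : Ioo (t₀ - ε') (t₀ + ε') ⊆ Ioo (t₀ - ε) (t₀ + ε) :=
    Ioo_subset_Ioo (by linarith) (by linarith)
  exact ⟨hε', h.Z_base, h.V_base, h.contDiffOn_x.mono hsub, h.contDiffOn_Z.mono hsub,
    fun t ht ↦ h.mem t (hsub ht), fun t ht ↦ h.deriv_x t (hsub ht),
    fun t ht ↦ h.deriv_Z t (hsub ht), fun t ht ↦ h.deriv_V t (hsub ht),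
    fun t ht ↦ h.ZV t (hsub ht), fun t ht ↦ h.VZ t (hsub ht),
    fun t ht ↦ h.eq_symm t ⟨ht.1, hsub ht.2⟩,
    fun s hs t ht ↦ h.flow s ⟨hs.1, hsub hs.2⟩ t ⟨ht.1, hsub ht.2⟩⟩

namespace ControlStructure

variable {G : ControlStructure IM IU IQ IK M U Q K}

lemma contMDiffOn_field (s : G.LocalSection) :
    ContMDiffOn IM IM.tangent ∞ (fun m ↦ (⟨m, G.field s m⟩ : TangentBundle IM M)) s.dom := by
  refine (G.contMDiff_ρ.comp_contMDiffOn s.contMDiffOn).congr fun m hm ↦ ?_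
  have h := s.ν_σ m hm
  refine Bundle.TotalSpace.ext h.symm ?_
  exact HEq.rfl

lemma dAt_vel {m : M} {u : U} (h : G.ν u = m) : dAt IM G.τ m (G.vel m u) = 1 := by
  subst h
  exact (G.ρ u).2

lemma dAt_field (s : G.LocalSection) {m : M} (hm : m ∈ s.dom) :
    dAt IM G.τ m (G.field s m) = 1 :=
  dAt_vel (s.ν_σ m hm)

lemma mdifferentiable_τ : MDifferentiable IM 𝓘(ℝ, ℝ) G.τ :=
  G.bundle_τ.contMDiff.mdifferentiable (by simp)

/-- Along integral curves of fields in `𝓓`, the time coordinate increases with unit speed. -/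
lemma τ_integralCurve (s : G.LocalSection) {γ : ℝ → M} {h : ℝ} (hh : 0 ≤ h)
    (hγ : IsMIntegralCurveOn (I := IM) γ (G.field s) (Icc 0 h)) (hw : ∀ r ∈ Icc 0 h, γ r ∈ s.dom) :
    G.τ (γ h) = G.τ (γ 0) + h := by
  have hd : ∀ r ∈ Icc 0 h, HasDerivWithinAt (fun r ↦ G.τ (γ r) - r) 0 (Icc 0 h) r := by
    intro r hr
    have h1 := (G.mdifferentiable_τ (γ r)).hasMFDerivAt.comp_hasMFDerivWithinAt r (hγ r hr)
    have h2 : HasDerivWithinAt (fun r ↦ G.τ (γ r)) 1 (Icc 0 h) r := by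
      rw [hasDerivWithinAt_iff_hasFDerivWithinAt]
      refine h1.hasFDerivWithinAt.congr_fderiv ?_
      ext
      change dAt IM G.τ (γ r) ((1 : ℝ) • G.field s (γ r)) = (1 : ℝ) • (1 : ℝ)
      rw [map_smul, dAt_field s (hw r hr)]
    exact (h2.sub (hasDerivWithinAt_id r _)).congr_deriv (sub_self 1)
  have := constant_of_derivWithin_zero (f := fun r ↦ G.τ (γ r) - r) (a := 0) (b := h)
    (fun r hr ↦ (hd r hr).differentiableWithinAt)
    (fun r hr ↦ (hd r (Ico_subset_Icc_self hr)).derivWithin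
      (uniqueDiffOn_Icc (hr.1.trans_lt hr.2) r (Ico_subset_Icc_self hr))) h ⟨hh, le_rfl⟩
  simp only [sub_zero] at this
  linarith

/-- Fields in `𝓓` satisfy `dτ(X) = 1`, so their flow for the time `h` shifts `τ` by the constant
`h`; differentiate this identity. -/
lemma dAt_hasFlowDeriv [IM.Boundaryless] [CompleteSpace EM] [T2Space M] (s : G.LocalSection)
    {h : ℝ} {p q : M} {A : TangentSpace IM p →L[ℝ] TangentSpace IM q}
    (H : HasFlowDeriv (G.field s) s.dom h p q A) (w : TangentSpace IM p) :
    dAt IM G.τ q (A w) = dAt IM G.τ p w := by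
  have hq := H.map_eq
  subst hq
  have h1 := (G.mdifferentiable_τ _).hasMFDerivAt.comp p H.deriv
  have h2 : HasMFDerivAt IM 𝓘(ℝ, ℝ) (fun y ↦ G.τ y + h) p (dAt IM G.τ p) := by
    have h0 : HasMFDerivAt 𝓘(ℝ, ℝ) 𝓘(ℝ, ℝ) (fun z : ℝ ↦ z + h) (G.τ p)
        (ContinuousLinearMap.id ℝ ℝ) := ((hasFDerivAt_id (𝕜 := ℝ) (G.τ p)).add_const h).hasMFDerivAt
    exact h0.comp p (G.mdifferentiable_τ p).hasMFDerivAt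
  have h3 : (G.τ ∘ flowMap IM (G.field s) s.dom h) =ᶠ[𝓝 p] fun y ↦ G.τ y + h := by
    filter_upwards [H.curves] with y ⟨γ, h0, hw, hc⟩
    have h4 := flowMap_eq s.isOpen_dom (contMDiffOn_field s) H.nonneg hc hw
    have h5 := τ_integralCurve s H.nonneg hc hw
    rw [h0] at h4 h5
    rw [Function.comp_apply, h4, h5]
  have h6 := h1.congr_of_eventuallyEq h3.symm
  exact congrArg (fun L : TangentSpace IM p →L[ℝ] ℝ ↦ L w) (hasMFDerivAt_unique h6 h2)

namespace FlowData

variable {a b : ℝ} {u : ℝ → U} (P : G.FlowData a b u)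

variable [IM.Boundaryless] [FiniteDimensional ℝ EM] [T2Space M]

lemma exists_hasFlowDeriv_piece (i : Fin P.len) {s t : ℝ} (hs : P.pt i.castSucc ≤ s) (hst : s ≤ t)
    (ht : t ≤ P.pt i.succ) :
    ∃ A, HasFlowDeriv (G.field (P.sec i)) (P.sec i).dom (t - s) (G.ν (u s)) (G.ν (u t)) A :=
  exists_hasFlowDeriv (γ := fun t ↦ G.ν (u t)) (P.sec i).isOpen_dom (contMDiffOn_field _)
    (P.integral i) (P.mem_dom i) hs hst ht

/-- The chain rule over the factors, each of which has an invertible derivative that preserves `dτ`.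
In particular `transport` is a true derivative and not a default value. -/
lemma flowFrom_spec {t : ℝ} (ht : t ∈ Icc a b) :
    P.flowFrom t (G.ν (u t)) = G.ν (u b) ∧
      HasMFDerivAt IM IM (P.flowFrom t) (G.ν (u t)) (P.transport t) ∧
      Function.Bijective (P.transport t) ∧
      ∀ w, dAt IM G.τ (G.ν (u b)) (P.transport t w) = dAt IM G.τ (G.ν (u t)) w := by
  have := FiniteDimensional.complete ℝ EM
  -- The points of the base curve where the successive factors act: a piece that ends before `t`
  -- contributes the identity, and the piece containing `t` is entered at `t`.
  set p : Fin (P.len + 1) → M := fun j ↦ G.ν (u (max t (P.pt j))) with hp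
  obtain ⟨h1, D, hD, hb, hκ⟩ := exists_hasMFDerivAt_foldl (I := IM) (fun m ↦ dAt IM G.τ m) P.len
    (fun y i ↦ flowMap IM (G.field (P.sec i)) (P.sec i).dom
      (max 0 (P.pt i.succ - max (P.pt i.castSucc) t)) y) p (fun i ↦ by
    have hlt := P.pt_lt i
    rcases le_total (P.pt i.succ) t with h | h
    · have e1 : max 0 (P.pt i.succ - max (P.pt i.castSucc) t) = 0 := by
        rw [max_eq_left_iff, sub_nonpos]; exact h.trans (le_max_right _ _)
      have e2 : p i.succ = p i.castSucc := by
        simp only [hp, max_eq_left h, max_eq_left (hlt.le.trans h)]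
      rw [e1, e2]
      have e3 : flowMap IM (G.field (P.sec i)) (P.sec i).dom 0 = id := by
        ext y; exact flowMap_zero y
      refine ⟨flowMap_zero _, ContinuousLinearMap.id ℝ _, ?_, Function.bijective_id, fun w ↦ rfl⟩
      rw [e3]
      exact hasMFDerivAt_id _
    · have e1 : max 0 (P.pt i.succ - max (P.pt i.castSucc) t) =
          P.pt i.succ - max t (P.pt i.castSucc) := by
        rw [max_comm (P.pt i.castSucc) t, max_eq_right_iff, sub_nonneg]; exact max_le h hlt.le
      obtain ⟨A, hA⟩ := P.exists_hasFlowDeriv_piece i (le_max_right t (P.pt i.castSucc))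
        (max_le h hlt.le) le_rfl
      have e2 : p i.succ = G.ν (u (P.pt i.succ)) := by simp only [hp, max_eq_right h]
      rw [e1, e2]
      exact ⟨hA.map_eq, A, hA.deriv, hA.bijective, dAt_hasFlowDeriv _ hA⟩)
  have p0 : p 0 = G.ν (u t) := by simp only [hp, P.first, max_eq_left ht.1]
  have p1 : p (Fin.last _) = G.ν (u b) := by simp only [hp, P.last, max_eq_right ht.2]
  rw [p0, p1] at h1
  have hD' : HasMFDerivAt IM IM (P.flowFrom t) (G.ν (u t)) D := by
    rw [p0] at hD; exact hD
  have hT : P.transport t = D := hD'.mfderiv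
  refine ⟨h1, ?_, ?_, ?_⟩
  · rw [hT]; exact hD'
  · rw [hT]; exact hb
  · intro w
    rw [hT]
    rw [p0, p1] at hκ
    exact hκ w

lemma transport_bijective {t : ℝ} (ht : t ∈ Icc a b) : Function.Bijective (P.transport t) :=
  (P.flowFrom_spec ht).2.2.1

lemma dAt_transport {t : ℝ} (ht : t ∈ Icc a b) (w : TangentSpace IM (G.ν (u t))) :
    dAt IM G.τ (G.ν (u b)) (P.transport t w) = dAt IM G.τ (G.ν (u t)) w :=
  (P.flowFrom_spec ht).2.2.2 w

omit [IM.Boundaryless] [FiniteDimensional ℝ EM] [T2Space M] in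
lemma transport_last (w : TangentSpace IM (G.ν (u b))) : P.transport b w = w := by
  have h : P.flowFrom b = id := by
    ext x
    refine foldl_eq_self _ _ (fun j y ↦ ?_) x
    have e1 : max 0 (P.pt j.succ - max (P.pt j.castSucc) b) = 0 := by
      rw [max_eq_left_iff, sub_nonpos]; exact (P.pt_le _).trans (le_max_right _ _)
    rw [e1, flowMap_zero]
  rw [transport, h, mfderiv_id]
  rfl

/-- Near `c(s)` the flow from `s` is the flow from `t` after the flow of `Xᵢ` for the time `t - s`,
by the semigroup law inside the piece `i`. -/
lemma transport_comp (i : Fin P.len) {s t : ℝ} (hs : P.pt i.castSucc ≤ s) (hst : s ≤ t)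
    (ht : t ≤ P.pt i.succ) {A : TangentSpace IM (G.ν (u s)) →L[ℝ] TangentSpace IM (G.ν (u t))}
    (hA : HasFlowDeriv (G.field (P.sec i)) (P.sec i).dom (t - s) (G.ν (u s)) (G.ν (u t)) A) :
    P.transport s = (P.transport t).comp A := by
  have := FiniteDimensional.complete ℝ EM
  obtain ⟨B, hB⟩ := P.exists_hasFlowDeriv_piece i (hs.trans hst) ht le_rfl
  have hev := hA.eventually_comp (P.sec i).isOpen_dom (contMDiffOn_field _) hB
  have htI : t ∈ Icc a b := ⟨(P.le_pt _).trans (hs.trans hst), ht.trans (P.pt_le _)⟩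
  have hmono : ∀ {j k : Fin (P.len + 1)}, j ≤ k → P.pt j ≤ P.pt k := fun h ↦ P.strictMono.monotone h
  have heq : P.flowFrom s =ᶠ[𝓝 (G.ν (u s))]
      P.flowFrom t ∘ flowMap IM (G.field (P.sec i)) (P.sec i).dom (t - s) := by
    filter_upwards [hev] with y hy
    rw [Function.comp_apply, flowFrom, flowFrom]
    refine foldl_eq_foldl _ _ _ i _ _ (fun j hj z ↦ ?_) ?_ (fun j hj z ↦ ?_)
    · have h1 : P.pt j.succ ≤ P.pt i.castSucc := hmono (by
        rw [Fin.le_def]; simpa using hj)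
      have e : ∀ r, P.pt i.castSucc ≤ r → max 0 (P.pt j.succ - max (P.pt j.castSucc) r) = 0 := by
        intro r hr
        rw [max_eq_left_iff, sub_nonpos]; exact (h1.trans hr).trans (le_max_right _ _)
      rw [e s hs, e t (hs.trans hst), flowMap_zero]
      exact ⟨rfl, rfl⟩
    · have e : ∀ r, P.pt i.castSucc ≤ r → r ≤ P.pt i.succ →
          max 0 (P.pt i.succ - max (P.pt i.castSucc) r) = P.pt i.succ - r := by
        intro r hr hr'
        rw [max_eq_right hr, max_eq_right]; linarith
      simp only [e s hs (hst.trans ht), e t (hs.trans hst) ht]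
      rw [← hy.2]
      congr 1
      ring
    · have h1 : P.pt i.succ ≤ P.pt j.castSucc := hmono (by
        rw [Fin.le_def]; simpa using hj)
      simp only [max_eq_left ((hst.trans ht).trans h1), max_eq_left (ht.trans h1)]
  have h2 := (P.flowFrom_spec htI).2.1
  have h2' : HasMFDerivAt IM IM (P.flowFrom t)
      (flowMap IM (G.field (P.sec i)) (P.sec i).dom (t - s) (G.ν (u s))) (P.transport t) := by
    rw [hA.map_eq]; exact h2
  exact ((h2'.comp _ hA.deriv).congr_of_eventuallyEq heq).mfderiv

/-- The transport map near a time `t₀` in a piece of the composite flow, in coordinates. -/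
lemma exists_transport_eq (i : Fin P.len) {t₀ : ℝ}
    (ht₀ : t₀ ∈ Icc (P.pt i.castSucc) (P.pt i.succ)) :
    ∃ ε x Z V, IsLocalLinearization (G.field (P.sec i)) (P.sec i).dom (fun t ↦ G.ν (u t))
        (P.pt i.castSucc) (P.pt i.succ) t₀ ε x Z V ∧
      ∃ B : EM →L[ℝ] TangentSpace IM (G.ν (u b)), Function.Bijective B ∧
        ∀ t ∈ Icc (P.pt i.castSucc) (P.pt i.succ) ∩ Ioo (t₀ - ε) (t₀ + ε),
          P.transport t = B.comp ((Z t).comp (toCoord IM (G.ν (u t₀)) (G.ν (u t)))) := by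
  obtain ⟨ε, x, Z, V, h⟩ := exists_isLocalLinearization (γ := fun t ↦ G.ν (u t))
    (P.sec i).isOpen_dom (contMDiffOn_field _) (P.integral i) (P.mem_dom i) ht₀
  have hε := h.pos
  -- A comparison instant to the right of `t₀`, unless `t₀` ends the piece. With the radius halved,
  -- every relevant `t` satisfies `t ≤ t₁`, so the derivative of the flow from `t` to `t₁` is `V t₁
  -- * Z t` in coordinates; all that does not depend on `t` goes into `B`.
  set t₁ := min (t₀ + ε / 2) (P.pt i.succ) with ht₁
  have ht₁I : t₁ ∈ Icc (P.pt i.castSucc) (P.pt i.succ) :=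
    ⟨le_min (by linarith [ht₀.1]) (P.pt_lt i).le, min_le_right _ _⟩
  have ht₀₁ : t₀ ≤ t₁ := le_min (by linarith) ht₀.2
  have ht₁J : t₁ ∈ Ioo (t₀ - ε) (t₀ + ε) :=
    ⟨by linarith, (min_le_left _ _).trans_lt (by linarith)⟩
  have ht₁ab : t₁ ∈ Icc a b := ⟨(P.le_pt _).trans ht₁I.1, ht₁I.2.trans (P.pt_le _)⟩
  have hsrc : G.ν (u t₁) ∈ (chartAt HM (G.ν (u t₀))).source := by
    rw [show G.ν (u t₁) = _ from h.eq_symm t₁ ⟨ht₁I, ht₁J⟩, ← extChartAt_source IM]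
    exact (extChartAt IM (G.ν (u t₀))).map_target (h.mem t₁ ht₁J).1
  refine ⟨ε / 2, x, Z, V, h.mono (by linarith) (by linarith),
    (P.transport t₁).comp ((ofCoord IM (G.ν (u t₀)) (G.ν (u t₁))).comp (V t₁)), ?_, ?_⟩
  · exact (P.transport_bijective ht₁ab).comp ((ofCoord_bijective (I := IM) hsrc).comp
      (bijective_of_mul_eq_one (h.VZ t₁ ht₁J) (h.ZV t₁ ht₁J)))
  · rintro t ⟨htI, htJ⟩
    have htt₁ : t ≤ t₁ := le_min htJ.2.le htI.2
    exact P.transport_comp i htI.1 htt₁ ht₁I.2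
      (h.flow t ⟨htI, by linarith [htJ.1], by linarith [htJ.2]⟩ t₁ ⟨ht₁I, ht₁J⟩ htt₁)

end FlowData
end ControlStructure
end Transport

/-! ### The Hamiltonian and the adjoint equation -/

section Adjoint

variable {EM HM EU HU EQ HQ EK HK : Type*}
  [NormedAddCommGroup EM] [NormedSpace ℝ EM] [TopologicalSpace HM]
  [NormedAddCommGroup EU] [NormedSpace ℝ EU] [TopologicalSpace HU]
  [NormedAddCommGroup EQ] [NormedSpace ℝ EQ] [TopologicalSpace HQ]
  [NormedAddCommGroup EK] [NormedSpace ℝ EK] [TopologicalSpace HK]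
  {IM : ModelWithCorners ℝ EM HM} {IU : ModelWithCorners ℝ EU HU}
  {IQ : ModelWithCorners ℝ EQ HQ} {IK : ModelWithCorners ℝ EK HK}
  {M U Q K : Type*}
  [TopologicalSpace M] [ChartedSpace HM M] [IsManifold IM ∞ M]
  [TopologicalSpace U] [ChartedSpace HU U]
  [TopologicalSpace Q] [ChartedSpace HQ Q]
  [TopologicalSpace K] [ChartedSpace HK K]

variable (IM) in
lemma toCoord_congr {x₀ x x' : M} (h : x = x') (w : EM) :
    toCoord IM x₀ x w = toCoord IM x₀ x' w := by
  subst h; rfl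

lemma mfderiv_eq_zero_of_isMax {E H : Type*} [NormedAddCommGroup E] [NormedSpace ℝ E]
    [TopologicalSpace H] {I : ModelWithCorners ℝ E H} [I.Boundaryless] {N : Type*}
    [TopologicalSpace N] [ChartedSpace H N] {f : N → ℝ} {n : N} (hmax : ∀ n', f n' ≤ f n) :
    mfderiv I 𝓘(ℝ, ℝ) f n = 0 := by
  by_cases hf : MDifferentiableAt I 𝓘(ℝ, ℝ) f n
  · rw [hf.mfderiv, I.range_eq_univ, fderivWithin_univ]
    refine IsLocalMax.fderiv_eq_zero (Filter.Eventually.of_forall fun y ↦ ?_)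
    simp only [writtenInExtChartAt, extChartAt_model_space_eq_id, PartialEquiv.refl_coe,
      Function.comp_apply, id_eq, extChartAt_to_inv]
    exact hmax _
  -- Where `f` is not differentiable, `mfderiv` has the default value zero.
  · exact mfderiv_zero_of_not_mdifferentiableAt hf

namespace ControlStructure

variable (G : ControlStructure IM IU IQ IK M U Q K)

lemma mdifferentiable_ν : MDifferentiable IU IM G.ν :=
  G.bundle_ν.contMDiff.mdifferentiable (by simp)

/-- A function that is maximal on its fibre at `u₀` has vanishing derivative on the vertical
tangent vectors at `u₀`. -/
lemma mfderiv_eq_zero_of_fibre_max [IK.Boundaryless] {f : U → ℝ} {u₀ : U}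
    (hf : MDifferentiableAt IU 𝓘(ℝ, ℝ) f u₀) (hmax : ∀ u', G.ν u' = G.ν u₀ → f u' ≤ f u₀)
    {w : TangentSpace IU u₀} (hw : mfderiv IU IM G.ν u₀ w = 0) :
    dAt IU f u₀ w = 0 := by
  obtain ⟨W, hW, hmem, φ, ψ, hφ, hψ, h₁, h₂⟩ := G.bundle_ν.locallyTrivial (G.ν u₀)
  have hWU : IsOpen (G.ν ⁻¹' W) := hW.preimage G.bundle_ν.contMDiff.continuous
  have dφ : HasMFDerivAt IU IK φ u₀ (mfderiv IU IK φ u₀) :=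
    ((hφ.contMDiffAt (hWU.mem_nhds hmem)).mdifferentiableAt (by simp)).hasMFDerivAt
  have dψ : MDifferentiableAt (IM.prod IK) IU ψ (G.ν u₀, φ u₀) :=
    (hψ.contMDiffAt ((hW.prod isOpen_univ).mem_nhds ⟨hmem, mem_univ _⟩)).mdifferentiableAt (by simp)
  have e0 : ψ (G.ν u₀, φ u₀) = u₀ := h₁ u₀ hmem
  have df : HasMFDerivAt (IM.prod IK) 𝓘(ℝ, ℝ) (f ∘ ψ) (G.ν u₀, φ u₀)
      (mfderiv (IM.prod IK) 𝓘(ℝ, ℝ) (f ∘ ψ) (G.ν u₀, φ u₀)) := by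
    refine MDifferentiableAt.hasMFDerivAt (MDifferentiableAt.comp _ ?_ dψ)
    rwa [e0]
  have d1 := df.comp u₀ ((G.mdifferentiable_ν u₀).hasMFDerivAt.prodMk dφ)
  have d2 : HasMFDerivAt IU 𝓘(ℝ, ℝ) f u₀ _ := d1.congr_of_eventuallyEq (by
    filter_upwards [hWU.mem_nhds hmem] with u' hu'
    exact congrArg f (h₁ u' hu').symm)
  have d3 := df.comp (φ u₀) ((hasMFDerivAt_const (I := IK) (G.ν u₀) (φ u₀)).prodMk
    (hasMFDerivAt_id (φ u₀)))
  -- Along the fibre through `u₀`, parametrized by `ψ`, the function `f` is maximal at `φ u₀`.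
  have h0 : mfderiv IK 𝓘(ℝ, ℝ) (fun k ↦ (f ∘ ψ) (G.ν u₀, k)) (φ u₀) = 0 := by
    refine mfderiv_eq_zero_of_isMax fun k ↦ ?_
    simp only [Function.comp_apply, e0]
    exact hmax _ (h₂ _ hmem k).1
  have h3 := d3.mfderiv
  rw [dAt, d2.mfderiv]
  have h4 := (congrArg (fun L : TangentSpace IK (φ u₀) →L[ℝ] ℝ ↦ L (mfderiv IU IK φ u₀ w))
    (h3.symm.trans h0))
  -- In the trivialization `w` has components `Tν w` and `Tφ w`; the first vanishes, the second is
  -- tangent to the fibre.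
  change mfderiv (IM.prod IK) 𝓘(ℝ, ℝ) (f ∘ ψ) (G.ν u₀, φ u₀)
    (mfderiv IU IM G.ν u₀ w, mfderiv IU IK φ u₀ w) = 0
  rw [hw]
  exact h4

variable {G}

lemma mdifferentiableAt_section (s : G.LocalSection) {m : M} (hm : m ∈ s.dom) :
    MDifferentiableAt IM IU s.σ m :=
  (s.contMDiffOn.contMDiffAt (s.isOpen_dom.mem_nhds hm)).mdifferentiableAt (by simp)

lemma mfderiv_ν_section (s : G.LocalSection) {m : M} (hm : m ∈ s.dom) (w : TangentSpace IM m) :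
    mfderiv IU IM G.ν (s.σ m) (mfderiv IM IU s.σ m w) = w := by
  have h1 := (G.mdifferentiable_ν (s.σ m)).hasMFDerivAt.comp m
    (mdifferentiableAt_section s hm).hasMFDerivAt
  have h2 := h1.congr_of_eventuallyEq (f₁ := id) (by
    filter_upwards [s.isOpen_dom.mem_nhds hm] with m' hm'
    exact (s.ν_σ m' hm').symm)
  exact congrArg (fun L : EM →L[ℝ] EM ↦ L w) (hasMFDerivAt_unique h2 (hasMFDerivAt_id m))

end ControlStructure

lemma IsLocalLinearization.mem_source {E H : Type*} [NormedAddCommGroup E] [NormedSpace ℝ E]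
    [TopologicalSpace H] {I : ModelWithCorners ℝ E H} {N : Type*} [TopologicalSpace N]
    [ChartedSpace H N] [IsManifold I ∞ N] {v : ∀ x : N, TangentSpace I x} {W : Set N}
    {γ : ℝ → N} {α β t₀ ε : ℝ} {x : ℝ → E} {Z V : ℝ → E →L[ℝ] E}
    (h : IsLocalLinearization v W γ α β t₀ ε x Z V) {t : ℝ}
    (ht : t ∈ Icc α β ∩ Ioo (t₀ - ε) (t₀ + ε)) :
    γ t ∈ (chartAt H (γ t₀)).source ∧ x t = extChartAt I (γ t₀) (γ t) := by
  rw [h.eq_symm t ht, (extChartAt I (γ t₀)).right_inv (h.mem t ht.2).1, ← extChartAt_source I]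
  exact ⟨(extChartAt I (γ t₀)).map_target (h.mem t ht.2).1, rfl⟩

namespace OptimalControlStructure

variable (G : OptimalControlStructure IM IU IQ IK M U Q K)

/-- The function `u' ↦ ⟨p, 𝐓 (ρ u')⟩ + λ L(u')`, for a covector `p` that is constant in the chart
centred at `x₀`. -/
def ham (lam : ℝ) (x₀ : M) (p : EM →L[ℝ] ℝ) (u' : U) : ℝ :=
  p (toCoord IM x₀ (G.ν u') (G.ρ u').1) + lam * G.L u'

lemma contMDiffAt_vel_coord {x₀ : M} {u' : U} (h : G.ν u' ∈ (chartAt HM x₀).source) :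
    ContMDiffAt IU 𝓘(ℝ, EM) ∞ (fun z ↦ toCoord IM x₀ (G.ν z) (G.ρ z).1) u' :=
  contMDiffAt_toCoord IM (f := fun z ↦ (⟨G.ν z, (G.ρ z).1⟩ : TangentBundle IM M))
    (s := univ) (G.contMDiff_ρ u') h

lemma mdifferentiableAt_ham (lam : ℝ) {x₀ : M} (p : EM →L[ℝ] ℝ) {u' : U}
    (h : G.ν u' ∈ (chartAt HM x₀).source) :
    MDifferentiableAt IU 𝓘(ℝ, ℝ) (G.ham lam x₀ p) u' := by
  have h1 : ContMDiffAt IU 𝓘(ℝ, ℝ) ∞ (fun z ↦ p (toCoord IM x₀ (G.ν z) (G.ρ z).1)) u' :=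
    p.contMDiff.contMDiffAt.comp u' (G.contMDiffAt_vel_coord h)
  have h2 : ContMDiffAt IU 𝓘(ℝ, ℝ) ∞ (fun z ↦ lam * G.L z) u' :=
    (contMDiff_const.mul G.contMDiff_L).contMDiffAt
  exact (h1.add h2).mdifferentiableAt (by simp)

/-- The adjoint equation at time `t`, for a curve `α` of covectors along `ν ∘ u`. -/
def AdjointAt (lam : ℝ) (u : ℝ → U) (α : ∀ t, TangentSpace IM (G.ν (u t)) →L[ℝ] ℝ) (s : Set ℝ)
    (t : ℝ) : Prop :=
  ∃ α' : EM →L[ℝ] ℝ,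
    HasDerivWithinAt (fun r ↦ (α r).comp (ofCoord IM (G.ν (u t)) (G.ν (u r)))) α' s t ∧
    ∀ w : TangentSpace IU (u t), α' (mfderiv IU IM G.ν (u t) w) +
      dAt IU (G.ham lam (G.ν (u t)) (α t)) (u t) w = 0

variable {G}

/-- The derivative of `u' ↦ ⟨p, 𝐓 (ρ u')⟩` in the direction of a local section. -/
lemma mfderiv_ham_section [IM.Boundaryless] (s : G.LocalSection) {m : M} (hm : m ∈ s.dom)
    (p : EM →L[ℝ] ℝ) (w : TangentSpace IM m) :
    dAt IU (G.ham 0 m p) (s.σ m) (mfderiv IM IU s.σ m w) =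
      p (fderiv ℝ (coordField IM (G.field s) m) (extChartAt IM m m) w) := by
  have hsrc : G.ν (s.σ m) ∈ (chartAt HM m).source := by
    rw [s.ν_σ m hm]; exact mem_chart_source HM m
  have h1 := (G.mdifferentiableAt_ham 0 p hsrc).hasMFDerivAt.comp m
    (ControlStructure.mdifferentiableAt_section s hm).hasMFDerivAt
  have hF : HasFDerivAt (coordField IM (G.field s) m)
      (fderiv ℝ (coordField IM (G.field s) m) (extChartAt IM m m)) (extChartAt IM m m) :=
    (((contDiffOn_coordField IM (ControlStructure.contMDiffOn_field s) m).contDiffAt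
      ((isOpen_coordDom IM s.isOpen_dom m).mem_nhds
        (extChartAt_mem_coordDom IM (mem_chart_source HM m) hm))).differentiableAt
      (by simp)).hasFDerivAt
  have h2 := (p.hasFDerivAt.comp _ hF).hasMFDerivAt.comp m
    (hasMFDerivAt_extChartAt_toCoord IM (mem_chart_source HM m))
  have h3 := h2.congr_of_eventuallyEq (f₁ := G.ham 0 m p ∘ s.σ) (by
    filter_upwards [s.isOpen_dom.mem_nhds hm,
      (chartAt HM m).open_source.mem_nhds (mem_chart_source HM m)] with z hz hz'
    simp only [Function.comp_apply, ham, zero_mul, add_zero]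
    rw [coordField_extChartAt IM _ hz']
    have := s.ν_σ z hz
    exact congrArg p (toCoord_congr IM this _))
  have h4 := congrArg (fun L : EM →L[ℝ] ℝ ↦ L w) (hasMFDerivAt_unique h1 h3)
  refine h4.trans ?_
  change p (fderiv ℝ (coordField IM (G.field s) m) (extChartAt IM m m) (toCoord IM m m w)) = _
  rw [toCoord_self]

/-- At a maximum over the fibre, the derivative of `u' ↦ ⟨p, 𝐓 (ρ u')⟩` is determined by a local
section. -/
lemma dAt_ham_of_fibre_max [IM.Boundaryless] [IK.Boundaryless] (s : G.LocalSection) {m : M}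
    (hm : m ∈ s.dom) (p : EM →L[ℝ] ℝ)
    (hmax : ∀ u', G.ν u' = m → G.ham 0 m p u' ≤ G.ham 0 m p (s.σ m))
    (w : TangentSpace IU (s.σ m)) :
    dAt IU (G.ham 0 m p) (s.σ m) w =
      p (fderiv ℝ (coordField IM (G.field s) m) (extChartAt IM m m)
        (mfderiv IU IM G.ν (s.σ m) w)) := by
  have hν := s.ν_σ m hm
  have hsrc : G.ν (s.σ m) ∈ (chartAt HM m).source := by
    rw [hν]; exact mem_chart_source HM m
  set w' : TangentSpace IM m := mfderiv IU IM G.ν (s.σ m) w with hw'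
  -- A vector minus the lift of its projection through the section is tangent to the fibre, where
  -- the derivative vanishes by maximality.
  have h1 : mfderiv IU IM G.ν (s.σ m) (w - mfderiv IM IU s.σ m w') = 0 := by
    have h2 := ControlStructure.mfderiv_ν_section s hm w'
    exact (map_sub _ _ _).trans (sub_eq_zero.2 (hw'.symm.trans h2.symm))
  have h3 := G.mfderiv_eq_zero_of_fibre_max (G.mdifferentiableAt_ham 0 p hsrc)
    (fun u' hu' ↦ hmax u' (hu'.trans hν)) h1
  have h4 := mfderiv_ham_section s hm p w'
  rw [map_sub, sub_eq_zero] at h3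
  exact h3.trans h4

lemma ham_self {m : M} {u' : U} (h : G.ν u' = m) (p : EM →L[ℝ] ℝ) (lam : ℝ) :
    G.ham lam m p u' = p (G.vel m u') + lam * G.L u' := by
  subst h
  rw [ham, toCoord_self]
  rfl

end OptimalControlStructure

namespace ControlStructure.FlowData

variable [IM.Boundaryless] [FiniteDimensional ℝ EM] [T2Space M]
  {G : OptimalControlStructure IM IU IQ IK M U Q K} {a b : ℝ} {u : ℝ → U}
  (P : G.FlowData a b u)

/-- Covectors that are transported by the composite flow satisfy the adjoint equation where the
maximum condition holds. -/
lemma adjointAt_comp_transport [IK.Boundaryless] (i : Fin P.len) {t₀ : ℝ}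
    (ht₀ : t₀ ∈ Ioc (P.pt i.castSucc) (P.pt i.succ))
    (κ : TangentSpace IM (G.ν (u b)) →L[ℝ] ℝ)
    (hmax : ∀ u', G.ν u' = G.ν (u t₀) → κ (P.transport t₀ (G.vel (G.ν (u t₀)) u')) ≤
      κ (P.transport t₀ (G.vel (G.ν (u t₀)) (u t₀)))) :
    G.AdjointAt 0 u (fun t ↦ κ.comp (P.transport t)) (Icc (P.pt i.castSucc) (P.pt i.succ)) t₀ := by
  have ht₀' := Ioc_subset_Icc_self ht₀
  obtain ⟨ε, x, Z, V, h, B, -, hB⟩ := P.exists_transport_eq i ht₀'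
  have hε := h.pos
  have ht₀J : t₀ ∈ Ioo (t₀ - ε) (t₀ + ε) := ⟨by linarith, by linarith⟩
  have hcoord : ∀ t ∈ Icc (P.pt i.castSucc) (P.pt i.succ) ∩ Ioo (t₀ - ε) (t₀ + ε),
      (κ.comp (P.transport t)).comp (ofCoord IM (G.ν (u t₀)) (G.ν (u t))) =
        (κ.comp B).comp (Z t) := by
    intro t ht
    rw [hB t ht]
    ext z
    have := toCoord_ofCoord IM (h.mem_source ht).1 z
    exact congrArg (fun y ↦ κ (B (Z t y))) this
  have hκ : ∀ z : EM, κ (P.transport t₀ z) = κ (B z) := by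
    intro z
    have h1 := hcoord t₀ ⟨ht₀', ht₀J⟩
    rw [h.Z_base] at h1
    have h2 := congrArg (fun L : EM →L[ℝ] ℝ ↦ L z) h1
    have h3 : ofCoord IM (G.ν (u t₀)) (G.ν (u t₀)) z = z := ofCoord_self IM z
    change κ (P.transport t₀ (ofCoord IM (G.ν (u t₀)) (G.ν (u t₀)) z)) = κ (B z) at h2
    rwa [h3] at h2
  have hx := (h.mem_source ⟨ht₀', ht₀J⟩).2
  refine ⟨-((κ.comp B).comp (fderiv ℝ (coordField IM (G.field (P.sec i)) (G.ν (u t₀))) (x t₀))),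
    ?_, ?_⟩
  · have h1 : HasDerivAt (fun t ↦ (κ.comp B).comp (Z t)) ((κ.comp B).comp
        (-(Z t₀ * fderiv ℝ (coordField IM (G.field (P.sec i)) (G.ν (u t₀))) (x t₀)))) t₀ :=
      ((ContinuousLinearMap.compL ℝ EM EM ℝ) (κ.comp B)).hasFDerivAt.comp_hasDerivAt t₀
        (h.deriv_Z t₀ ht₀J)
    rw [h.Z_base, one_mul, ContinuousLinearMap.comp_neg] at h1
    refine h1.hasDerivWithinAt.congr_of_eventuallyEq ?_ (hcoord t₀ ⟨ht₀', ht₀J⟩)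
    filter_upwards [self_mem_nhdsWithin,
      mem_nhdsWithin_of_mem_nhds (Ioo_mem_nhds ht₀J.1 ht₀J.2)] with t h1 h2
    exact hcoord t ⟨h1, h2⟩
  · have hu : u t₀ = (P.sec i).σ (G.ν (u t₀)) := P.control i t₀ ht₀
    have hmem : G.ν (u t₀) ∈ (P.sec i).dom := P.mem_dom i t₀ ht₀'
    have hκ' : ∀ z : EM, (κ.comp (P.transport t₀) : EM →L[ℝ] ℝ) z = κ (B z) := hκ
    intro w
    -- The equality `u t₀ = σ (c t₀)` is only propositional while tangent spaces depend on the
    -- point, so the claim is made for a variable `u₁` and the equality is substituted.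
    have key : ∀ u₁ : U, u₁ = (P.sec i).σ (G.ν (u t₀)) → ∀ w : EU,
        dAt IU (G.ham 0 (G.ν (u t₀)) (κ.comp (P.transport t₀))) u₁ w =
        (κ.comp (P.transport t₀) : EM →L[ℝ] ℝ)
          (fderiv ℝ (coordField IM (G.field (P.sec i)) (G.ν (u t₀)))
          (extChartAt IM (G.ν (u t₀)) (G.ν (u t₀))) (mfderiv IU IM G.ν u₁ w)) := by
      rintro u₁ hu₁ w
      subst hu₁
      refine OptimalControlStructure.dAt_ham_of_fibre_max (P.sec i) hmem _ (fun u' hu' ↦ ?_) w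
      rw [OptimalControlStructure.ham_self hu',
        OptimalControlStructure.ham_self ((P.sec i).ν_σ _ hmem), ← hu]
      simpa using! hmax u' hu'
    have h5 := (key _ hu w).trans (hκ' _)
    rw [← hx] at h5
    exact (congrArg (_ + ·) h5).trans (neg_add_cancel _)

/-- The pairing of a solution of the adjoint equation with a transported vector is stationary. -/
lemma hasDerivWithinAt_pairing (i : Fin P.len) {t₀ : ℝ}
    (ht₀ : t₀ ∈ Ioc (P.pt i.castSucc) (P.pt i.succ))
    {α : ∀ t, TangentSpace IM (G.ν (u t)) →L[ℝ] ℝ}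
    (hα : G.AdjointAt 0 u α (Icc (P.pt i.castSucc) (P.pt i.succ)) t₀)
    {w : TangentSpace IM (G.ν (u b))} {y : ∀ t, TangentSpace IM (G.ν (u t))}
    (hy : ∀ t ∈ Icc (P.pt i.castSucc) (P.pt i.succ), P.transport t (y t) = w) :
    HasDerivWithinAt (fun t ↦ α t (y t)) 0 (Icc (P.pt i.castSucc) (P.pt i.succ)) t₀ := by
  have ht₀' := Ioc_subset_Icc_self ht₀
  obtain ⟨ε, x, Z, V, h, B, hBb, hB⟩ := P.exists_transport_eq i ht₀'
  have hε := h.pos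
  have ht₀J : t₀ ∈ Ioo (t₀ - ε) (t₀ + ε) := ⟨by linarith, by linarith⟩
  obtain ⟨z, rfl⟩ := hBb.2 w
  have hyV : ∀ t ∈ Icc (P.pt i.castSucc) (P.pt i.succ) ∩ Ioo (t₀ - ε) (t₀ + ε),
      y t = ofCoord IM (G.ν (u t₀)) (G.ν (u t)) (V t z) := by
    intro t ht
    have h1 := hy t ht.1
    rw [hB t ht] at h1
    have h2 : Z t (toCoord IM (G.ν (u t₀)) (G.ν (u t)) (y t)) = z := hBb.1 h1
    have h3 := congrArg (fun A : EM →L[ℝ] EM ↦ A (toCoord IM (G.ν (u t₀)) (G.ν (u t)) (y t)))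
      (h.VZ t ht.2)
    have h4 : V t z = toCoord IM (G.ν (u t₀)) (G.ν (u t)) (y t) := by
      rw [← h2]; exact h3
    rw [h4, ofCoord_toCoord IM (h.mem_source ht).1]
  obtain ⟨α', hα', hw⟩ := hα
  have hV : HasDerivAt (fun t ↦ V t z)
      ((fderiv ℝ (coordField IM (G.field (P.sec i)) (G.ν (u t₀))) (x t₀)) z) t₀ := by
    have h1 := (h.deriv_V t₀ ht₀J).clm_apply (hasDerivAt_const t₀ z)
    rw [h.V_base, mul_one] at h1
    simpa using h1
  have h1 := hα'.clm_apply hV.hasDerivWithinAt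
  have hu : u t₀ = (P.sec i).σ (G.ν (u t₀)) := P.control i t₀ ht₀
  have hmem : G.ν (u t₀) ∈ (P.sec i).dom := P.mem_dom i t₀ ht₀'
  have hx := (h.mem_source ⟨ht₀', ht₀J⟩).2
  have key : ∀ u₁ : U, u₁ = (P.sec i).σ (G.ν (u t₀)) →
      (∀ w : EU, α' (mfderiv IU IM G.ν u₁ w) + dAt IU (G.ham 0 (G.ν (u t₀)) (α t₀)) u₁ w = 0) →
      α' z + (α t₀ : EM →L[ℝ] ℝ) (fderiv ℝ (coordField IM (G.field (P.sec i)) (G.ν (u t₀)))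
          (extChartAt IM (G.ν (u t₀)) (G.ν (u t₀))) z) = 0 := by
    rintro u₁ hu₁ h2
    subst hu₁
    -- Testing the equation on the lift of `z` through the section makes `dH` equal to `α t₀ ∘ DF`,
    -- which is the contribution of the linearized equation for `V`.
    have h3 := h2 (mfderiv IM IU (P.sec i).σ (G.ν (u t₀)) z)
    have h4 := OptimalControlStructure.mfderiv_ham_section (P.sec i) hmem (α t₀) z
    have h5 : mfderiv IU IM G.ν ((P.sec i).σ (G.ν (u t₀)))
      (mfderiv IM IU (P.sec i).σ (G.ν (u t₀)) z) = z := ControlStructure.mfderiv_ν_section _ hmem z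
    rw [h4] at h3
    rw [← h3]
    congr 2
    exact h5.symm
  have h2 := key _ hu hw
  have h3 : HasDerivWithinAt (fun t ↦ ((α t).comp (ofCoord IM (G.ν (u t₀)) (G.ν (u t)))) (V t z)) 0
      (Icc (P.pt i.castSucc) (P.pt i.succ)) t₀ := by
    refine h1.congr_deriv ?_
    rw [← h2, h.V_base, hx]
    congr 1
    exact congrArg (α t₀) (ofCoord_self IM _)
  refine h3.congr_of_eventuallyEq ?_ (congrArg (α t₀) (hyV t₀ ⟨ht₀', ht₀J⟩))
  filter_upwards [self_mem_nhdsWithin,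
    mem_nhdsWithin_of_mem_nhds (Ioo_mem_nhds ht₀J.1 ht₀J.2)] with t h1 h2
  exact congrArg (α t) (hyV t ⟨h1, h2⟩)

end ControlStructure.FlowData
end Adjoint

/-! ### Curves in the cotangent bundle -/

section CotangentCurves

variable {E H : Type*} [NormedAddCommGroup E] [NormedSpace ℝ E] [TopologicalSpace H]
  (I : ModelWithCorners ℝ E H) {M : Type*} [TopologicalSpace M] [ChartedSpace H M]
  [IsManifold I ∞ M]

/-- The chart need not be centred at the point considered; this serves curves of covectors with
constant coordinates in one chart. -/
lemma contMDiffWithinAt_cotangent_iff_of_mem {f : ℝ → Cotangent I M} {s : Set ℝ} {t : ℝ} {x₀ : M}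
    (hx : (f t).1 ∈ (chartAt H x₀).source) :
    ContMDiffWithinAt 𝓘(ℝ, ℝ) (I.prod 𝓘(ℝ, E →L[ℝ] ℝ)) ∞ f s t ↔
      ContMDiffWithinAt 𝓘(ℝ, ℝ) I ∞ (fun r ↦ (f r).1) s t ∧
      ContDiffWithinAt ℝ ∞ (fun r ↦ (f r).2.comp (ofCoord I x₀ (f r).1)) s t := by
  set e := trivializationAt (E →L[ℝ] ℝ) (fun m : M ↦ TangentSpace I m →L[ℝ] ℝ) x₀ with he
  have hmem : f t ∈ e.source := by
    rw [e.mem_source, he, hom_trivializationAt_baseSet]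
    exact ⟨by simpa using hx, by simp⟩
  rw [e.contMDiffWithinAt_iff (IB := I) hmem, ← contMDiffWithinAt_iff_contDiffWithinAt]
  have : ∀ r, (e (f r)).2 = (f r).2.comp (ofCoord I x₀ (f r).1) := fun r ↦ by
    rw [← inCoordinates_covector, he, hom_trivializationAt_apply]
  simp only [this]

/-- The velocity of a curve in the cotangent bundle in canonical coordinates. -/
lemma mfderiv_cotangent_apply {f : ℝ → Cotangent I M} {t : ℝ}
    (hf : ContMDiffAt 𝓘(ℝ, ℝ) (I.prod 𝓘(ℝ, E →L[ℝ] ℝ)) ∞ f t) {x' : E} {a' : E →L[ℝ] ℝ}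
    (hx : HasDerivAt (fun r ↦ extChartAt I (f t).1 (f r).1) x' t)
    (ha : HasDerivAt (fun r ↦ (f r).2.comp (ofCoord I (f t).1 (f r).1)) a' t) :
    (mfderiv 𝓘(ℝ, ℝ) (I.prod 𝓘(ℝ, E →L[ℝ] ℝ)) f t (1 : ℝ) : E × (E →L[ℝ] ℝ)) = (x', a') := by
  have h1 := (hf.mdifferentiableAt (by simp)).mfderiv
  have h2 : HasDerivAt (fun r ↦ (extChartAt I (f t).1 (f r).1,
    (f r).2.comp (ofCoord I (f t).1 (f r).1))) (x', a') t := hx.prodMk ha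
  rw [h1]
  have h3 : (writtenInExtChartAt 𝓘(ℝ, ℝ) (I.prod 𝓘(ℝ, E →L[ℝ] ℝ)) t f) =ᶠ[𝓝 t]
      (fun r ↦ (extChartAt I (f t).1 (f r).1, (f r).2.comp (ofCoord I (f t).1 (f r).1))) := by
    have hc : ContinuousAt (fun r ↦ (f r).1) t :=
      ((FiberBundle.continuous_proj (E →L[ℝ] ℝ)
        (fun m : M ↦ TangentSpace I m →L[ℝ] ℝ)).continuousAt).comp hf.continuousAt
    filter_upwards [hc.preimage_mem_nhds
      ((chartAt H (f t).1).open_source.mem_nhds (mem_chart_source H (f t).1))] with r hr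
    have h4 : (trivializationAt (E →L[ℝ] ℝ) (fun m : M ↦ TangentSpace I m →L[ℝ] ℝ) (f t).1) (f r) =
        ((f r).1, (f r).2.comp (ofCoord I (f t).1 (f r).1)) := by
      rw [← inCoordinates_covector, hom_trivializationAt_apply]
    simp only [writtenInExtChartAt, extChartAt_model_space_eq_id, PartialEquiv.refl_symm,
      PartialEquiv.refl_coe, Function.comp_apply, id_eq]
    rw [FiberBundle.extChartAt]
    simp only [PartialEquiv.coe_trans, Function.comp_apply, PartialEquiv.prod_coe,
      PartialEquiv.refl_coe, id_eq]
    exact congrArg (fun z : M × (E →L[ℝ] ℝ) ↦ (extChartAt I (f t).1 z.1, z.2)) h4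
  have h5 := h2.congr_of_eventuallyEq h3
  simp only [extChartAt_model_space_eq_id, PartialEquiv.refl_coe, id_eq]
  rw [show range 𝓘(ℝ, ℝ) = univ from by simp, fderivWithin_univ]
  exact h5.deriv

/-- The point is that `dτ` has smooth coefficients, so the multiples of `dτ` subtracted in `H_λ`
preserve smoothness. -/
lemma dAt_comp_ofCoord [I.Boundaryless] {τ : M → ℝ}
    (hτ : ContMDiff I 𝓘(ℝ, ℝ) ∞ τ) {x₀ x : M}
    (hx : x ∈ (chartAt H x₀).source) :
    (dAt I τ x).comp (ofCoord I x₀ x) =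
      fderiv ℝ (τ ∘ (extChartAt I x₀).symm) (extChartAt I x₀ x) := by
  have hx' : x ∈ (extChartAt I x₀).source := by rwa [extChartAt_source I]
  have h1 := hasMFDerivAt_extChartAt_symm_ofCoord I ((extChartAt I x₀).map_source hx')
  have h2 : HasMFDerivAt I 𝓘(ℝ, ℝ) τ ((extChartAt I x₀).symm (extChartAt I x₀ x))
    (dAt I τ ((extChartAt I x₀).symm (extChartAt I x₀ x))) :=
    (hτ.mdifferentiableAt (by simp)).hasMFDerivAt
  have h3 := (HasMFDerivAt.comp _ h2 h1).mfderiv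
  rw [mfderiv_eq_fderiv, (extChartAt I x₀).left_inv hx'] at h3
  exact h3.symm

lemma contDiffWithinAt_dAt_comp_ofCoord [I.Boundaryless] {τ : M → ℝ} (hτ : ContMDiff I 𝓘(ℝ, ℝ) ∞ τ) {x₀ : M}
    {c : ℝ → M} {s : Set ℝ} {t : ℝ} (hc : ContMDiffWithinAt 𝓘(ℝ, ℝ) I ∞ c s t)
    (hx : c t ∈ (chartAt H x₀).source) :
    ContDiffWithinAt ℝ ∞ (fun r ↦ (dAt I τ (c r)).comp (ofCoord I x₀ (c r))) s t := by
  have h1 : ContDiffOn ℝ ∞ (τ ∘ (extChartAt I x₀).symm) (extChartAt I x₀).target :=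
    (hτ.comp_contMDiffOn (contMDiffOn_extChartAt_symm x₀)).contDiffOn
  have hx' : c t ∈ (extChartAt I x₀).source := by rwa [extChartAt_source I]
  have h2 := (h1.fderiv_of_isOpen (m := ∞) (isOpen_extChartAt_target x₀) le_rfl).contDiffAt
    ((isOpen_extChartAt_target x₀).mem_nhds ((extChartAt I x₀).map_source hx'))
  have h3 : ContDiffWithinAt ℝ ∞ (fun r ↦ extChartAt I x₀ (c r)) s t :=
    ((contMDiffAt_extChartAt' hx).comp_contMDiffWithinAt t hc).contDiffWithinAt
  refine (h2.comp_contDiffWithinAt t h3).congr_of_eventuallyEq ?_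
    (dAt_comp_ofCoord I hτ hx)
  filter_upwards [hc.continuousWithinAt.preimage_mem_nhdsWithin
    ((chartAt H x₀).open_source.mem_nhds hx)] with r hr
  exact dAt_comp_ofCoord I hτ hr

end CotangentCurves

/-! ### The map `H_λ` along curves and its velocity -/

section Characteristic

variable {EM HM EU HU EQ HQ EK HK : Type*}
  [NormedAddCommGroup EM] [NormedSpace ℝ EM] [TopologicalSpace HM]
  [NormedAddCommGroup EU] [NormedSpace ℝ EU] [TopologicalSpace HU]
  [NormedAddCommGroup EQ] [NormedSpace ℝ EQ] [TopologicalSpace HQ]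
  [NormedAddCommGroup EK] [NormedSpace ℝ EK] [TopologicalSpace HK]
  {IM : ModelWithCorners ℝ EM HM} {IU : ModelWithCorners ℝ EU HU}
  {IQ : ModelWithCorners ℝ EQ HQ} {IK : ModelWithCorners ℝ EK HK}
  {M U Q K : Type*}
  [TopologicalSpace M] [ChartedSpace HM M] [IsManifold IM ∞ M]
  [TopologicalSpace U] [ChartedSpace HU U]
  [TopologicalSpace Q] [ChartedSpace HQ Q]
  [TopologicalSpace K] [ChartedSpace HK K]

lemma hasDerivAt_comp_curve {E H N F : Type*} [NormedAddCommGroup E] [NormedSpace ℝ E]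
    [TopologicalSpace H] {I : ModelWithCorners ℝ E H} [TopologicalSpace N] [ChartedSpace H N]
    [NormedAddCommGroup F] [NormedSpace ℝ F] {f : N → F} {γ : ℝ → N} {t : ℝ}
    (hf : MDifferentiableAt I 𝓘(ℝ, F) f (γ t)) {w : TangentSpace I (γ t)}
    (hγ : HasMFDerivAt 𝓘(ℝ, ℝ) I γ t ((1 : ℝ →L[ℝ] ℝ).smulRight w)) :
    HasDerivAt (fun r ↦ f (γ r)) (mfderiv I 𝓘(ℝ, F) f (γ t) w : F) t := by
  have h := (HasMFDerivAt.comp t hf.hasMFDerivAt hγ).hasFDerivAt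
  refine hasDerivAt_iff_hasFDerivAt.2 (HasFDerivAt.congr_fderiv h ?_)
  ext
  exact map_smul (mfderiv I 𝓘(ℝ, F) f (γ t)) (1 : ℝ) w

lemma hasMFDerivAt_clm_comp {E H N F : Type*} [NormedAddCommGroup E] [NormedSpace ℝ E]
    [TopologicalSpace H] {I : ModelWithCorners ℝ E H} [TopologicalSpace N] [ChartedSpace H N]
    [NormedAddCommGroup F] [NormedSpace ℝ F] {g : N → F} {n : N}
    (hg : MDifferentiableAt I 𝓘(ℝ, F) g n) (A : F →L[ℝ] ℝ) :
    HasMFDerivAt I 𝓘(ℝ, ℝ) (fun z ↦ A (g z)) n (A.comp (mfderiv I 𝓘(ℝ, F) g n)) :=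
  A.hasFDerivAt.hasMFDerivAt.comp n hg.hasMFDerivAt

namespace OptimalControlStructure

variable (G : OptimalControlStructure IM IU IQ IK M U Q K)

lemma hCov_apply_vert (lam : ℝ) (u : U) (η : CoVert IM G.τ (G.ν u)) (v : Vert IM G.τ (G.ν u)) :
    G.hCov lam u η v = η v := by
  have hv : dAt IM G.τ (G.ν u) v = 0 := v.2
  have h1 : G.vertProj u v = v := by
    apply Subtype.ext
    change (v : TangentSpace IM (G.ν u)) - dAt IM G.τ (G.ν u) v • (G.ρ u).1 = v
    rw [hv, zero_smul, sub_zero]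
  change η (G.vertProj u v) - (lam * G.L u) * dAt IM G.τ (G.ν u) v = η v
  rw [h1, hv, mul_zero, sub_zero]

/-- Any extension `A` of `η` differs from `H_λ(u, η)` by a multiple of `dτ`, which the value on `𝐓(ρ
u)` determines. Along a curve `A` may be taken smooth, which gives the smoothness of `H_λ`. -/
lemma hCov_eq (lam : ℝ) (u : U) (η : CoVert IM G.τ (G.ν u)) (A : TangentSpace IM (G.ν u) →L[ℝ] ℝ)
    (hA : ∀ v : Vert IM G.τ (G.ν u), A v = η v) :
    G.hCov lam u η = A - (A (G.ρ u).1 + lam * G.L u) • dAt IM G.τ (G.ν u) := by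
  ext v
  change η (G.vertProj u v) - (lam * G.L u) * dAt IM G.τ (G.ν u) v =
    A v - (A (G.ρ u).1 + lam * G.L u) * dAt IM G.τ (G.ν u) v
  rw [← hA]
  change A (v - dAt IM G.τ (G.ν u) v • (G.ρ u).1) - _ = _
  rw [map_sub, map_smul, smul_eq_mul]
  ring

lemma hCov_vel (lam : ℝ) (u : U) (η : CoVert IM G.τ (G.ν u)) :
    G.hCov lam u η (G.ρ u).1 + lam * G.L u = 0 := by
  have h := (G.ρ u).2
  have h1 : G.vertProj u (G.ρ u).1 = 0 := by
    apply Subtype.ext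
    change (G.ρ u).1 - dAt IM G.τ (G.ν u) (G.ρ u).1 • (G.ρ u).1 = 0
    rw [h, one_smul, sub_self]
  change η (G.vertProj u (G.ρ u).1) - (lam * G.L u) * dAt IM G.τ (G.ν u) (G.ρ u).1 +
    lam * G.L u = 0
  rw [h1, h, map_zero]
  ring

variable {G}

lemma contMDiffOn_hMap [IM.Boundaryless] (lam : ℝ) {p : ℝ → G.Phase} {s : Set ℝ}
    (hp : G.SmoothPhaseOn p s) :
    ContMDiffOn 𝓘(ℝ, ℝ) (IM.prod 𝓘(ℝ, EM →L[ℝ] ℝ)) ∞ (fun r ↦ G.hMap lam (p r)) s := by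
  obtain ⟨hu, A, hA, hAη⟩ := hp
  intro t ht
  have hc : ContMDiffWithinAt 𝓘(ℝ, ℝ) IM ∞ (fun r ↦ G.ν (p r).1) s t :=
    (G.bundle_ν.contMDiff _).comp_contMDiffWithinAt t (hu t ht)
  rw [contMDiffWithinAt_cotangent_iff]
  refine ⟨hc, ?_⟩
  have h1 := ((contMDiffWithinAt_cotangent_iff IM).1 (hA t ht)).2
  have h2 := contDiffWithinAt_dAt_comp_ofCoord IM G.bundle_τ.contMDiff hc
    (mem_chart_source HM (G.ν (p t).1))
  have h3 : ContDiffWithinAt ℝ ∞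
      (fun r ↦ toCoord IM (G.ν (p t).1) (G.ν (p r).1) (G.ρ (p r).1).1) s t :=
    (ContMDiffAt.comp_contMDiffWithinAt
      (g := fun z ↦ toCoord IM (G.ν (p t).1) (G.ν z) (G.ρ z).1) t
      (G.contMDiffAt_vel_coord (mem_chart_source HM (G.ν (p t).1))) (hu t ht)).contDiffWithinAt
  have h4 : ContDiffWithinAt ℝ ∞ (fun r ↦ lam * G.L (p r).1) s t :=
    contDiffWithinAt_const.mul
      ((G.contMDiff_L _).comp_contMDiffWithinAt t (hu t ht)).contDiffWithinAt
  have h5 := h1.sub (((h1.clm_apply h3).add h4).smul h2)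
  have key : ∀ r, r ∈ s → G.ν (p r).1 ∈ (chartAt HM (G.ν (p t).1)).source →
      (G.hCov lam (p r).1 (p r).2).comp (ofCoord IM (G.ν (p t).1) (G.ν (p r).1)) =
      (A r).comp (ofCoord IM (G.ν (p t).1) (G.ν (p r).1)) -
      ((A r).comp (ofCoord IM (G.ν (p t).1) (G.ν (p r).1))
        (toCoord IM (G.ν (p t).1) (G.ν (p r).1) (G.ρ (p r).1).1) + lam * G.L (p r).1) •
      (dAt IM G.τ (G.ν (p r).1)).comp (ofCoord IM (G.ν (p t).1) (G.ν (p r).1)) := by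
    intro r hr hsrc
    rw [G.hCov_eq lam _ _ (A r) (hAη r hr)]
    ext v
    have := ofCoord_toCoord IM hsrc (G.ρ (p r).1).1
    change A r _ - (A r _ + _) * _ = A r _ - (A r (ofCoord IM _ _ (toCoord IM _ _ _)) + _) * _
    rw [this]
    rfl
  refine h5.congr_of_eventuallyEq ?_ (key t ht (mem_chart_source HM _))
  filter_upwards [self_mem_nhdsWithin, hc.continuousWithinAt.preimage_mem_nhdsWithin
    ((chartAt HM (G.ν (p t).1)).open_source.mem_nhds (mem_chart_source HM _))] with r hr hr'
  exact key r hr hr'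

/-- The velocity in `T*M` of the image under `H_λ` of a curve in `U ×_M V*τ`. -/
lemma hVel_eq [IM.Boundaryless] (lam : ℝ) {p : ℝ → G.Phase} {s : Set ℝ} {t : ℝ}
    (hs : s ∈ 𝓝 t) (hp : G.SmoothPhaseOn p s) {w : TangentSpace IU (p t).1}
    (hw : HasMFDerivAt 𝓘(ℝ, ℝ) IU (fun r ↦ (p r).1) t ((1 : ℝ →L[ℝ] ℝ).smulRight w)) :
    ∃ a' : EM →L[ℝ] ℝ,
      HasDerivAt (fun r ↦ (G.hCov lam (p r).1 (p r).2).comp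
        (ofCoord IM (G.ν (p t).1) (G.ν (p r).1))) a' t ∧
      (G.hVel lam p t : EM × (EM →L[ℝ] ℝ)) = (mfderiv IU IM G.ν (p t).1 w, a') ∧
      a' (G.ρ (p t).1).1 +
        dAt IU (G.ham lam (G.ν (p t).1) (G.hCov lam (p t).1 (p t).2)) (p t).1 w = 0 := by
  have hh := (contMDiffOn_hMap lam hp).contMDiffAt hs
  have hd := (((contMDiffWithinAt_cotangent_iff IM).1
    (contMDiffWithinAt_univ.2 hh)).2.contDiffAt Filter.univ_mem).differentiableAt (by simp)
  have hν : HasMFDerivAt 𝓘(ℝ, ℝ) IM (fun r ↦ G.ν (p r).1) t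
      ((1 : ℝ →L[ℝ] ℝ).smulRight (mfderiv IU IM G.ν (p t).1 w)) := by
    refine ((G.mdifferentiable_ν _).hasMFDerivAt.comp t hw).congr_mfderiv ?_
    ext
    exact map_smul (mfderiv IU IM G.ν (p t).1) (1 : ℝ) w
  have hx := hasDerivWithinAt_extChartAt_comp IM (mem_chart_source HM (G.ν (p t).1))
    (hasMFDerivWithinAt_univ.2 hν)
  replace hx : HasDerivAt (fun r ↦ extChartAt IM (G.ν (p t).1) (G.ν (p r).1))
      (mfderiv IU IM G.ν (p t).1 w : EM) t :=
    hasDerivWithinAt_univ.1 (hx.congr_deriv (toCoord_self IM _))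
  refine ⟨_, hd.hasDerivAt, mfderiv_cotangent_apply IM hh hx hd.hasDerivAt, ?_⟩
  set x₀ := G.ν (p t).1 with hx₀
  set a' := deriv (fun r ↦ (G.hMap lam (p r)).2.comp (ofCoord IM x₀ (G.hMap lam (p r)).1)) t
  have h1 : HasDerivAt (fun r ↦ (G.hCov lam (p r).1 (p r).2).comp
    (ofCoord IM x₀ (G.ν (p r).1))) a' t := hd.hasDerivAt
  have hsrc := mem_chart_source HM x₀
  have h2 : HasDerivAt (fun r ↦ toCoord IM x₀ (G.ν (p r).1) (G.ρ (p r).1).1)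
      (mfderiv IU 𝓘(ℝ, EM) (fun z ↦ toCoord IM x₀ (G.ν z) (G.ρ z).1) (p t).1 w) t :=
    hasDerivAt_comp_curve ((G.contMDiffAt_vel_coord hsrc).mdifferentiableAt (by simp)) hw
  have h4 : HasDerivAt (fun r ↦ lam * G.L (p r).1) (lam * dAt IU G.L (p t).1 w) t :=
    (hasDerivAt_comp_curve (G.contMDiff_L.mdifferentiableAt (by simp)) hw).const_mul lam
  have h5 := (h1.clm_apply h2).add h4
  -- The constraint `⟨α, 𝐓ρ⟩ + λL = 0` holds identically along the curve, so the derivative given by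
  -- the product rule is zero.
  have h6 := h5.congr_of_eventuallyEq (f₁ := fun _ ↦ 0) (by
    filter_upwards [(hν.continuousAt).preimage_mem_nhds
      ((chartAt HM x₀).open_source.mem_nhds hsrc)] with r hr
    have h7 := ofCoord_toCoord IM hr (G.ρ (p r).1).1
    have h8 := G.hCov_vel lam (p r).1 (p r).2
    rw [← h7] at h8
    exact h8.symm)
  have h9 := h6.unique (hasDerivAt_const t (0 : ℝ))
  have h10 : dAt IU (G.ham lam x₀ (G.hCov lam (p t).1 (p t).2)) (p t).1 w =
      G.hCov lam (p t).1 (p t).2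
        (mfderiv IU 𝓘(ℝ, EM) (fun z ↦ toCoord IM x₀ (G.ν z) (G.ρ z).1) (p t).1 w) +
      lam * dAt IU G.L (p t).1 w := by
    have hA : HasMFDerivAt IU 𝓘(ℝ, ℝ)
        (fun z ↦ (G.hCov lam (p t).1 (p t).2 : EM →L[ℝ] ℝ) (toCoord IM x₀ (G.ν z) (G.ρ z).1))
        (p t).1 _ :=
      hasMFDerivAt_clm_comp ((G.contMDiffAt_vel_coord hsrc).mdifferentiableAt (by simp)) _
    have hB : HasMFDerivAt IU 𝓘(ℝ, ℝ) (fun z ↦ lam * G.L z) (p t).1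
        (lam • dAt IU G.L (p t).1) := by
      exact (G.contMDiff_L.mdifferentiableAt (x := (p t).1) (by simp)).hasMFDerivAt.const_smul lam
    have := (hA.add hB).mfderiv
    exact congrArg (fun L : EU →L[ℝ] ℝ ↦ L w) this
  rw [h10, ← h9, ← add_assoc]
  congr 1
  congr 1
  · exact congrArg a' (toCoord_self IM _).symm
  · exact congrArg (G.hCov lam (p t).1 (p t).2) (ofCoord_self IM _).symm

end OptimalControlStructure

end Characteristic

/-! ### The contraction condition as an adjoint equation -/

section Characteristic

variable {EM HM EU HU EQ HQ EK HK : Type*}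
  [NormedAddCommGroup EM] [NormedSpace ℝ EM] [TopologicalSpace HM]
  [NormedAddCommGroup EU] [NormedSpace ℝ EU] [TopologicalSpace HU]
  [NormedAddCommGroup EQ] [NormedSpace ℝ EQ] [TopologicalSpace HQ]
  [NormedAddCommGroup EK] [NormedSpace ℝ EK] [TopologicalSpace HK]
  {IM : ModelWithCorners ℝ EM HM} {IU : ModelWithCorners ℝ EU HU}
  {IQ : ModelWithCorners ℝ EQ HQ} {IK : ModelWithCorners ℝ EK HK}
  {M U Q K : Type*}
  [TopologicalSpace M] [ChartedSpace HM M] [IsManifold IM ∞ M]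
  [TopologicalSpace U] [ChartedSpace HU U]
  [TopologicalSpace Q] [ChartedSpace HQ Q]
  [TopologicalSpace K] [ChartedSpace HK K]

namespace OptimalControlStructure

variable {G : OptimalControlStructure IM IU IQ IK M U Q K}

variable (G) in
/-- Every tangent vector of `U` is the velocity of a curve in `U ×_M V*τ`. -/
lemma exists_smoothPhase [IsManifold IU ∞ U] [IU.Boundaryless] (p₀ : G.Phase) (w : EU) :
    ∃ (q : ℝ → G.Phase) (r : ℝ), 0 < r ∧ G.SmoothPhaseOn q (Ioo (-r) r) ∧ q 0 = p₀ ∧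
      HasMFDerivAt 𝓘(ℝ, ℝ) IU (fun s ↦ (q s).1) 0
        ((1 : ℝ →L[ℝ] ℝ).smulRight (show TangentSpace IU (q 0).1 from w)) := by
  obtain ⟨u₀, η₀⟩ := p₀
  -- A straight line in a chart of `U`, with the covector kept constant in a chart of `M`; `O` keeps
  -- the projection of the line inside that chart.
  set y : ℝ → EU := fun s ↦ extChartAt IU u₀ u₀ + s • w with hy
  set O := coordDom IU (G.ν ⁻¹' (chartAt HM (G.ν u₀)).source) u₀ with hO
  have hOo : IsOpen O := isOpen_coordDom IU
    ((chartAt HM (G.ν u₀)).open_source.preimage G.bundle_ν.contMDiff.continuous) u₀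
  have hys : ContDiff ℝ ∞ y := by fun_prop
  have hy0 : y 0 = extChartAt IU u₀ u₀ := by simp [hy]
  have hyO : y 0 ∈ O := by
    rw [hy0]
    exact extChartAt_mem_coordDom IU (mem_chart_source HU u₀) (mem_chart_source HM (G.ν u₀))
  obtain ⟨r, hr, hball⟩ := Metric.mem_nhds_iff.1
    (hys.continuous.continuousAt.preimage_mem_nhds (hOo.mem_nhds hyO))
  rw [Real.ball_eq_Ioo, zero_sub, zero_add] at hball
  set c : ℝ → U := fun s ↦ (extChartAt IU u₀).symm (y s) with hc
  have hc0 : c 0 = u₀ := by rw [hc]; simp only [hy0]; exact extChartAt_to_inv (I := IU) u₀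
  set α₀ : EM →L[ℝ] ℝ := G.hCov 0 u₀ η₀ with hα₀
  have hcs : ContMDiffOn 𝓘(ℝ, ℝ) IU ∞ c (Ioo (-r) r) := by
    refine (contMDiffOn_extChartAt_symm (n := ∞) (I := IU) u₀).comp
      (hys.contMDiff.contMDiffOn) fun s hs ↦ (hball hs).1
  refine ⟨fun s ↦ ⟨c s, (α₀.comp (toCoord IM (G.ν u₀) (G.ν (c s)))).comp
    (Vert IM G.τ (G.ν (c s))).subtypeL⟩, r, hr, ⟨hcs, fun s ↦
      α₀.comp (toCoord IM (G.ν u₀) (G.ν (c s))), ?_, fun _ _ _ ↦ rfl⟩, ?_, ?_⟩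
  · intro s hs
    have hsrc : ∀ s ∈ Ioo (-r) r, G.ν (c s) ∈ (chartAt HM (G.ν u₀)).source :=
      fun s hs ↦ (hball hs).2
    rw [contMDiffWithinAt_cotangent_iff_of_mem IM (hsrc s hs)]
    refine ⟨(G.bundle_ν.contMDiff _).comp_contMDiffWithinAt s (hcs s hs), ?_⟩
    have h1 : ∀ s ∈ Ioo (-r) r, (α₀.comp (toCoord IM (G.ν u₀) (G.ν (c s)))).comp
        (ofCoord IM (G.ν u₀) (G.ν (c s))) = α₀ := by
      intro s hs
      ext z
      exact congrArg α₀ (toCoord_ofCoord IM (hsrc s hs) z)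
    exact contDiffWithinAt_const.congr h1 (h1 s hs)
  · have : ∀ u₁ : U, u₁ = u₀ → (⟨u₁, (α₀.comp (toCoord IM (G.ν u₀) (G.ν u₁))).comp
        (Vert IM G.τ (G.ν u₁)).subtypeL⟩ : G.Phase) = ⟨u₀, η₀⟩ := by
      rintro u₁ rfl
      congr 1
      ext v
      refine Eq.trans ?_ (G.hCov_apply_vert 0 u₁ η₀ v)
      exact congrArg α₀ (toCoord_self IM _)
    exact this _ hc0
  · have h1 : HasDerivWithinAt y w univ 0 := by
      have := ((hasDerivAt_id (0 : ℝ)).smul_const w).const_add (extChartAt IU u₀ u₀)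
      rw [one_smul] at this
      exact this.hasDerivWithinAt
    have h2 := hasMFDerivWithinAt_univ.1
      (hasMFDerivWithinAt_extChartAt_symm_comp IU (x₀ := u₀) hyO.1 h1)
    have h3 : ∀ u₁ : U, u₁ = u₀ → (ofCoord IU u₀ u₁ w : EU) = w := by
      rintro u₁ rfl
      exact ofCoord_self IU w
    refine HasMFDerivAt.congr_mfderiv h2 ?_
    exact congrArg (fun z : EU ↦ (1 : ℝ →L[ℝ] ℝ).smulRight z) (h3 _ hc0)

/-- As the projection of `p` to `M` has velocity `𝐓ρ`, the form is `a'(Tν w) - a₂(𝐓ρ)`, with `a₂`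
the covector part of the velocity of `q`. The constraint, differentiated along `q` in `hVel_eq`,
replaces `-a₂(𝐓ρ)` by `dH(w)`. -/
lemma sympl_hVel [IM.Boundaryless] (lam : ℝ) {p q : ℝ → G.Phase} {s s' : Set ℝ} {t : ℝ}
    (hs : s ∈ 𝓝 t) (hp : G.SmoothPhaseOn p s) (hs' : s' ∈ 𝓝 0) (hq : G.SmoothPhaseOn q s')
    (hqp : q 0 = p t)
    (hv : HasMFDerivAt 𝓘(ℝ, ℝ) IM (fun r ↦ G.ν (p r).1) t
      ((1 : ℝ →L[ℝ] ℝ).smulRight (G.ρ (p t).1).1))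
    {w : EU}
    (hw : HasMFDerivAt 𝓘(ℝ, ℝ) IU (fun r ↦ (q r).1) 0
      ((1 : ℝ →L[ℝ] ℝ).smulRight (show TangentSpace IU (q 0).1 from w))) {a' : EM →L[ℝ] ℝ}
    (ha' : HasDerivAt (fun r ↦ (G.hCov lam (p r).1 (p r).2).comp
        (ofCoord IM (G.ν (p t).1) (G.ν (p r).1))) a' t) :
    sympl IM (G.hMap lam (p t)) (G.hVel lam p t) (G.hVel lam q 0) =
      a' (mfderiv IU IM G.ν (p t).1 w) +
        dAt IU (G.ham lam (G.ν (p t).1) (G.hCov lam (p t).1 (p t).2)) (p t).1 w := by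
  have hu := (hp.1.contMDiffAt hs).mdifferentiableAt (by simp)
  have hu' : HasMFDerivAt 𝓘(ℝ, ℝ) IU (fun r ↦ (p r).1) t ((1 : ℝ →L[ℝ] ℝ).smulRight
      (mfderiv 𝓘(ℝ, ℝ) IU (fun r ↦ (p r).1) t (1 : ℝ) : TangentSpace IU (p t).1)) := by
    refine hu.hasMFDerivAt.congr_mfderiv ?_
    ext
    exact (one_smul ℝ _).symm
  obtain ⟨a₁, ha₁, hp₁, -⟩ := hVel_eq lam hs hp hu'
  obtain rfl := ha₁.unique ha'
  have hvel : (mfderiv IU IM G.ν (p t).1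
      (mfderiv 𝓘(ℝ, ℝ) IU (fun r ↦ (p r).1) t (1 : ℝ) : TangentSpace IU (p t).1) : EM) =
      (G.ρ (p t).1).1 := by
    have h1 := hasMFDerivAt_unique ((G.mdifferentiable_ν _).hasMFDerivAt.comp t hu') hv
    have h2 := congrArg (fun L : ℝ →L[ℝ] EM ↦ L 1) h1
    refine Eq.trans ?_ (h2.trans (one_smul ℝ _))
    exact congrArg (mfderiv IU IM G.ν (p t).1) (one_smul ℝ _).symm
  have key : ∀ p₀ : G.Phase, q 0 = p₀ → ∃ a₂ : EM →L[ℝ] ℝ,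
      (G.hVel lam q 0 : EM × (EM →L[ℝ] ℝ)) = (mfderiv IU IM G.ν p₀.1 w, a₂) ∧
      a₂ (G.ρ p₀.1).1 + dAt IU (G.ham lam (G.ν p₀.1) (G.hCov lam p₀.1 p₀.2)) p₀.1 w = 0 := by
    rintro _ rfl
    obtain ⟨a₂, -, h1, h2⟩ := hVel_eq lam hs' hq hw
    exact ⟨a₂, h1, h2⟩
  obtain ⟨a₂, hq₁, hq₂⟩ := key _ hqp
  have h1 : sympl IM (G.hMap lam (p t)) (G.hVel lam p t) (G.hVel lam q 0) =
      (G.hVel lam p t : EM × (EM →L[ℝ] ℝ)).2 (G.hVel lam q 0 : EM × (EM →L[ℝ] ℝ)).1 -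
      (G.hVel lam q 0 : EM × (EM →L[ℝ] ℝ)).2 (G.hVel lam p t : EM × (EM →L[ℝ] ℝ)).1 := rfl
  have h2 : (a₂ (mfderiv IU IM G.ν (p t).1
      (mfderiv 𝓘(ℝ, ℝ) IU (fun r ↦ (p r).1) t (1 : ℝ) : TangentSpace IU (p t).1)) : ℝ) =
      a₂ (G.ρ (p t).1).1 := congrArg a₂ hvel
  rw [h1, hp₁, hq₁]
  refine (congrArg (_ - ·) h2).trans ?_
  rw [sub_eq_add_neg]
  congr 1
  linarith

/-- The contraction condition is the adjoint equation. -/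
lemma contractionZero_iff [IM.Boundaryless] [IsManifold IU ∞ U] [IU.Boundaryless] (lam : ℝ)
    {u : ℝ → U} {η : ∀ t, CoVert IM G.τ (G.ν (u t))} {s : Set ℝ} {t : ℝ} (hs : s ∈ 𝓝 t)
    (hp : G.SmoothPhaseOn (fun t ↦ ⟨u t, η t⟩) s)
    (hv : HasMFDerivAt 𝓘(ℝ, ℝ) IM (fun r ↦ G.ν (u r)) t
      ((1 : ℝ →L[ℝ] ℝ).smulRight (G.ρ (u t)).1)) :
    G.ContractionZero lam (fun t ↦ ⟨u t, η t⟩) t ↔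
      G.AdjointAt lam u (fun r ↦ G.hCov lam (u r) (η r)) univ t := by
  constructor
  · intro h
    have hh := (contMDiffOn_hMap lam hp).contMDiffAt hs
    have hd := ((((contMDiffWithinAt_cotangent_iff IM).1
      (contMDiffWithinAt_univ.2 hh)).2.contDiffAt Filter.univ_mem).differentiableAt
        (by simp)).hasDerivAt
    refine ⟨_, hd.hasDerivWithinAt, fun w ↦ ?_⟩
    obtain ⟨q, r, hr, hq, hq0, hqw⟩ := exists_smoothPhase G ⟨u t, η t⟩ w
    rw [← h q r hr hq hq0]
    exact (sympl_hVel lam hs hp (Ioo_mem_nhds (neg_lt_zero.2 hr) hr) hq hq0 hv hqw hd).symm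
  · rintro ⟨a', ha', h⟩ q r hr hq hq0
    have hr' := Ioo_mem_nhds (neg_lt_zero.2 hr) hr
    have hqd := (hq.1.contMDiffAt hr').mdifferentiableAt (by simp)
    have hqw : HasMFDerivAt 𝓘(ℝ, ℝ) IU (fun r ↦ (q r).1) 0 ((1 : ℝ →L[ℝ] ℝ).smulRight
        (mfderiv 𝓘(ℝ, ℝ) IU (fun r ↦ (q r).1) 0 (1 : ℝ) : TangentSpace IU (q 0).1)) := by
      refine hqd.hasMFDerivAt.congr_mfderiv ?_
      ext
      exact (one_smul ℝ _).symm
    have := sympl_hVel lam hs hp hr' hq hq0 hv hqw (hasDerivWithinAt_univ.1 ha')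
    exact this.trans (h _)

end OptimalControlStructure

end Characteristic

/-! ### Piecewise arguments on a subdivided interval -/

section Subdivisions

variable {a b : ℝ} (S : Subdivision a b)

lemma Subdivision.exists_mem_Ioc {t : ℝ} (ht : t ∈ Ioc a b) :
    ∃ i : Fin S.len, t ∈ Ioc (S.pt i.castSucc) (S.pt i.succ) := by
  by_contra! h
  have h1 : ∀ j : Fin (S.len + 1), S.pt j < t := by
    intro j
    induction j using Fin.induction with
    | zero => exact S.first.le.trans_lt ht.1
    | succ i ih => exact lt_of_not_ge fun h' ↦ h i ⟨ih, h'⟩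
  exact absurd ht.2 (not_le.2 (S.last.symm.le.trans_lt (h1 _)))

lemma Subdivision.len_pos (hab : a < b) : 0 < S.len := by
  obtain ⟨i, -⟩ := S.exists_mem_Ioc ⟨hab, le_rfl⟩
  exact i.pos

lemma Subdivision.exists_mem_Icc (hab : a < b) {t : ℝ} (ht : t ∈ Icc a b) :
    ∃ i : Fin S.len, t ∈ Icc (S.pt i.castSucc) (S.pt i.succ) := by
  rcases ht.1.eq_or_lt with rfl | h
  · have hl := S.len_pos hab
    refine ⟨⟨0, hl⟩, ?_⟩
    have h0 : (⟨0, hl⟩ : Fin S.len).castSucc = 0 := rfl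
    have h1 := (S.pt_lt ⟨0, hl⟩).le
    rw [h0] at h1 ⊢
    exact ⟨S.first.le, S.first.symm.le.trans h1⟩
  · obtain ⟨i, hi⟩ := S.exists_mem_Ioc ⟨h, ht.2⟩
    exact ⟨i, Ioc_subset_Icc_self hi⟩

lemma Subdivision.Icc_subset (i : Fin S.len) : Icc (S.pt i.castSucc) (S.pt i.succ) ⊆ Icc a b :=
  Icc_subset_Icc (S.le_pt _) (S.pt_le _)

/-- Off a finite set, every instant lies in the interior of a piece. -/
lemma Subdivision.exists_mem_Ioo {t : ℝ} (ht : t ∈ Ioo a b \ range S.pt) :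
    ∃ i : Fin S.len, t ∈ Ioo (S.pt i.castSucc) (S.pt i.succ) := by
  obtain ⟨i, hi⟩ := S.exists_mem_Ioc (Ioo_subset_Ioc_self ht.1)
  exact ⟨i, hi.1, hi.2.lt_of_ne fun h ↦ ht.2 ⟨_, h.symm⟩⟩

/-- A finite cover by closed pieces: those that miss `t` have trivial trace near `t`, and those that
contain `t` are covered by the hypothesis. -/
lemma Subdivision.continuousOn_of_inter (hab : a < b) {X : Type*} [TopologicalSpace X] {g : ℝ → X}
    {s : Set ℝ} (hs : s ⊆ Icc a b)
    (h : ∀ i : Fin S.len, ContinuousOn g (s ∩ Icc (S.pt i.castSucc) (S.pt i.succ))) :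
    ContinuousOn g s := by
  intro t ht
  have h1 : s = ⋃ i : Fin S.len, s ∩ Icc (S.pt i.castSucc) (S.pt i.succ) := by
    ext r
    simp only [mem_iUnion, mem_inter_iff]
    refine ⟨fun hr ↦ ?_, fun ⟨_, hr, _⟩ ↦ hr⟩
    obtain ⟨i, hi⟩ := S.exists_mem_Icc hab (hs hr)
    exact ⟨i, hr, hi⟩
  rw [ContinuousWithinAt, h1, nhdsWithin_iUnion, Filter.tendsto_iSup]
  intro i
  by_cases hi : t ∈ Icc (S.pt i.castSucc) (S.pt i.succ)
  · exact h i t ⟨ht, hi⟩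
  · have : 𝓝[s ∩ Icc (S.pt i.castSucc) (S.pt i.succ)] t = ⊥ := by
      rw [← Filter.empty_mem_iff_bot]
      filter_upwards [self_mem_nhdsWithin,
        mem_nhdsWithin_of_mem_nhds (isClosed_Icc.isOpen_compl.mem_nhds hi)] with r hr hr'
      exact hr' hr.2
    rw [this]
    exact Filter.tendsto_bot

/-- The fundamental theorem of calculus off a countable set; continuity bridges the exceptional
instants. -/
lemma eq_right_of_hasDerivAt_zero {g : ℝ → ℝ} {F : Set ℝ} (hF : F.Countable)
    (hg : ContinuousOn g (Icc a b)) (hd : ∀ t ∈ Ioo a b \ F, HasDerivAt g 0 t) {t : ℝ}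
    (ht : t ∈ Icc a b) : g t = g b := by
  have h := MeasureTheory.integral_eq_of_hasDerivAt_off_countable_of_le g (fun _ ↦ 0) ht.2 hF
    (hg.mono (Icc_subset_Icc_left ht.1)) (fun r hr ↦ hd r ⟨⟨ht.1.trans_lt hr.1.1, hr.1.2⟩, hr.2⟩)
    intervalIntegrable_const
  rw [intervalIntegral.integral_zero] at h
  linarith

end Subdivisions

/-! ### Locality of the adjoint equation; local sections through a point -/

section Core


variable {EM HM EU HU EQ HQ EK HK : Type*}
  [NormedAddCommGroup EM] [NormedSpace ℝ EM] [TopologicalSpace HM]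
  [NormedAddCommGroup EU] [NormedSpace ℝ EU] [TopologicalSpace HU]
  [NormedAddCommGroup EQ] [NormedSpace ℝ EQ] [TopologicalSpace HQ]
  [NormedAddCommGroup EK] [NormedSpace ℝ EK] [TopologicalSpace HK]
  {IM : ModelWithCorners ℝ EM HM} {IU : ModelWithCorners ℝ EU HU}
  {IQ : ModelWithCorners ℝ EQ HQ} {IK : ModelWithCorners ℝ EK HK}
  {M U Q K : Type*}
  [TopologicalSpace M] [ChartedSpace HM M] [IsManifold IM ∞ M]
  [TopologicalSpace U] [ChartedSpace HU U]
  [TopologicalSpace Q] [ChartedSpace HQ Q]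
  [TopologicalSpace K] [ChartedSpace HK K]

namespace OptimalControlStructure

lemma AdjointAt.mono {G : OptimalControlStructure IM IU IQ IK M U Q K} {lam : ℝ} {u : ℝ → U}
    {α : ∀ t, TangentSpace IM (G.ν (u t)) →L[ℝ] ℝ} {s s' : Set ℝ} {t : ℝ}
    (h : G.AdjointAt lam u α s t) (hs : s' ⊆ s) : G.AdjointAt lam u α s' t := by
  obtain ⟨α', h1, h2⟩ := h
  exact ⟨α', h1.mono hs, h2⟩

lemma AdjointAt.congr {G : OptimalControlStructure IM IU IQ IK M U Q K} {lam : ℝ} {u : ℝ → U}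
    {α β : ∀ t, TangentSpace IM (G.ν (u t)) →L[ℝ] ℝ} {s : Set ℝ} {t : ℝ}
    (h : G.AdjointAt lam u α s t) (hβ : ∀ᶠ r in 𝓝[s] t, β r = α r) (ht : β t = α t) :
    G.AdjointAt lam u β s t := by
  obtain ⟨α', h1, h2⟩ := h
  refine ⟨α', h1.congr_of_eventuallyEq ?_ ?_, ?_⟩
  · filter_upwards [hβ] with r hr
    rw [hr]
  · rw [ht]
  · rw [ht]
    exact h2

end OptimalControlStructure

namespace ControlStructure

variable (G : ControlStructure IM IU IQ IK M U Q K)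

/-- Every point of `U` lies on a local section. -/
lemma exists_localSection (u₀ : U) :
    ∃ Y : G.LocalSection, G.ν u₀ ∈ Y.dom ∧ Y.σ (G.ν u₀) = u₀ := by
  obtain ⟨W, hW, hmem, φ, ψ, hφ, hψ, h₁, h₂⟩ := G.bundle_ν.locallyTrivial (G.ν u₀)
  refine ⟨⟨W, hW, fun m ↦ ψ (m, φ u₀), ?_, fun m hm ↦ (h₂ m hm _).1⟩, hmem, h₁ u₀ hmem⟩
  exact hψ.comp (contMDiff_id.prodMk contMDiff_const).contMDiffOn fun m hm ↦ ⟨hm, mem_univ _⟩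

end ControlStructure
end Core

/-! ### From a covector on the cone to the adjoint equation and the maximum condition -/

section Core


variable {EM HM EU HU EQ HQ EK HK : Type*}
  [NormedAddCommGroup EM] [NormedSpace ℝ EM] [TopologicalSpace HM]
  [NormedAddCommGroup EU] [NormedSpace ℝ EU] [TopologicalSpace HU]
  [NormedAddCommGroup EQ] [NormedSpace ℝ EQ] [TopologicalSpace HQ]
  [NormedAddCommGroup EK] [NormedSpace ℝ EK] [TopologicalSpace HK]
  {IM : ModelWithCorners ℝ EM HM} {IU : ModelWithCorners ℝ EU HU}
  {IQ : ModelWithCorners ℝ EQ HQ} {IK : ModelWithCorners ℝ EK HK}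
  {M U Q K : Type*}
  [TopologicalSpace M] [ChartedSpace HM M] [IsManifold IM ∞ M]
  [TopologicalSpace U] [ChartedSpace HU U]
  [TopologicalSpace Q] [ChartedSpace HQ Q]
  [TopologicalSpace K] [ChartedSpace HK K]

namespace ControlStructure.FlowData

variable [IM.Boundaryless] [FiniteDimensional ℝ EM] [T2Space M]
  {G : OptimalControlStructure IM IU IQ IK M U Q K} {a b : ℝ} {u : ℝ → U}
  (P : G.FlowData a b u)

include P in
-- In a chart the base curve is the restriction of a smooth solution defined on both sides of the
-- instant, hence it is smooth up to the ends of a piece. For transported covectors the next lemma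
-- uses `Z` in the same way.
lemma contMDiffOn_base (i : Fin P.len) :
    ContMDiffOn 𝓘(ℝ, ℝ) IM ∞ (fun t ↦ G.ν (u t)) (Icc (P.pt i.castSucc) (P.pt i.succ)) := by
  intro t₀ ht₀
  obtain ⟨ε, x, Z, V, h, -⟩ := P.exists_transport_eq i ht₀
  have hε := h.pos
  have ht₀J : t₀ ∈ Ioo (t₀ - ε) (t₀ + ε) := ⟨by linarith, by linarith⟩
  have h1 : ContMDiffAt 𝓘(ℝ, ℝ) IM ∞ (fun t ↦ (extChartAt IM (G.ν (u t₀))).symm (x t)) t₀ :=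
    ((contMDiffOn_extChartAt_symm (n := ∞) (I := IM) (G.ν (u t₀))).contMDiffAt
      ((isOpen_extChartAt_target _).mem_nhds (h.mem t₀ ht₀J).1)).comp t₀
      (h.contDiffOn_x.contDiffAt (isOpen_Ioo.mem_nhds ht₀J)).contMDiffAt
  refine h1.contMDiffWithinAt.congr_of_eventuallyEq ?_ (h.eq_symm t₀ ⟨ht₀, ht₀J⟩)
  filter_upwards [self_mem_nhdsWithin,
    mem_nhdsWithin_of_mem_nhds (Ioo_mem_nhds ht₀J.1 ht₀J.2)] with t h1 h2
  exact h.eq_symm t ⟨h1, h2⟩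

lemma contMDiffOn_comp_transport (i : Fin P.len) (κ : TangentSpace IM (G.ν (u b)) →L[ℝ] ℝ) :
    ContMDiffOn 𝓘(ℝ, ℝ) (IM.prod 𝓘(ℝ, EM →L[ℝ] ℝ)) ∞
      (fun t ↦ (⟨G.ν (u t), κ.comp (P.transport t)⟩ : Cotangent IM M))
      (Icc (P.pt i.castSucc) (P.pt i.succ)) := by
  intro t₀ ht₀
  rw [contMDiffWithinAt_cotangent_iff]
  refine ⟨P.contMDiffOn_base i t₀ ht₀, ?_⟩
  obtain ⟨ε, x, Z, V, h, B, -, hB⟩ := P.exists_transport_eq i ht₀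
  have hε := h.pos
  have ht₀J : t₀ ∈ Ioo (t₀ - ε) (t₀ + ε) := ⟨by linarith, by linarith⟩
  have hcoord : ∀ t ∈ Icc (P.pt i.castSucc) (P.pt i.succ) ∩ Ioo (t₀ - ε) (t₀ + ε),
      (κ.comp (P.transport t)).comp (ofCoord IM (G.ν (u t₀)) (G.ν (u t))) =
        (κ.comp B).comp (Z t) := by
    intro t ht
    rw [hB t ht]
    ext z
    have := toCoord_ofCoord IM (h.mem_source ht).1 z
    exact congrArg (fun y ↦ κ (B (Z t y))) this
  have h1 : ContDiffAt ℝ ∞ (fun t ↦ (κ.comp B : EM →L[ℝ] ℝ).comp (Z t)) t₀ :=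
    contDiffAt_const.clm_comp (h.contDiffOn_Z.contDiffAt (isOpen_Ioo.mem_nhds ht₀J))
  refine h1.contDiffWithinAt.congr_of_eventuallyEq ?_ (hcoord t₀ ⟨ht₀, ht₀J⟩)
  filter_upwards [self_mem_nhdsWithin,
    mem_nhdsWithin_of_mem_nhds (Ioo_mem_nhds ht₀J.1 ht₀J.2)] with t h1 h2
  exact hcoord t ⟨h1, h2⟩

/-- The vector fields of a composite flow are invariant under their own flows. -/
lemma transport_field_eq (i : Fin P.len) {t : ℝ}
    (ht : t ∈ Icc (P.pt i.castSucc) (P.pt i.succ)) :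
    P.transport t (G.field (P.sec i) (G.ν (u t))) =
      P.transport (P.pt i.castSucc)
        (G.field (P.sec i) (G.ν (u (P.pt i.castSucc)))) := by
  let f : ℝ → EM := fun t ↦ P.transport t (G.field (P.sec i) (G.ν (u t)))
  have hder : ∀ t₀ ∈ Icc (P.pt i.castSucc) (P.pt i.succ),
      HasDerivWithinAt f 0 (Icc (P.pt i.castSucc) (P.pt i.succ)) t₀ := by
    intro t₀ ht₀
    obtain ⟨ε, x, Z, V, h, B, -, hB⟩ := P.exists_transport_eq i ht₀
    have hε := h.pos
    have ht₀J : t₀ ∈ Ioo (t₀ - ε) (t₀ + ε) := ⟨by linarith, by linarith⟩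
    set F := coordField IM (G.field (P.sec i)) (G.ν (u t₀)) with hF
    let B' : EM →L[ℝ] EM := B
    have heq : ∀ t ∈ Icc (P.pt i.castSucc) (P.pt i.succ) ∩ Ioo (t₀ - ε) (t₀ + ε),
        f t = B' (Z t (F (x t))) := by
      intro t ht
      change P.transport t (G.field (P.sec i) (G.ν (u t))) = _
      rw [hB t ht, (h.mem_source ht).2, hF]
      exact congrArg (fun y ↦ B (Z t y)) (coordField_extChartAt IM _ (h.mem_source ht).1).symm
    have hFd : DifferentiableAt ℝ F (x t₀) :=
      ((contDiffOn_coordField IM (contMDiffOn_field _) _).contDiffAt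
        ((isOpen_coordDom IM (P.sec i).isOpen_dom _).mem_nhds (h.mem t₀ ht₀J))).differentiableAt
        (by simp)
    have h1 := hFd.hasFDerivAt.comp_hasDerivAt t₀ (h.deriv_x t₀ ht₀J)
    have h2 := B'.hasFDerivAt.comp_hasDerivAt t₀
      ((h.deriv_Z t₀ ht₀J).clm_apply h1)
    -- The adjoint equation for `Z` contributes `-DF(F)` and the chain rule for `F ∘ x` contributes
    -- `DF(F)`.
    have h3 : HasDerivAt (fun t ↦ B' (Z t (F (x t)))) 0 t₀ := by
      refine h2.congr_deriv ?_
      refine (congrArg B' ?_).trans (map_zero B')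
      rw [h.Z_base]
      simp [hF]
    refine h3.hasDerivWithinAt.congr_of_eventuallyEq ?_ (heq t₀ ⟨ht₀, ht₀J⟩)
    filter_upwards [self_mem_nhdsWithin,
      mem_nhdsWithin_of_mem_nhds (Ioo_mem_nhds ht₀J.1 ht₀J.2)] with t h1 h2
    exact heq t ⟨h1, h2⟩
  refine constant_of_derivWithin_zero (f := f) (fun t ht ↦ (hder t ht).differentiableWithinAt)
    (fun t ht ↦ (hder t (Ico_subset_Icc_self ht)).derivWithin ?_) t ht
  exact uniqueDiffOn_Icc (P.pt_lt i) t (Ico_subset_Icc_self ht)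

/-- The covector along the base curve obtained by pulling back `κ` under the composite flow,
restricted to vertical vectors. -/
def pull (κ : TangentSpace IM (G.ν (u b)) →L[ℝ] ℝ) (t : ℝ) : CoVert IM G.τ (G.ν (u t)) :=
  (κ.comp (P.transport t)).comp (Vert IM G.τ (G.ν (u t))).subtypeL

/-- Since transport preserves `dτ`, the correction that normalizes a pulled-back covector is itself
a pull-back from `n`, with a coefficient that may depend on `t`. -/
lemma hCov_pull (κ : TangentSpace IM (G.ν (u b)) →L[ℝ] ℝ) {t : ℝ} (ht : t ∈ Icc a b) :
    G.hCov 0 (u t) (P.pull κ t) =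
      (κ - κ (P.transport t (G.ρ (u t)).1) • dAt IM G.τ (G.ν (u b))).comp (P.transport t) := by
  rw [G.hCov_eq 0 _ _ (κ.comp (P.transport t)) (fun v ↦ rfl)]
  ext v
  have := P.dAt_transport ht v
  change κ (P.transport t v) - (κ (P.transport t (G.ρ (u t)).1) + 0 * G.L (u t)) *
    dAt IM G.τ (G.ν (u t)) v = κ (P.transport t v) - κ (P.transport t (G.ρ (u t)).1) *
      dAt IM G.τ (G.ν (u b)) (P.transport t v)
  rw [this, zero_mul, add_zero]

/-- On one piece the coefficient in `hCov_pull` is constant by `transport_field_eq`, so the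
normalized curve is the pull-back of a single covector. The maximum condition survives the
correction because `dτ` equals 1 on all velocities compared. -/
lemma adjointAt_hCov_pull [IK.Boundaryless] (i : Fin P.len) {t₀ : ℝ}
    (ht₀ : t₀ ∈ Ioc (P.pt i.castSucc) (P.pt i.succ))
    (κ : TangentSpace IM (G.ν (u b)) →L[ℝ] ℝ)
    (hmax : ∀ u', G.ν u' = G.ν (u t₀) → κ (P.transport t₀ (G.vel (G.ν (u t₀)) u')) ≤
      κ (P.transport t₀ (G.vel (G.ν (u t₀)) (u t₀)))) :
    G.AdjointAt 0 u (fun t ↦ G.hCov 0 (u t) (P.pull κ t))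
      (Icc (P.pt i.castSucc) (P.pt i.succ)) t₀ := by
  set ξ : TangentSpace IM (G.ν (u b)) := P.transport t₀ (G.ρ (u t₀)).1 with hξ
  have hξt : ∀ t ∈ Ioc (P.pt i.castSucc) (P.pt i.succ),
      P.transport t (G.ρ (u t)).1 = ξ := by
    have h1 : ∀ t ∈ Ioc (P.pt i.castSucc) (P.pt i.succ), (G.ρ (u t)).1 =
        G.field (P.sec i) (G.ν (u t)) := by
      intro t ht
      exact congrArg (fun z ↦ G.vel (G.ν (u t)) z) (P.control i t ht)
    intro t ht
    rw [hξ, h1 t ht, h1 t₀ ht₀, P.transport_field_eq i (Ioc_subset_Icc_self ht),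
      P.transport_field_eq i (Ioc_subset_Icc_self ht₀)]
  have hα : ∀ t ∈ Ioc (P.pt i.castSucc) (P.pt i.succ), G.hCov 0 (u t) (P.pull κ t) =
      (κ - κ ξ • dAt IM G.τ (G.ν (u b))).comp (P.transport t) := by
    intro t ht
    rw [P.hCov_pull κ (P.Icc_subset i (Ioc_subset_Icc_self ht)), hξt t ht]
  refine OptimalControlStructure.AdjointAt.congr (P.adjointAt_comp_transport i ht₀
    (κ - κ ξ • dAt IM G.τ (G.ν (u b))) fun u' hu' ↦ ?_) ?_ (hα t₀ ht₀)
  · have hI := P.Icc_subset i (Ioc_subset_Icc_self ht₀)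
    have h1 : dAt IM G.τ (G.ν (u b)) (P.transport t₀ (G.vel (G.ν (u t₀)) u')) = 1 :=
      (P.dAt_transport hI _).trans (dAt_vel hu')
    have h2 : dAt IM G.τ (G.ν (u b)) (P.transport t₀ (G.vel (G.ν (u t₀)) (u t₀))) = 1 :=
      (P.dAt_transport hI _).trans (dAt_vel rfl)
    have h3 := hmax u' hu'
    change κ _ - κ ξ * dAt IM G.τ (G.ν (u b)) _ ≤ κ _ - κ ξ * dAt IM G.τ (G.ν (u b)) _
    rw [h1, h2]
    linarith
  · have : Ioc (P.pt i.castSucc) (P.pt i.succ) ∈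
        𝓝[Icc (P.pt i.castSucc) (P.pt i.succ)] t₀ := by
      filter_upwards [self_mem_nhdsWithin, mem_nhdsWithin_of_mem_nhds (Ioi_mem_nhds ht₀.1)]
        with r hr hr'
      exact ⟨hr', hr.2⟩
    filter_upwards [this] with r hr using hα r hr

/-- A covector that is nonpositive on the vertical cone satisfies the maximum condition, when pulled
back under the composite flow. -/
lemma max_of_cone {κ : TangentSpace IM (G.ν (u b)) →L[ℝ] ℝ}
    (hκ : ∀ w ∈ P.verticalCone, κ w ≤ 0) {t : ℝ} (ht : t ∈ Ioc a b) {u' : U}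
    (hu' : G.ν u' = G.ν (u t)) :
    κ (P.transport t (G.vel (G.ν (u t)) u')) ≤
      κ (P.transport t (G.vel (G.ν (u t)) (u t))) := by
  obtain ⟨Y, hY, hYu⟩ := G.exists_localSection u'
  rw [hu'] at hY hYu
  set w : TangentSpace IM (G.ν (u b)) :=
    P.transport t (G.vel (G.ν (u t)) u' - G.vel (G.ν (u t)) (u t)) with hw
  have hwv : dAt IM G.τ (G.ν (u b)) w = 0 := by
    rw [hw, P.dAt_transport (Ioc_subset_Icc_self ht), map_sub, dAt_vel hu', dAt_vel rfl, sub_self]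
  -- A sum with one term and coefficient 1, for a section through `u'`.
  have h1 := hκ ⟨w, hwv⟩ ⟨1, fun _ ↦ 1, fun _ ↦ t, fun _ ↦ Y, fun _ ↦ zero_le_one, fun _ ↦ ht,
    fun _ ↦ hY, by simp [hw, field, hYu]⟩
  have h2 : κ w ≤ 0 := h1
  rw [hw, map_sub, map_sub] at h2
  linarith

/-- The maximum condition at the initial instant, by continuity. -/
lemma max_of_cone_left [T2Space U] (hab : a < b) (hua : ContinuousWithinAt u (Icc a b) a)
    {κ : TangentSpace IM (G.ν (u b)) →L[ℝ] ℝ}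
    (hκ : ∀ w ∈ P.verticalCone, κ w ≤ 0) {t : ℝ} (ht : t ∈ Icc a b) {u' : U}
    (hu' : G.ν u' = G.ν (u t)) :
    κ (P.transport t (G.vel (G.ν (u t)) u')) ≤
      κ (P.transport t (G.vel (G.ν (u t)) (u t))) := by
  rcases ht.1.lt_or_eq with h | rfl
  · exact P.max_of_cone hκ ⟨h, ht.2⟩ hu'
  have hl := P.len_pos hab
  set i : Fin P.len := ⟨0, hl⟩ with hi
  have hi0 : P.pt i.castSucc = a := P.first
  have hlt := P.pt_lt i
  rw [hi0] at hlt
  have hai : a ∈ Icc (P.pt i.castSucc) (P.pt i.succ) := ⟨hi0.le, hlt.le⟩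
  obtain ⟨ε, x, Z, V, hL, B, -, hB⟩ := P.exists_transport_eq i hai
  have hε := hL.pos
  have haJ : a ∈ Ioo (a - ε) (a + ε) := ⟨by linarith, by linarith⟩
  -- The cone only involves instants `t > a`. A section through `u'` provides competitors over
  -- `c(t)` for `t` near `a`, and the inequalities for them pass to the limit.
  obtain ⟨Y, hY, hYu⟩ := G.exists_localSection u'
  rw [hu'] at hY hYu
  have hsub : Ioi a ∩ Iio (min (P.pt i.succ) (a + ε)) ⊆
      Icc (P.pt i.castSucc) (P.pt i.succ) ∩ Ioo (a - ε) (a + ε) := fun t ht ↦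
    ⟨⟨hi0.le.trans (le_of_lt ht.1), (lt_min_iff.1 ht.2).1.le⟩, haJ.1.trans ht.1,
      (lt_min_iff.1 ht.2).2⟩
  have hc : ContinuousWithinAt (fun t ↦ G.ν (u t)) (Icc a b) a :=
    G.bundle_ν.contMDiff.continuous.continuousAt.comp_continuousWithinAt hua
  have hmem : Ioc a b ⊆ Icc a b := Ioc_subset_Icc_self
  have hvel : ∀ {z : ℝ → U}, ContinuousWithinAt z (Ioc a b) a →
      (G.ν (z a) = G.ν (u a)) →
      ContinuousWithinAt (fun t ↦ (κ.comp B : EM →L[ℝ] ℝ) (Z t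
        (toCoord IM (G.ν (u a)) (G.ν (z t)) (G.ρ (z t)).1))) (Ioc a b) a := by
    intro z hz hza
    have h1 : ContinuousAt (fun z ↦ toCoord IM (G.ν (u a)) (G.ν z) (G.ρ z).1) (z a) :=
      (G.contMDiffAt_vel_coord (by rw [hza]; exact mem_chart_source HM _)).continuousAt
    have h2 : ContinuousAt Z a := (hL.contDiffOn_Z.contDiffAt (isOpen_Ioo.mem_nhds haJ)).continuousAt
    exact (κ.comp B : EM →L[ℝ] ℝ).continuous.continuousAt.comp_continuousWithinAt
      (h2.continuousWithinAt.clm_apply (h1.comp_continuousWithinAt hz))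
  have hYc : ContinuousWithinAt (fun t ↦ Y.σ (G.ν (u t))) (Ioc a b) a :=
    (Y.contMDiffOn.contMDiffAt (Y.isOpen_dom.mem_nhds hY)).continuousAt.comp_continuousWithinAt
      (f := fun t ↦ G.ν (u t)) (hc.mono hmem)
  have : (𝓝[Ioc a b] a).NeBot := by
    rw [nhdsWithin_Ioc_eq_nhdsGT hab]
    infer_instance
  have key := le_of_tendsto_of_tendsto (hvel hYc (by simp only [hYu, hu'])) (hvel (hua.mono hmem) rfl) (by
    have h1 : ∀ᶠ t in 𝓝[Ioc a b] a, G.ν (u t) ∈ Y.dom :=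
      (hc.mono hmem).preimage_mem_nhdsWithin (Y.isOpen_dom.mem_nhds hY)
    filter_upwards [self_mem_nhdsWithin, h1, mem_nhdsWithin_of_mem_nhds
      (Iio_mem_nhds (lt_min hlt haJ.2))] with t ht htY ht'
    have htI := hsub ⟨ht.1, ht'⟩
    have h2 := P.max_of_cone hκ ht (Y.ν_σ _ htY)
    rw [hB t htI] at h2
    refine Eq.trans_le ?_ h2
    exact congrArg (fun y ↦ κ (B (Z t y))) (toCoord_congr IM (Y.ν_σ _ htY) _))
  rw [hB a ⟨hai, haJ⟩]
  refine Eq.trans_le ?_ key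
  have h1 : ∀ z : U, z = u' → κ (B (Z a (toCoord IM (G.ν (u a)) (G.ν (u a)) (G.vel (G.ν (u a)) u')))) =
      (κ.comp B : EM →L[ℝ] ℝ) (Z a (toCoord IM (G.ν (u a)) (G.ν z) (G.ρ z).1)) := by
    rintro z rfl
    exact congrArg (fun y ↦ κ (B (Z a y))) (toCoord_congr IM hu'.symm _)
  exact h1 _ hYu

/-- Transport is bijective and preserves verticality, so `v` comes from a vertical vector at `c(t)`.
-/
lemma pull_ne_zero {κ : TangentSpace IM (G.ν (u b)) →L[ℝ] ℝ} {v : Vert IM G.τ (G.ν (u b))}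
    (hv : κ v ≠ 0) {t : ℝ} (ht : t ∈ Icc a b) : P.pull κ t ≠ 0 := by
  intro h
  obtain ⟨y, hy⟩ := (P.transport_bijective ht).2 v
  have hyv : dAt IM G.τ (G.ν (u t)) y = 0 := by
    rw [← P.dAt_transport ht, hy]
    exact v.2
  have h1 := congrArg (fun L : CoVert IM G.τ (G.ν (u t)) ↦ L ⟨y, hyv⟩) h
  have h2 : κ (P.transport t y) = 0 := h1
  rw [hy] at h2
  exact hv h2

omit [IM.Boundaryless] [FiniteDimensional ℝ EM] [T2Space M] in
lemma pull_last (κ : TangentSpace IM (G.ν (u b)) →L[ℝ] ℝ) (v : Vert IM G.τ (G.ν (u b))) :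
    P.pull κ b v = κ v := congrArg κ (P.transport_last v)

end ControlStructure.FlowData
end Core

/-! ### From a multiplier to a covector on the cone -/

section Core


variable {EM HM EU HU EQ HQ EK HK : Type*}
  [NormedAddCommGroup EM] [NormedSpace ℝ EM] [TopologicalSpace HM]
  [NormedAddCommGroup EU] [NormedSpace ℝ EU] [TopologicalSpace HU]
  [NormedAddCommGroup EQ] [NormedSpace ℝ EQ] [TopologicalSpace HQ]
  [NormedAddCommGroup EK] [NormedSpace ℝ EK] [TopologicalSpace HK]
  {IM : ModelWithCorners ℝ EM HM} {IU : ModelWithCorners ℝ EU HU}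
  {IQ : ModelWithCorners ℝ EQ HQ} {IK : ModelWithCorners ℝ EK HK}
  {M U Q K : Type*}
  [TopologicalSpace M] [ChartedSpace HM M] [IsManifold IM ∞ M]
  [TopologicalSpace U] [ChartedSpace HU U]
  [TopologicalSpace Q] [ChartedSpace HQ Q]
  [TopologicalSpace K] [ChartedSpace HK K]

namespace ControlStructure.FlowData

variable [IM.Boundaryless] [FiniteDimensional ℝ EM] [T2Space M]
  {G : OptimalControlStructure IM IU IQ IK M U Q K} {a b : ℝ} {u : ℝ → U}
  (P : G.FlowData a b u)

/-- Pairing a continuous curve of covectors with a transported vector is continuous. -/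
lemma continuousOn_pairing (i : Fin P.len) {A : ∀ t : ℝ, TangentSpace IM (G.ν (u t)) →L[ℝ] ℝ}
    {s : Set ℝ}
    (hA : ContMDiffOn 𝓘(ℝ, ℝ) (IM.prod 𝓘(ℝ, EM →L[ℝ] ℝ)) ∞
      (fun t ↦ (⟨G.ν (u t), A t⟩ : Cotangent IM M)) s)
    {w : TangentSpace IM (G.ν (u b))} {y : ∀ t, TangentSpace IM (G.ν (u t))}
    (hy : ∀ t ∈ Icc (P.pt i.castSucc) (P.pt i.succ), P.transport t (y t) = w) :
    ContinuousOn (fun t ↦ A t (y t)) (s ∩ Icc (P.pt i.castSucc) (P.pt i.succ)) := by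
  intro t₀ ht₀
  obtain ⟨ε, x, Z, V, h, B, hBb, hB⟩ := P.exists_transport_eq i ht₀.2
  have hε := h.pos
  have ht₀J : t₀ ∈ Ioo (t₀ - ε) (t₀ + ε) := ⟨by linarith, by linarith⟩
  obtain ⟨z, rfl⟩ := hBb.2 w
  have hyV : ∀ t ∈ Icc (P.pt i.castSucc) (P.pt i.succ) ∩ Ioo (t₀ - ε) (t₀ + ε),
      y t = ofCoord IM (G.ν (u t₀)) (G.ν (u t)) (V t z) := by
    intro t ht
    have h1 := hy t ht.1
    rw [hB t ht] at h1
    have h2 : Z t (toCoord IM (G.ν (u t₀)) (G.ν (u t)) (y t)) = z := hBb.1 h1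
    have h3 := congrArg (fun A : EM →L[ℝ] EM ↦ A (toCoord IM (G.ν (u t₀)) (G.ν (u t)) (y t)))
      (h.VZ t ht.2)
    have h4 : V t z = toCoord IM (G.ν (u t₀)) (G.ν (u t)) (y t) := by
      rw [← h2]; exact h3
    rw [h4, ofCoord_toCoord IM (h.mem_source ht).1]
  have h1 := ((contMDiffWithinAt_cotangent_iff IM).1 (hA t₀ ht₀.1)).2.continuousWithinAt
  have h2 : ContinuousAt (fun t ↦ V t z) t₀ :=
    (h.deriv_V t₀ ht₀J).continuousAt.clm_apply continuousAt_const
  have h3 := (h1.mono (inter_subset_left (t := Icc (P.pt i.castSucc) (P.pt i.succ)))).clm_apply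
    h2.continuousWithinAt
  refine h3.congr_of_eventuallyEq ?_ (congrArg (A t₀) (hyV t₀ ⟨ht₀.2, ht₀J⟩))
  filter_upwards [self_mem_nhdsWithin,
    mem_nhdsWithin_of_mem_nhds (Ioo_mem_nhds ht₀J.1 ht₀J.2)] with t h1 h2
  exact congrArg (A t) (hyV t ⟨h1.2, h2⟩)

/-- A solution of the adjoint equation is the pull-back of its final value. -/
lemma eq_apply_transport (hab : a < b) {η : ∀ t, CoVert IM G.τ (G.ν (u t))} (S : Subdivision a b)
    (hS : ∀ (i : Fin S.len) (j : Fin P.len), SmoothCovOn IM G.τ (fun t ↦ G.ν (u t)) η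
      (Icc (S.pt i.castSucc) (S.pt i.succ) ∩ Icc (P.pt j.castSucc) (P.pt j.succ))) {F : Set ℝ} (hF : F.Countable)
    (hadj : ∀ t ∈ Ioo a b \ F, G.AdjointAt 0 u (fun t ↦ G.hCov 0 (u t) (η t)) univ t)
    {t : ℝ} (ht : t ∈ Icc a b) (v : Vert IM G.τ (G.ν (u t))) (w : Vert IM G.τ (G.ν (u b)))
    (hw : P.transport t v = w) : η t v = η b w := by
  -- `y t` is the vector at `c(t)` that is carried to `w`; its pairing with `η t` will be constant.
  -- Outside `[a, b]` the value 0 is a filler.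
  have hex : ∀ t, ∃ y : TangentSpace IM (G.ν (u t)), t ∈ Icc a b → P.transport t y = w := by
    intro t
    by_cases ht : t ∈ Icc a b
    · obtain ⟨y, hy⟩ := (P.transport_bijective ht).2 w
      exact ⟨y, fun _ ↦ hy⟩
    · exact ⟨0, fun h ↦ absurd h ht⟩
  choose y hy using hex
  have hyv : ∀ t ∈ Icc a b, dAt IM G.τ (G.ν (u t)) (y t) = 0 := by
    intro t ht
    rw [← P.dAt_transport ht, hy t ht]
    exact w.2
  set g : ℝ → ℝ := fun t ↦ G.hCov 0 (u t) (η t) (y t) with hg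
  have hgη : ∀ t (ht : t ∈ Icc a b), g t = η t ⟨y t, hyv t ht⟩ := fun t ht ↦
    G.hCov_apply_vert 0 (u t) (η t) ⟨y t, hyv t ht⟩
  -- `η` is controlled on the pieces of `S` and `y` on those of `P`, so continuity is checked on
  -- their intersections.
  have hgc : ContinuousOn g (Icc a b) := by
    refine S.continuousOn_of_inter hab subset_rfl fun i ↦ ?_
    refine P.continuousOn_of_inter hab inter_subset_left fun j ↦ ?_
    obtain ⟨A, hA, hAη⟩ := hS i j
    refine ((P.continuousOn_pairing j hA (y := y) (w := w)
      (fun t ht ↦ hy t (P.Icc_subset j ht))).mono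
      fun t ht ↦ ⟨⟨ht.1.2, ht.2⟩, ht.2⟩).congr fun t ht ↦ ?_
    rw [hgη t ht.1.1]
    exact (hAη t ⟨ht.1.2, ht.2⟩ ⟨y t, hyv t ht.1.1⟩).symm
  have hgd : ∀ t ∈ Ioo a b \ (F ∪ range P.pt), HasDerivAt g 0 t := by
    intro t ht
    obtain ⟨i, hi⟩ := P.exists_mem_Ioo ⟨ht.1, fun h ↦ ht.2 (Or.inr h)⟩
    exact (P.hasDerivWithinAt_pairing i (Ioo_subset_Ioc_self hi)
      ((hadj t ⟨ht.1, fun h ↦ ht.2 (Or.inl h)⟩).mono (subset_univ _)) (y := y) (w := w)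
      (fun t ht ↦ hy t (P.Icc_subset i ht))).hasDerivAt (Icc_mem_nhds hi.1 hi.2)
  have h1 := eq_right_of_hasDerivAt_zero (hF.union (finite_range P.pt).countable) hgc hgd ht
  have hb : b ∈ Icc a b := ⟨hab.le, le_rfl⟩
  rw [hgη t ht, hgη b hb] at h1
  have e1 : (⟨y t, hyv t ht⟩ : Vert IM G.τ (G.ν (u t))) = v :=
    Subtype.ext ((P.transport_bijective ht).1 ((hy t ht).trans hw.symm))
  have e2 : (⟨y b, hyv b hb⟩ : Vert IM G.τ (G.ν (u b))) = w :=
    Subtype.ext ((P.transport_last _).symm.trans (hy b hb))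
  rwa [e1, e2] at h1

/-- The final value of a solution of the adjoint equation that satisfies the maximum condition is
nonpositive on the vertical cone. -/
lemma le_zero_of_mem_verticalCone (hab : a < b) {η : ∀ t, CoVert IM G.τ (G.ν (u t))}
    (S : Subdivision a b)
    (hS : ∀ (i : Fin S.len) (j : Fin P.len), SmoothCovOn IM G.τ (fun t ↦ G.ν (u t)) η
      (Icc (S.pt i.castSucc) (S.pt i.succ) ∩ Icc (P.pt j.castSucc) (P.pt j.succ))) {F : Set ℝ} (hF : F.Countable)
    (hadj : ∀ t ∈ Ioo a b \ F, G.AdjointAt 0 u (fun t ↦ G.hCov 0 (u t) (η t)) univ t)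
    (hmax : ∀ t ∈ Icc a b, ∀ u' : U, G.ν u' = G.ν (u t) →
      G.hCov 0 (u t) (η t) (G.vel (G.ν (u t)) u') ≤
        G.hCov 0 (u t) (η t) (G.vel (G.ν (u t)) (u t)))
    {w : Vert IM G.τ (G.ν (u b))} (hw : w ∈ P.verticalCone) : η b w ≤ 0 := by
  obtain ⟨s, δ, t, Y, hδ, ht, hY, hw⟩ := hw
  have hv : ∀ i, dAt IM G.τ (G.ν (u (t i)))
      (G.field (Y i) (G.ν (u (t i))) - G.vel (G.ν (u (t i))) (u (t i))) = 0 := by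
    intro i
    rw [map_sub, dAt_field _ (hY i), dAt_vel rfl, sub_self]
  have hT : ∀ i, dAt IM G.τ (G.ν (u b)) (P.transport (t i)
      (G.field (Y i) (G.ν (u (t i))) - G.vel (G.ν (u (t i))) (u (t i)))) = 0 := by
    intro i
    rw [P.dAt_transport (Ioc_subset_Icc_self (ht i)), hv]
  have hw' : w = ∑ i, δ i • (⟨_, hT i⟩ : Vert IM G.τ (G.ν (u b))) := by
    apply Subtype.ext
    rw [hw]
    simp
  rw [hw', map_sum]
  refine Finset.sum_nonpos fun i _ ↦ ?_
  rw [map_smul, smul_eq_mul]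
  refine mul_nonpos_of_nonneg_of_nonpos (hδ i) ?_
  -- The value of `η b` on a generator equals that of `η (t i)` on `Y - ċ`, a difference of
  -- Hamiltonian values subject to the maximum condition.
  rw [← P.eq_apply_transport hab S hS hF hadj (Ioc_subset_Icc_self (ht i)) ⟨_, hv i⟩ ⟨_, hT i⟩ rfl,
    ← G.hCov_apply_vert 0 (u (t i)) (η (t i)) ⟨_, hv i⟩]
  have h1 := hmax (t i) (Ioc_subset_Icc_self (ht i)) ((Y i).σ (G.ν (u (t i))))
    ((Y i).ν_σ _ (hY i))
  refine (map_sub (G.hCov 0 (u (t i)) (η (t i))) _ _).trans_le ?_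
  exact sub_nonpos.2 h1

end ControlStructure.FlowData
end Core

/-! ### Multipliers in terms of the adjoint equation -/

section Multipliers


variable {EM HM EU HU EQ HQ EK HK : Type*}
  [NormedAddCommGroup EM] [NormedSpace ℝ EM] [TopologicalSpace HM]
  [NormedAddCommGroup EU] [NormedSpace ℝ EU] [TopologicalSpace HU]
  [NormedAddCommGroup EQ] [NormedSpace ℝ EQ] [TopologicalSpace HQ]
  [NormedAddCommGroup EK] [NormedSpace ℝ EK] [TopologicalSpace HK]
  {IM : ModelWithCorners ℝ EM HM} {IU : ModelWithCorners ℝ EU HU}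
  {IQ : ModelWithCorners ℝ EQ HQ} {IK : ModelWithCorners ℝ EK HK}
  {M U Q K : Type*}
  [TopologicalSpace M] [ChartedSpace HM M] [IsManifold IM ∞ M]
  [TopologicalSpace U] [ChartedSpace HU U]
  [TopologicalSpace Q] [ChartedSpace HQ Q]
  [TopologicalSpace K] [ChartedSpace HK K]

namespace ControlStructure

variable {G : ControlStructure IM IU IQ IK M U Q K} {a b : ℝ} {u : ℝ → U}

/-- This is where the convention `u a = w i a` for the first piece matters. -/
lemma IsControl.continuousWithinAt_left (hab : a < b) (hu : G.IsControl a b u) :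
    ContinuousWithinAt u (Icc a b) a := by
  obtain ⟨S, w, hw⟩ := hu.piecewise
  set i : Fin S.len := ⟨0, S.len_pos hab⟩ with hi
  have hi0 : S.pt i.castSucc = a := S.first
  obtain ⟨⟨O, hO, hsubO, hwO, -⟩, -, h2, h3⟩ := hw i
  have hlt := S.pt_lt i
  rw [hi0] at hsubO h2 hlt
  have h4 : ContinuousAt (w i) a :=
    (hwO.contMDiffAt (hO.mem_nhds (hsubO ⟨le_rfl, hlt.le⟩))).continuousAt
  refine h4.continuousWithinAt.congr_of_eventuallyEq ?_ (h3 hi0)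
  filter_upwards [self_mem_nhdsWithin, mem_nhdsWithin_of_mem_nhds (Iio_mem_nhds hlt)] with t h5 h6
  rcases h5.1.eq_or_lt with rfl | h7
  · exact h3 hi0
  · exact h2 t ⟨h7, h6.le⟩

lemma IsControl.exists_hasMFDerivWithinAt (hu : G.IsControl a b u) {t : ℝ} (ht : t ∈ Ioc a b) :
    ∃ p < t, HasMFDerivWithinAt 𝓘(ℝ, ℝ) IM (fun r ↦ G.ν (u r)) (Icc p t) t
      ((1 : ℝ →L[ℝ] ℝ).smulRight (G.ρ (u t)).1) := by
  obtain ⟨S, w, hw⟩ := hu.piecewise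
  obtain ⟨i, hi⟩ := S.exists_mem_Ioc ht
  obtain ⟨-, h1, h2, -⟩ := hw i
  have hut := h2 t hi
  have h3 : ∀ z : U, z = w i t → HasMFDerivAt 𝓘(ℝ, ℝ) IM (fun r ↦ G.ν (w i r)) t
      ((1 : ℝ →L[ℝ] ℝ).smulRight (show EM from (G.ρ z).1) : ℝ →L[ℝ] EM) := by
    rintro z rfl
    exact h1 t (Ioc_subset_Icc_self hi)
  -- The midpoint keeps `[p, t]` inside the half-open piece, where `u` agrees with `w i`.
  refine ⟨(S.pt i.castSucc + t) / 2, by linarith [hi.1], ?_⟩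
  refine HasMFDerivWithinAt.congr_of_eventuallyEq (h3 _ hut).hasMFDerivWithinAt ?_
    (congrArg G.ν hut)
  filter_upwards [self_mem_nhdsWithin] with r hr
  exact congrArg G.ν (h2 r ⟨by linarith [hr.1, hi.1], hr.2.trans hi.2⟩)

lemma IsControl.exists_subdivision (hu : G.IsControl a b u) :
    ∃ S : Subdivision a b, ∀ i : Fin S.len,
      ContMDiffOn 𝓘(ℝ, ℝ) IU ∞ u (Ioo (S.pt i.castSucc) (S.pt i.succ)) ∧
      ∀ t ∈ Ioo (S.pt i.castSucc) (S.pt i.succ),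
        HasMFDerivAt 𝓘(ℝ, ℝ) IM (fun r ↦ G.ν (u r)) t
          ((1 : ℝ →L[ℝ] ℝ).smulRight (G.ρ (u t)).1) := by
  obtain ⟨S, w, hw⟩ := hu.piecewise
  refine ⟨S, fun i ↦ ?_⟩
  obtain ⟨⟨O, hO, hsubO, hwO, -⟩, h1, h2, -⟩ := hw i
  refine ⟨(hwO.mono (Ioo_subset_Icc_self.trans hsubO)).congr
    fun t ht ↦ h2 t (Ioo_subset_Ioc_self ht), fun t ht ↦ ?_⟩
  have hut := h2 t (Ioo_subset_Ioc_self ht)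
  have h3 : ∀ z : U, z = w i t → HasMFDerivAt 𝓘(ℝ, ℝ) IM (fun r ↦ G.ν (w i r)) t
      ((1 : ℝ →L[ℝ] ℝ).smulRight (show EM from (G.ρ z).1) : ℝ →L[ℝ] EM) := by
    rintro z rfl
    exact h1 t (Ioo_subset_Icc_self ht)
  refine HasMFDerivAt.congr_of_eventuallyEq (h3 _ hut) ?_
  filter_upwards [Ioo_mem_nhds ht.1 ht.2] with r hr
  exact congrArg G.ν (h2 r (Ioo_subset_Ioc_self hr))

end ControlStructure

namespace OptimalControlStructure

variable {G : OptimalControlStructure IM IU IQ IK M U Q K} {a b : ℝ} {u : ℝ → U}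
  {η : ∀ t, CoVert IM G.τ (G.ν (u t))} {lam : ℝ}
  [IM.Boundaryless] [IsManifold IU ∞ U] [IU.Boundaryless]

lemma IsMultiplier.exists_adjointAt (hu : G.IsControl a b u) (h : G.IsMultiplier a b u η lam) :
    ∃ F : Set ℝ, F.Countable ∧ ∀ t ∈ Ioo a b \ F,
      G.AdjointAt lam u (fun t ↦ G.hCov lam (u t) (η t)) univ t := by
  obtain ⟨S, hS⟩ := h.piecewise
  obtain ⟨S', hS'⟩ := hu.exists_subdivision
  refine ⟨range S.pt ∪ range S'.pt, (finite_range _).countable.union (finite_range _).countable,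
    fun t ht ↦ ?_⟩
  obtain ⟨i, hi⟩ := S.exists_mem_Ioo ⟨ht.1, fun h ↦ ht.2 (Or.inl h)⟩
  obtain ⟨j, hj⟩ := S'.exists_mem_Ioo ⟨ht.1, fun h ↦ ht.2 (Or.inr h)⟩
  set r := max (S.pt i.castSucc) (S'.pt j.castSucc) with hr
  set s := min (S.pt i.succ) (S'.pt j.succ) with hs
  have htI : t ∈ Ioo r s := ⟨max_lt hi.1 hj.1, lt_min hi.2 hj.2⟩
  have h1 : Ioo r s ⊆ Icc (S.pt i.castSucc) (S.pt i.succ) :=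
    (Ioo_subset_Ioo (le_max_left _ _) (min_le_left _ _)).trans Ioo_subset_Icc_self
  have h2 : Ioo r s ⊆ Ioo (S'.pt j.castSucc) (S'.pt j.succ) :=
    Ioo_subset_Ioo (le_max_right _ _) (min_le_right _ _)
  obtain ⟨A, hA, hAη⟩ := hS i
  have hp : G.SmoothPhaseOn (fun t ↦ ⟨u t, η t⟩) (Ioo r s) :=
    ⟨(hS' j).1.mono h2, A, hA.mono h1, fun t ht v ↦ hAη t (h1 ht) v⟩
  exact (contractionZero_iff lam (isOpen_Ioo.mem_nhds htI) hp ((hS' j).2 t (h2 htI))).1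
    (h.characteristic r s (h1.trans (S.Icc_subset i)) hp t htI)

/-- A smooth part of `(u, η)` may run across breakpoints of `S`. There the curve is differentiable,
so its derivative is its left derivative and a left-sided adjoint equation suffices. The bound 0 in
`hmax` is the maximum condition because the Hamiltonian vanishes at `u t` by `hCov_vel`. -/
lemma isMultiplier_of_adjointAt (hu : G.IsControl a b u) (S : Subdivision a b)
    (hS : ∀ i : Fin S.len, SmoothCovOn IM G.τ (fun t ↦ G.ν (u t)) η
      (Icc (S.pt i.castSucc) (S.pt i.succ)))
    (hadj : ∀ t ∈ Ioc a b, ∃ p < t,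
      G.AdjointAt lam u (fun t ↦ G.hCov lam (u t) (η t)) (Icc p t) t)
    (hmax : ∀ t ∈ Icc a b, ∀ u' : U, G.ν u' = G.ν (u t) →
      G.hCov lam (u t) (η t) (G.vel (G.ν (u t)) u') + lam * G.L u' ≤ 0)
    (hne : ∀ t ∈ Icc a b, ¬ (η t = 0 ∧ lam = 0)) : G.IsMultiplier a b u η lam where
  piecewise := ⟨S, hS⟩
  characteristic r s hrs hp t ht := by
    have htI : t ∈ Ioc a b := by
      have h1 := hrs (show (r + t) / 2 ∈ Ioo r s from ⟨by linarith [ht.1], by linarith [ht.1, ht.2]⟩)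
      exact ⟨by linarith [h1.1, ht.1], (hrs ht).2⟩
    have hn : Ioo r s ∈ 𝓝 t := isOpen_Ioo.mem_nhds ht
    have hv : HasMFDerivAt 𝓘(ℝ, ℝ) IM (fun r ↦ G.ν (u r)) t
        ((1 : ℝ →L[ℝ] ℝ).smulRight (G.ρ (u t)).1) := by
      obtain ⟨p, hpt, hd⟩ := hu.exists_hasMFDerivWithinAt htI
      have h1 : MDifferentiableAt 𝓘(ℝ, ℝ) IM (fun r ↦ G.ν (u r)) t :=
        (G.mdifferentiable_ν _).comp t ((hp.1.contMDiffAt hn).mdifferentiableAt (by simp))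
      have h2 : UniqueMDiffWithinAt 𝓘(ℝ, ℝ) (Icc p t) t :=
        uniqueMDiffWithinAt_iff_uniqueDiffWithinAt.2 (uniqueDiffOn_Icc hpt t ⟨hpt.le, le_rfl⟩)
      have h3 := h2.eq h1.hasMFDerivAt.hasMFDerivWithinAt hd
      exact h1.hasMFDerivAt.congr_mfderiv h3
    rw [contractionZero_iff lam hn hp hv]
    obtain ⟨p, hpt, α', hα', hw⟩ := hadj t htI
    have hh := (contMDiffOn_hMap lam hp).contMDiffAt hn
    have hd := ((((contMDiffWithinAt_cotangent_iff IM).1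
      (contMDiffWithinAt_univ.2 hh)).2.contDiffAt Filter.univ_mem).differentiableAt
        (by simp)).hasDerivAt
    have h2 : UniqueDiffWithinAt ℝ (Icc p t) t := uniqueDiffOn_Icc hpt t ⟨hpt.le, le_rfl⟩
    have h3 := h2.eq_deriv _ hd.hasDerivWithinAt hα'
    exact ⟨α', (hd.congr_deriv h3).hasDerivWithinAt, hw⟩
  maximum t ht u' hu' := (hmax t ht u' hu').trans_eq (G.hCov_vel lam (u t) (η t)).symm
  ne_zero := hne

end OptimalControlStructure
end Multipliers

/-! ### Charts of `M × ℝ` -/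

section ProductCoordinates

variable {E H : Type*} [NormedAddCommGroup E] [NormedSpace ℝ E] [TopologicalSpace H]
  (I : ModelWithCorners ℝ E H) {M : Type*} [TopologicalSpace M] [ChartedSpace H M]
  [IsManifold I ∞ M]

lemma toCoord_prod {x₀ x : M} (J₀ J : ℝ) (hx : x ∈ (chartAt H x₀).source) (v : E × ℝ) :
    toCoord (I.prod 𝓘(ℝ, ℝ)) (x₀, J₀) (x, J) v = (toCoord I x₀ x v.1, v.2) := by
  have hx' : (x, J) ∈ (chartAt (ModelProd H ℝ) (x₀, J₀)).source := by
    simpa [chartAt_self_eq] using hx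
  have h1 := hasMFDerivAt_extChartAt_toCoord (I.prod 𝓘(ℝ, ℝ)) hx'
  have h2 : HasMFDerivAt (I.prod 𝓘(ℝ, ℝ)) 𝓘(ℝ, E × ℝ) (fun q : M × ℝ ↦ (extChartAt I x₀ q.1, q.2))
      (x, J) (((toCoord I x₀ x).comp (ContinuousLinearMap.fst ℝ (TangentSpace I x)
        (TangentSpace 𝓘(ℝ, ℝ) J))).prod (ContinuousLinearMap.snd ℝ (TangentSpace I x)
        (TangentSpace 𝓘(ℝ, ℝ) J))) := by
    rw [modelWithCornersSelf_prod, ← chartedSpaceSelf_prod]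
    exact HasMFDerivAt.prodMk
      (HasMFDerivAt.comp (x, J) (hasMFDerivAt_extChartAt_toCoord I hx) (hasMFDerivAt_fst (x, J)))
      (hasMFDerivAt_snd (x, J))
  have h3 : (extChartAt (I.prod 𝓘(ℝ, ℝ)) (x₀, J₀) : M × ℝ → E × ℝ) =
      fun q ↦ (extChartAt I x₀ q.1, q.2) := by
    ext q <;> simp [chartAt_self_eq]
  rw [h3] at h1
  exact congrArg (fun L : E × ℝ →L[ℝ] E × ℝ ↦ L v) (hasMFDerivAt_unique h1 h2)

lemma ofCoord_prod {x₀ x : M} (J₀ J : ℝ) (hx : x ∈ (chartAt H x₀).source) (v : E × ℝ) :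
    (ofCoord (I.prod 𝓘(ℝ, ℝ)) (x₀, J₀) (x, J) v : E × ℝ) = (ofCoord I x₀ x v.1, v.2) := by
  have hx' : (x, J) ∈ (chartAt (ModelProd H ℝ) (x₀, J₀)).source := by
    simpa [chartAt_self_eq] using hx
  have h1 := toCoord_prod I J₀ J hx ((ofCoord I x₀ x v.1 : E), v.2)
  have h2 : (toCoord I x₀ x (ofCoord I x₀ x v.1), v.2) = v := by
    rw [toCoord_ofCoord I hx]
  have h3 := congrArg (ofCoord (I.prod 𝓘(ℝ, ℝ)) (x₀, J₀) (x, J)) (h1.trans h2)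
  exact h3.symm.trans (ofCoord_toCoord (I.prod 𝓘(ℝ, ℝ)) hx' _)

end ProductCoordinates

/-! ### Hamiltonian and adjoint equation of the extended structure -/

section Extension

variable {EM HM EU HU EQ HQ EK HK : Type*}
  [NormedAddCommGroup EM] [NormedSpace ℝ EM] [TopologicalSpace HM]
  [NormedAddCommGroup EU] [NormedSpace ℝ EU] [TopologicalSpace HU]
  [NormedAddCommGroup EQ] [NormedSpace ℝ EQ] [TopologicalSpace HQ]
  [NormedAddCommGroup EK] [NormedSpace ℝ EK] [TopologicalSpace HK]
  {IM : ModelWithCorners ℝ EM HM} {IU : ModelWithCorners ℝ EU HU}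
  {IQ : ModelWithCorners ℝ EQ HQ} {IK : ModelWithCorners ℝ EK HK}
  {M U Q K : Type*}
  [TopologicalSpace M] [ChartedSpace HM M] [IsManifold IM ∞ M]
  [TopologicalSpace U] [ChartedSpace HU U]
  [TopologicalSpace Q] [ChartedSpace HQ Q]
  [TopologicalSpace K] [ChartedSpace HK K]

namespace OptimalControlStructure

variable (G : OptimalControlStructure IM IU IQ IK M U Q K)

/-- The extended control structure, with zero cost. -/
abbrev extendedZero : OptimalControlStructure (IM.prod 𝓘(ℝ, ℝ)) (IU.prod 𝓘(ℝ, ℝ))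
    (IQ.prod 𝓘(ℝ, ℝ)) IK (M × ℝ) (U × ℝ) (Q × ℝ) K :=
  { G.extended with
    L := fun _ ↦ 0
    contMDiff_L := contMDiff_const }

/-- The `J`-component of an extended velocity is the cost, so the coefficient of `dJ` plays the role
of `λ`. -/
lemma ham_extendedZero {x₀ : M} (J₀ : ℝ) (p : EM × ℝ →L[ℝ] ℝ) {q : U × ℝ}
    (hq : G.ν q.1 ∈ (chartAt HM x₀).source) :
    G.extendedZero.ham 0 (x₀, J₀) p q =
      G.ham (p (0, 1)) x₀ (p.comp (ContinuousLinearMap.inl ℝ EM ℝ)) q.1 := by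
  have h1 := toCoord_prod IM J₀ q.2 hq ((G.ρ q.1).1, G.L q.1)
  have h2 : G.extendedZero.ham 0 (x₀, J₀) p q =
      p (toCoord IM x₀ (G.ν q.1) (G.ρ q.1).1, G.L q.1) + 0 * 0 := congrArg (fun z ↦ p z + 0 * 0) h1
  have h3 : ((toCoord IM x₀ (G.ν q.1) (G.ρ q.1).1, G.L q.1) : EM × ℝ) =
      (toCoord IM x₀ (G.ν q.1) (G.ρ q.1).1, 0) + G.L q.1 • (0, 1) := by simp
  rw [h2, h3, map_add, map_smul, ham, smul_eq_mul]
  change _ + _ + (0 : ℝ) * 0 = p (toCoord IM x₀ (G.ν q.1) (G.ρ q.1).1, 0) + _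
  ring

lemma mfderiv_ν_extendedZero (q : U × ℝ) (w : EU × ℝ) :
    (mfderiv (IU.prod 𝓘(ℝ, ℝ)) (IM.prod 𝓘(ℝ, ℝ)) G.extendedZero.ν q w : EM × ℝ) =
      (mfderiv IU IM G.ν q.1 w.1, w.2) := by
  have h : HasMFDerivAt (IU.prod 𝓘(ℝ, ℝ)) (IM.prod 𝓘(ℝ, ℝ)) (fun q : U × ℝ ↦ (G.ν q.1, q.2)) q
      (((mfderiv IU IM G.ν q.1).comp (ContinuousLinearMap.fst ℝ (TangentSpace IU q.1)
        (TangentSpace 𝓘(ℝ, ℝ) q.2))).prod (ContinuousLinearMap.snd ℝ (TangentSpace IU q.1)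
        (TangentSpace 𝓘(ℝ, ℝ) q.2))) :=
    HasMFDerivAt.prodMk
      (HasMFDerivAt.comp q (G.mdifferentiable_ν q.1).hasMFDerivAt (hasMFDerivAt_fst q))
      (hasMFDerivAt_snd q)
  exact congrArg (fun L : EU × ℝ →L[ℝ] EM × ℝ ↦ L w) h.mfderiv

lemma dAt_ham_extendedZero {x₀ : M} (J₀ : ℝ) (p : EM × ℝ →L[ℝ] ℝ) {q : U × ℝ}
    (hq : G.ν q.1 ∈ (chartAt HM x₀).source) (w : EU × ℝ) :
    dAt (IU.prod 𝓘(ℝ, ℝ)) (G.extendedZero.ham 0 (x₀, J₀) p) q w =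
      dAt IU (G.ham (p (0, 1)) x₀ (p.comp (ContinuousLinearMap.inl ℝ EM ℝ))) q.1 w.1 := by
  have h1 : HasMFDerivAt (IU.prod 𝓘(ℝ, ℝ)) 𝓘(ℝ, ℝ)
      (fun q : U × ℝ ↦ G.ham (p (0, 1)) x₀ (p.comp (ContinuousLinearMap.inl ℝ EM ℝ)) q.1) q
      ((dAt IU (G.ham (p (0, 1)) x₀ (p.comp (ContinuousLinearMap.inl ℝ EM ℝ))) q.1).comp
        (ContinuousLinearMap.fst ℝ (TangentSpace IU q.1) (TangentSpace 𝓘(ℝ, ℝ) q.2))) :=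
    HasMFDerivAt.comp q (G.mdifferentiableAt_ham _ _ hq).hasMFDerivAt (hasMFDerivAt_fst q)
  have hc : Continuous fun q : U × ℝ ↦ G.ν q.1 :=
    G.bundle_ν.contMDiff.continuous.comp continuous_fst
  have h2 := h1.congr_of_eventuallyEq (f₁ := G.extendedZero.ham 0 (x₀, J₀) p) (by
    filter_upwards [hc.continuousAt.preimage_mem_nhds
      ((chartAt HM x₀).open_source.mem_nhds hq)] with q' hq'
    exact G.ham_extendedZero J₀ p hq')
  exact congrArg (fun L : EU × ℝ →L[ℝ] ℝ ↦ L w) h2.mfderiv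

variable {G}

/-- The adjoint equation of the extended structure. -/
lemma adjointAt_extendedZero_iff {u : ℝ → U} {J : ℝ → ℝ}
    {α : ∀ t, TangentSpace (IM.prod 𝓘(ℝ, ℝ)) (G.extendedZero.ν (u t, J t)) →L[ℝ] ℝ}
    {s : Set ℝ} {t : ℝ} (hc : ContinuousWithinAt (fun r ↦ G.ν (u r)) s t) :
    G.extendedZero.AdjointAt 0 (fun r ↦ (u r, J r)) α s t ↔
      G.AdjointAt (α t ((0 : EM), (1 : ℝ))) u
        (fun r ↦ (α r : EM × ℝ →L[ℝ] ℝ).comp (ContinuousLinearMap.inl ℝ EM ℝ)) s t ∧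
      HasDerivWithinAt (fun r ↦ α r ((0 : EM), (1 : ℝ))) 0 s t := by
  set x₀ := G.ν (u t) with hx₀
  have hsrc := mem_chart_source HM x₀
  have hev : ∀ᶠ r in 𝓝[s] t, G.ν (u r) ∈ (chartAt HM x₀).source :=
    hc.preimage_mem_nhdsWithin ((chartAt HM x₀).open_source.mem_nhds hsrc)
  set f : ℝ → EM × ℝ →L[ℝ] ℝ := fun r ↦
    (α r).comp (ofCoord (IM.prod 𝓘(ℝ, ℝ)) (x₀, J t) (G.ν (u r), J r)) with hf
  set g : ℝ → EM →L[ℝ] ℝ := fun r ↦ ((α r : EM × ℝ →L[ℝ] ℝ).comp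
    (ContinuousLinearMap.inl ℝ EM ℝ)).comp (ofCoord IM x₀ (G.ν (u r)) : EM →L[ℝ] EM) with hg
  set l : ℝ → ℝ := fun r ↦ α r ((0 : EM), (1 : ℝ)) with hl
  have hfg : ∀ r, G.ν (u r) ∈ (chartAt HM x₀).source →
      f r = (g r).comp (ContinuousLinearMap.fst ℝ EM ℝ) +
        l r • ContinuousLinearMap.snd ℝ EM ℝ := by
    intro r hr
    ext v
    · change α r (ofCoord (IM.prod 𝓘(ℝ, ℝ)) (x₀, J t) (G.ν (u r), J r) (v, (0 : ℝ))) =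
        α r ((ofCoord IM x₀ (G.ν (u r)) v : EM), (0 : ℝ)) + l r * 0
      rw [mul_zero, add_zero]
      exact congrArg (α r) (ofCoord_prod IM (J t) (J r) hr (v, 0))
    · change α r (ofCoord (IM.prod 𝓘(ℝ, ℝ)) (x₀, J t) (G.ν (u r), J r) ((0 : EM), (1 : ℝ))) =
        (g r : EM →L[ℝ] ℝ) 0 + l r * 1
      rw [map_zero, zero_add, mul_one]
      refine congrArg (α r) ((ofCoord_prod IM (J t) (J r) hr (0, 1)).trans ?_)
      exact congrArg (fun z : EM ↦ (z, (1 : ℝ))) (map_zero (ofCoord IM x₀ (G.ν (u r))))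
  have hgf : ∀ r, G.ν (u r) ∈ (chartAt HM x₀).source →
      g r = (f r).comp (ContinuousLinearMap.inl ℝ EM ℝ) := by
    intro r hr
    rw [hfg r hr]
    ext v
    simp
  have hlf : ∀ r, G.ν (u r) ∈ (chartAt HM x₀).source → l r = f r (0, 1) := by
    intro r hr
    rw [hfg r hr]
    simp
  have hdham : ∀ w : EU × ℝ,
      dAt (IU.prod 𝓘(ℝ, ℝ)) (G.extendedZero.ham 0 (x₀, J t) (α t)) (u t, J t) w =
      dAt IU (G.ham (l t) x₀ ((α t : EM × ℝ →L[ℝ] ℝ).comp (ContinuousLinearMap.inl ℝ EM ℝ)))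
        (u t) w.1 := G.dAt_ham_extendedZero (J t) (α t) (q := (u t, J t)) hsrc
  have hdν := G.mfderiv_ν_extendedZero (u t, J t)
  constructor
  · rintro ⟨f', hf', hw⟩
    have hf'' : HasDerivWithinAt f f' s t := hf'
    have hw' : ∀ w : EU × ℝ, f' (mfderiv IU IM G.ν (u t) w.1, w.2) + dAt IU (G.ham (l t) x₀
        ((α t : EM × ℝ →L[ℝ] ℝ).comp (ContinuousLinearMap.inl ℝ EM ℝ))) (u t) w.1 = 0 := by
      intro w
      refine Eq.trans ?_ (hw w)
      exact congrArg₂ (· + ·) (congrArg f' (hdν w).symm) (hdham w).symm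
    refine ⟨⟨f'.comp (ContinuousLinearMap.inl ℝ EM ℝ), ?_, fun w ↦ hw' (w, 0)⟩, ?_⟩
    · refine HasDerivWithinAt.congr_of_eventuallyEq (f₁ := g)
        ((((ContinuousLinearMap.compL ℝ EM (EM × ℝ) ℝ).flip
        (ContinuousLinearMap.inl ℝ EM ℝ)).hasFDerivAt.comp_hasDerivWithinAt t hf'')) ?_ (hgf t hsrc)
      filter_upwards [hev] with r hr using hgf r hr
    -- In the direction `∂/∂J` the Hamiltonian is constant, so the `dJ`-component of the covector is
    -- stationary.
    · have h1 := hw' (0, 1)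
      have h2 : f' ((mfderiv IU IM G.ν (u t) (0 : EU) : EM), (1 : ℝ)) = f' (0, 1) :=
        congrArg (fun z : EM ↦ f' (z, 1)) (map_zero (mfderiv IU IM G.ν (u t)))
      have h3 : f' ((0 : EM), (1 : ℝ)) = 0 := by
        rw [← h2]
        refine Eq.trans ?_ h1
        refine ((congrArg (_ + ·) ?_).trans (add_zero _)).symm
        exact map_zero (dAt IU (G.ham (l t) x₀
          ((α t : EM × ℝ →L[ℝ] ℝ).comp (ContinuousLinearMap.inl ℝ EM ℝ))) (u t))
      have h4 := hf''.clm_apply (hasDerivWithinAt_const t s ((0 : EM), (1 : ℝ)))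
      refine (h4.congr_deriv ?_).congr_of_eventuallyEq ?_ (hlf t hsrc)
      · rw [map_zero, add_zero, h3]
      · filter_upwards [hev] with r hr using hlf r hr
  · rintro ⟨⟨g', hg', hw⟩, hl'⟩
    have hg'' : HasDerivWithinAt g g' s t := hg'
    refine ⟨g'.comp (ContinuousLinearMap.fst ℝ EM ℝ), ?_, fun w ↦ ?_⟩
    · have h1 := ((((ContinuousLinearMap.compL ℝ (EM × ℝ) EM ℝ).flip
        (ContinuousLinearMap.fst ℝ EM ℝ)).hasFDerivAt.comp_hasDerivWithinAt t hg'')).add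
        (hl'.smul_const (ContinuousLinearMap.snd ℝ EM ℝ))
      refine HasDerivWithinAt.congr_of_eventuallyEq (f₁ := f) (h1.congr_deriv ?_) ?_ (hfg t hsrc)
      · rw [zero_smul, add_zero]
        rfl
      · filter_upwards [hev] with r hr using hfg r hr
    · refine Eq.trans ?_ (hw (show EU × ℝ from w).1)
      refine congrArg₂ (· + ·) ?_ (hdham w)
      exact congrArg (fun z : EM × ℝ ↦ g' z.1) (hdν w)

end OptimalControlStructure
end Extension

/-! ### Vertical covectors of the form `η + λ dJ` -/

section CovectorExtension


variable {EM HM EU HU EQ HQ EK HK : Type*}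
  [NormedAddCommGroup EM] [NormedSpace ℝ EM] [TopologicalSpace HM]
  [NormedAddCommGroup EU] [NormedSpace ℝ EU] [TopologicalSpace HU]
  [NormedAddCommGroup EQ] [NormedSpace ℝ EQ] [TopologicalSpace HQ]
  [NormedAddCommGroup EK] [NormedSpace ℝ EK] [TopologicalSpace HK]
  {IM : ModelWithCorners ℝ EM HM} {IU : ModelWithCorners ℝ EU HU}
  {IQ : ModelWithCorners ℝ EQ HQ} {IK : ModelWithCorners ℝ EK HK}
  {M U Q K : Type*}
  [TopologicalSpace M] [ChartedSpace HM M] [IsManifold IM ∞ M]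
  [TopologicalSpace U] [ChartedSpace HU U]
  [TopologicalSpace Q] [ChartedSpace HQ Q]
  [TopologicalSpace K] [ChartedSpace HK K]

variable (IM) in
lemma comp_fst_add_comp_ofCoord {x₀ x : M} (J₀ J : ℝ) (hx : x ∈ (chartAt HM x₀).source)
    (A : TangentSpace IM x →L[ℝ] ℝ) (lam : ℝ) :
    ((A : EM →L[ℝ] ℝ).comp (ContinuousLinearMap.fst ℝ EM ℝ) +
      lam • ContinuousLinearMap.snd ℝ EM ℝ : EM × ℝ →L[ℝ] ℝ).comp
      (ofCoord (IM.prod 𝓘(ℝ, ℝ)) (x₀, J₀) (x, J) : EM × ℝ →L[ℝ] EM × ℝ) =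
    (A.comp (ofCoord IM x₀ x)).comp (ContinuousLinearMap.fst ℝ EM ℝ) +
      lam • ContinuousLinearMap.snd ℝ EM ℝ := by
  refine ContinuousLinearMap.ext fun v ↦ ?_
  exact congrArg (fun z : EM × ℝ ↦ (A : EM →L[ℝ] ℝ) z.1 + lam * z.2) (ofCoord_prod IM J₀ J hx v)

variable (IM) in
lemma comp_inl_comp_ofCoord {x₀ x : M} (J₀ J : ℝ) (hx : x ∈ (chartAt HM x₀).source)
    (A : TangentSpace (IM.prod 𝓘(ℝ, ℝ)) (x, J) →L[ℝ] ℝ) :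
    ((A : EM × ℝ →L[ℝ] ℝ).comp (ContinuousLinearMap.inl ℝ EM ℝ)).comp
      (ofCoord IM x₀ x : EM →L[ℝ] EM) =
    (A.comp (ofCoord (IM.prod 𝓘(ℝ, ℝ)) (x₀, J₀) (x, J))).comp
      (ContinuousLinearMap.inl ℝ EM ℝ) := by
  refine ContinuousLinearMap.ext fun v ↦ ?_
  exact congrArg A (ofCoord_prod IM J₀ J hx (v, 0)).symm

namespace OptimalControlStructure

variable (G : OptimalControlStructure IM IU IQ IK M U Q K)

/-- The inclusion of vertical vectors of `M` into vertical vectors of `M × ℝ`. -/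
def vertInl (p : M × ℝ) : Vert IM G.τ p.1 →L[ℝ] Vert (IM.prod 𝓘(ℝ, ℝ)) G.extendedZero.τ p :=
  ContinuousLinearMap.codRestrict
    (((ContinuousLinearMap.inl ℝ EM ℝ : EM →L[ℝ] EM × ℝ) :
      TangentSpace IM p.1 →L[ℝ] TangentSpace (IM.prod 𝓘(ℝ, ℝ)) p).comp
      (Vert IM G.τ p.1).subtypeL) _
    fun v ↦ (G.dAt_extended p (show EM × ℝ from ((v : TangentSpace IM p.1), (0 : ℝ)))).trans v.2

/-- The projection of vertical vectors of `M × ℝ` onto vertical vectors of `M`. -/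
def vertFst (p : M × ℝ) : Vert (IM.prod 𝓘(ℝ, ℝ)) G.extendedZero.τ p →L[ℝ] Vert IM G.τ p.1 :=
  ContinuousLinearMap.codRestrict
    (((ContinuousLinearMap.fst ℝ EM ℝ : EM × ℝ →L[ℝ] EM) :
      TangentSpace (IM.prod 𝓘(ℝ, ℝ)) p →L[ℝ] TangentSpace IM p.1).comp
      (Vert (IM.prod 𝓘(ℝ, ℝ)) G.extendedZero.τ p).subtypeL) _
    fun v ↦ (G.dAt_extended p (show EM × ℝ from v.1)).symm.trans v.2

/-- The vertical covector `η + λ dJ`. -/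
def covExt (p : M × ℝ) (η : CoVert IM G.τ p.1) (lam : ℝ) :
    CoVert (IM.prod 𝓘(ℝ, ℝ)) G.extendedZero.τ p :=
  η.comp (G.vertFst p) + lam • (((ContinuousLinearMap.snd ℝ EM ℝ : EM × ℝ →L[ℝ] ℝ) :
      TangentSpace (IM.prod 𝓘(ℝ, ℝ)) p →L[ℝ] ℝ).comp
      (Vert (IM.prod 𝓘(ℝ, ℝ)) G.extendedZero.τ p).subtypeL)

lemma covExt_apply (p : M × ℝ) (η : CoVert IM G.τ p.1) (lam : ℝ)
    (v : Vert (IM.prod 𝓘(ℝ, ℝ)) G.extendedZero.τ p) :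
    G.covExt p η lam v = η (G.vertFst p v) + lam * (show EM × ℝ from v.1).2 := rfl

lemma covExt_zero (p : M × ℝ) : G.covExt p 0 0 = 0 := by
  ext v
  refine (G.covExt_apply p 0 0 v).trans ?_
  rw [zero_mul, add_zero]
  rfl

lemma covExt_negDJ (p : M × ℝ) (η : CoVert IM G.τ p.1) (lam : ℝ) :
    G.covExt p η lam (G.negDJ p) = -lam := by
  have h : G.vertFst p (G.negDJ p) = 0 := rfl
  refine (G.covExt_apply p η lam (G.negDJ p)).trans ?_
  change η (G.vertFst p (G.negDJ p)) + lam * (-1) = -lam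
  rw [h, map_zero]
  ring

/-- Splitting off the `J`-component of a vector shows that every vertical covector of the extended
structure is some `η + λ dJ`, with `λ` its value on `∂/∂J`. -/
lemma covExt_comp_vertInl (p : M × ℝ) (ε : CoVert (IM.prod 𝓘(ℝ, ℝ)) G.extendedZero.τ p) :
    G.covExt p (ε.comp (G.vertInl p)) (-ε (G.negDJ p)) = ε := by
  ext v
  have h : v = G.vertInl p (G.vertFst p v) + (-(show EM × ℝ from v.1).2) • G.negDJ p := by
    apply Subtype.ext
    change (show EM × ℝ from v.1) = ((show EM × ℝ from v.1).1, (0 : ℝ)) +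
      (-(show EM × ℝ from v.1).2) • ((0 : EM), (-1 : ℝ))
    ext <;> simp
  rw [covExt_apply]
  conv_rhs => rw [h, map_add, map_smul, smul_eq_mul]
  change ε (G.vertInl p (G.vertFst p v)) + _ = _
  ring

lemma covExt_ne_zero {p : M × ℝ} {η : CoVert IM G.τ p.1} {lam : ℝ} (h : ¬ (η = 0 ∧ lam = 0)) :
    G.covExt p η lam ≠ 0 := by
  intro h0
  have h1 : lam = 0 := by
    have := G.covExt_negDJ p η lam
    rw [h0] at this
    exact neg_eq_zero.1 this.symm
  refine h ⟨?_, h1⟩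
  ext v
  have h2 := G.covExt_apply p η lam (G.vertInl p v)
  rw [h0, h1, zero_mul, add_zero] at h2
  exact h2.symm

/-- The covector `H_0(ū, η + λ dJ)` of the extended structure is `H_λ(u, η) + λ dJ`. -/
lemma hCov_covExt (q : U × ℝ) (η : CoVert IM G.τ (G.ν q.1)) (lam : ℝ) :
    (G.extendedZero.hCov 0 q (G.covExt (G.ν q.1, q.2) η lam) : EM × ℝ →L[ℝ] ℝ) =
      (G.hCov lam q.1 η : EM →L[ℝ] ℝ).comp (ContinuousLinearMap.fst ℝ EM ℝ) +
        lam • ContinuousLinearMap.snd ℝ EM ℝ := by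
  set A : EM →L[ℝ] ℝ := G.hCov 0 q.1 η with hA
  have hAη : ∀ v : Vert IM G.τ (G.ν q.1), A (v : TangentSpace IM (G.ν q.1)) = η v :=
    G.hCov_apply_vert 0 q.1 η
  have h1 := G.hCov_eq lam q.1 η A hAη
  have h2 := G.extendedZero.hCov_eq 0 q (G.covExt (G.ν q.1, q.2) η lam)
    (A.comp (ContinuousLinearMap.fst ℝ EM ℝ) + lam • ContinuousLinearMap.snd ℝ EM ℝ)
    (fun v ↦ congrArg (· + lam * (show EM × ℝ from v.1).2) (hAη (G.vertFst (G.ν q.1, q.2) v)))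
  rw [h1]
  refine h2.trans (ContinuousLinearMap.ext fun v ↦ ?_)
  have h3 := G.dAt_extended (G.ν q.1, q.2) v
  change A (show EM × ℝ from v).1 + lam * (show EM × ℝ from v).2 -
    (A (G.ρ q.1).1 + lam * G.L q.1 + 0 * 0) *
      dAt (IM.prod 𝓘(ℝ, ℝ)) (fun q : M × ℝ ↦ G.τ q.1) (G.ν q.1, q.2) v =
    A (show EM × ℝ from v).1 - (A (G.ρ q.1).1 + lam * G.L q.1) *
      dAt IM G.τ (G.ν q.1) (show EM × ℝ from v).1 + lam * (show EM × ℝ from v).2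
  rw [h3]
  ring

variable {G}

lemma smoothCovOn_comp_vertInl {c : ℝ → M} {J : ℝ → ℝ}
    {η : ∀ t, CoVert (IM.prod 𝓘(ℝ, ℝ)) G.extendedZero.τ (c t, J t)} {s : Set ℝ}
    (h : SmoothCovOn (IM.prod 𝓘(ℝ, ℝ)) G.extendedZero.τ (fun t ↦ (c t, J t)) η s) :
    SmoothCovOn IM G.τ c (fun t ↦ (η t).comp (G.vertInl (c t, J t))) s := by
  obtain ⟨A, hA, hAη⟩ := h
  refine ⟨fun t ↦ (A t : EM × ℝ →L[ℝ] ℝ).comp (ContinuousLinearMap.inl ℝ EM ℝ), fun t ht ↦ ?_,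
    fun t ht v ↦ hAη t ht (G.vertInl (c t, J t) v)⟩
  have h1 := (contMDiffWithinAt_cotangent_iff (IM.prod 𝓘(ℝ, ℝ))).1 (hA t ht)
  have hc : ContMDiffWithinAt 𝓘(ℝ, ℝ) IM ∞ c s t :=
    contMDiff_fst.contMDiffAt.comp_contMDiffWithinAt t h1.1
  rw [contMDiffWithinAt_cotangent_iff]
  refine ⟨hc, ?_⟩
  have hsrc := mem_chart_source HM (c t)
  have h2 : ContDiffWithinAt ℝ ∞ (fun r ↦ ((A r).comp (ofCoord (IM.prod 𝓘(ℝ, ℝ)) (c t, J t)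
      (c r, J r))).comp (ContinuousLinearMap.inl ℝ EM ℝ)) s t :=
    h1.2.clm_comp contDiffWithinAt_const
  refine h2.congr_of_eventuallyEq ?_ (comp_inl_comp_ofCoord IM (J t) (J t) hsrc (A t))
  filter_upwards [hc.continuousWithinAt.preimage_mem_nhdsWithin
    ((chartAt HM (c t)).open_source.mem_nhds hsrc)] with r hr
  exact comp_inl_comp_ofCoord IM (J t) (J r) hr (A r)

lemma smoothCovOn_covExt {c : ℝ → M} {J : ℝ → ℝ} {η : ∀ t, CoVert IM G.τ (c t)} {s : Set ℝ}
    (lam : ℝ) (h : SmoothCovOn IM G.τ c η s)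
    (hJ : ContMDiffOn 𝓘(ℝ, ℝ) (IM.prod 𝓘(ℝ, ℝ)) ∞ (fun t ↦ (c t, J t)) s) :
    SmoothCovOn (IM.prod 𝓘(ℝ, ℝ)) G.extendedZero.τ (fun t ↦ (c t, J t))
      (fun t ↦ G.covExt (c t, J t) (η t) lam) s := by
  obtain ⟨A, hA, hAη⟩ := h
  refine ⟨fun t ↦ (A t : EM →L[ℝ] ℝ).comp (ContinuousLinearMap.fst ℝ EM ℝ) +
    lam • ContinuousLinearMap.snd ℝ EM ℝ, fun t ht ↦ ?_, fun t ht v ↦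
    congrArg (· + lam * (show EM × ℝ from v.1).2) (hAη t ht (G.vertFst (c t, J t) v))⟩
  have h1 := (contMDiffWithinAt_cotangent_iff IM).1 (hA t ht)
  rw [contMDiffWithinAt_cotangent_iff]
  refine ⟨hJ t ht, ?_⟩
  have hsrc := mem_chart_source HM (c t)
  have h2 : ContDiffWithinAt ℝ ∞ (fun r ↦ ((A r).comp (ofCoord IM (c t) (c r))).comp
      (ContinuousLinearMap.fst ℝ EM ℝ) + lam • ContinuousLinearMap.snd ℝ EM ℝ) s t :=
    (h1.2.clm_comp contDiffWithinAt_const).add contDiffWithinAt_const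
  refine h2.congr_of_eventuallyEq ?_ (comp_fst_add_comp_ofCoord IM (J t) (J t) hsrc (A t) lam)
  filter_upwards [h1.1.continuousWithinAt.preimage_mem_nhdsWithin
    ((chartAt HM (c t)).open_source.mem_nhds hsrc)] with r hr
  exact comp_fst_add_comp_ofCoord IM (J t) (J r) hr (A r) lam

end OptimalControlStructure
end CovectorExtension

/-! ### Closures of convex cones and supporting linear forms -/

section ConvexCones

variable {X : Type*} [NormedAddCommGroup X] [NormedSpace ℝ X]

/-- If `f x` were positive, the multiple of `x` by `(|k| + 1) / f x` would have the value `|k| + 1`,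
beyond the bound. -/
lemma le_zero_of_le_of_smul_mem {C : Set X} (hs : ∀ r : ℝ, 0 ≤ r → ∀ x ∈ C, r • x ∈ C)
    {f : X →L[ℝ] ℝ} {k : ℝ} (hf : ∀ x ∈ C, f x ≤ k) : ∀ x ∈ C, f x ≤ 0 := by
  intro x hx
  by_contra! h
  have h1 := hf _ (hs ((|k| + 1) / f x) (by positivity) x hx)
  rw [map_smul, smul_eq_mul, div_mul_cancel₀ _ h.ne'] at h1
  linarith [le_abs_self k]

lemma convex_of_smul_add {C : Set X} (hs : ∀ r : ℝ, 0 ≤ r → ∀ x ∈ C, r • x ∈ C)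
    (ha : ∀ x ∈ C, ∀ y ∈ C, x + y ∈ C) : Convex ℝ C :=
  fun x hx y hy _ _ hp hq _ ↦ ha _ (hs _ hp x hx) _ (hs _ hq y hy)

/-- Hahn–Banach separation of `x` from the closed cone; homogeneity improves the bound on the cone
to 0. -/
lemma notMem_closure_cone_iff {C : Set X} (h0 : 0 ∈ C)
    (hs : ∀ r : ℝ, 0 ≤ r → ∀ x ∈ C, r • x ∈ C) (ha : ∀ x ∈ C, ∀ y ∈ C, x + y ∈ C) {x : X} :
    x ∉ closure C ↔ ∃ f : X →L[ℝ] ℝ, (∀ y ∈ C, f y ≤ 0) ∧ 0 < f x := by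
  constructor
  · intro hx
    obtain ⟨f, k, hf, hk⟩ := geometric_hahn_banach_closed_point
      (convex_of_smul_add hs ha).closure isClosed_closure hx
    refine ⟨f, le_zero_of_le_of_smul_mem hs fun y hy ↦ (hf y (subset_closure hy)).le, ?_⟩
    have := hf 0 (subset_closure h0)
    rw [map_zero] at this
    exact this.trans hk
  · rintro ⟨f, hf, hx⟩ hmem
    have h1 : closure C ⊆ {y | f y ≤ 0} :=
      closure_minimal hf (isClosed_le f.continuous continuous_const)
    exact absurd (h1 hmem) (not_le.2 hx)

/-- A nonzero form is positive at some `x` or at `-x`, and that vector is not in the closure. -/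
lemma closure_cone_ne_univ_iff {C : Set X} (h0 : 0 ∈ C)
    (hs : ∀ r : ℝ, 0 ≤ r → ∀ x ∈ C, r • x ∈ C) (ha : ∀ x ∈ C, ∀ y ∈ C, x + y ∈ C) :
    closure C ≠ univ ↔ ∃ f : X →L[ℝ] ℝ, (∀ y ∈ C, f y ≤ 0) ∧ f ≠ 0 := by
  rw [Ne, eq_univ_iff_forall, not_forall]
  constructor
  · rintro ⟨x, hx⟩
    obtain ⟨f, hf, hfx⟩ := (notMem_closure_cone_iff h0 hs ha).1 hx
    exact ⟨f, hf, fun h ↦ by simp [h] at hfx⟩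
  · rintro ⟨f, hf, hne⟩
    obtain ⟨x, hx⟩ : ∃ x, f x ≠ 0 := by
      by_contra! h
      exact hne (ContinuousLinearMap.ext h)
    rcases lt_or_gt_of_ne hx with h | h
    · exact ⟨-x, (notMem_closure_cone_iff h0 hs ha).2 ⟨f, hf, by simpa using h⟩⟩
    · exact ⟨x, (notMem_closure_cone_iff h0 hs ha).2 ⟨f, hf, h⟩⟩

/-- If the closure has interior points, `x` is separated from the interior, and `f x = 0` since `f`
is bounded by `f x` on a cone that contains 0 and has `x` in its closure. Otherwise the cone lies in
a proper subspace, on which some nonzero form vanishes. Conversely, at an interior point with `f x =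
0` the form would have a local maximum, which forces `f = 0`. -/
lemma mem_frontier_closure_cone_iff [FiniteDimensional ℝ X] {C : Set X} (h0 : 0 ∈ C)
    (hs : ∀ r : ℝ, 0 ≤ r → ∀ x ∈ C, r • x ∈ C) (ha : ∀ x ∈ C, ∀ y ∈ C, x + y ∈ C) {x : X} :
    x ∈ frontier (closure C) ↔
      x ∈ closure C ∧ ∃ f : X →L[ℝ] ℝ, (∀ y ∈ C, f y ≤ 0) ∧ f ≠ 0 ∧ f x = 0 := by
  have hconv := (convex_of_smul_add hs ha).closure
  rw [isClosed_closure.frontier_eq, mem_sdiff]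
  refine and_congr_right fun hx ↦ ⟨fun hxi ↦ ?_, ?_⟩
  · have hcl : ∀ {f : X →L[ℝ] ℝ}, (∀ y ∈ C, f y ≤ 0) → ∀ y ∈ closure C, f y ≤ 0 :=
      fun {f} hf ↦ closure_minimal (t := {y | f y ≤ 0}) hf
        (isClosed_le f.continuous continuous_const)
    by_cases hne : (interior (closure C)).Nonempty
    · obtain ⟨f, hf⟩ := geometric_hahn_banach_open_point hconv.interior isOpen_interior hxi
      have h1 : ∀ y ∈ closure C, f y ≤ f x := by
        rw [← closure_closure (s := C), ← hconv.closure_interior_eq_closure_of_nonempty_interior hne]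
        exact closure_minimal (fun y hy ↦ (hf y hy).le)
          (isClosed_le f.continuous continuous_const)
      have h2 : ∀ y ∈ C, f y ≤ 0 :=
        le_zero_of_le_of_smul_mem hs fun y hy ↦ h1 y (subset_closure hy)
      refine ⟨f, h2, ?_, le_antisymm (hcl h2 x hx) ?_⟩
      · rintro rfl
        obtain ⟨y, hy⟩ := hne
        simpa using hf y hy
      · simpa using h1 0 (subset_closure h0)
    -- In finite dimension a convex set with full affine span has interior points, and as 0 belongs
    -- to the closure its affine span is its linear span.
    · have hspan : Submodule.span ℝ (closure C) ≠ ⊤ := by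
        intro htop
        apply hne
        rw [hconv.interior_nonempty_iff_affineSpan_eq_top,
          ← insert_eq_of_mem (subset_closure h0 : (0 : X) ∈ closure C)]
        refine SetLike.coe_injective ?_
        rw [affineSpan_insert_zero, htop]
        rfl
      obtain ⟨f, hf, hker⟩ := Submodule.exists_le_ker_of_lt_top _ (lt_top_iff_ne_top.2 hspan)
      have h1 : ∀ y ∈ closure C, f y = 0 := fun y hy ↦ hker (Submodule.subset_span hy)
      refine ⟨f.toContinuousLinearMap, fun y hy ↦ (h1 y (subset_closure hy)).le, fun h ↦ hf ?_,
        h1 x hx⟩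
      ext y
      exact congrArg (fun g : X →L[ℝ] ℝ ↦ g y) h
  · rintro ⟨f, hf, hne, hfx⟩ hxi
    have hmax : IsLocalMax f x := by
      filter_upwards [mem_interior_iff_mem_nhds.1 hxi] with y hy
      rw [hfx]
      exact closure_minimal (t := {y | f y ≤ 0}) hf (isClosed_le f.continuous continuous_const) hy
    have := hmax.fderiv_eq_zero
    rw [f.fderiv] at this
    exact hne this

variable {V : Submodule ℝ X}

/-- The form with a submodule serves for `Vert`, a submodule of a tangent space that unfolds to the
normed space `EM`. -/
lemma Submodule.notMem_closure_cone_iff {C : Set V} (h0 : 0 ∈ C)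
    (hs : ∀ r : ℝ, 0 ≤ r → ∀ x ∈ C, r • x ∈ C) (ha : ∀ x ∈ C, ∀ y ∈ C, x + y ∈ C) {x : V} :
    x ∉ closure C ↔ ∃ f : V →L[ℝ] ℝ, (∀ y ∈ C, f y ≤ 0) ∧ 0 < f x :=
  GeomControl.notMem_closure_cone_iff h0 hs ha

lemma Submodule.closure_cone_ne_univ_iff {C : Set V} (h0 : 0 ∈ C)
    (hs : ∀ r : ℝ, 0 ≤ r → ∀ x ∈ C, r • x ∈ C) (ha : ∀ x ∈ C, ∀ y ∈ C, x + y ∈ C) :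
    closure C ≠ univ ↔ ∃ f : V →L[ℝ] ℝ, (∀ y ∈ C, f y ≤ 0) ∧ f ≠ 0 :=
  GeomControl.closure_cone_ne_univ_iff h0 hs ha

lemma Submodule.mem_frontier_closure_cone_iff [FiniteDimensional ℝ X] {C : Set V} (h0 : 0 ∈ C)
    (hs : ∀ r : ℝ, 0 ≤ r → ∀ x ∈ C, r • x ∈ C) (ha : ∀ x ∈ C, ∀ y ∈ C, x + y ∈ C) {x : V} :
    x ∈ frontier (closure C) ↔
      x ∈ closure C ∧ ∃ f : V →L[ℝ] ℝ, (∀ y ∈ C, f y ≤ 0) ∧ f ≠ 0 ∧ f x = 0 :=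
  GeomControl.mem_frontier_closure_cone_iff h0 hs ha

end ConvexCones

/-! ### Abnormal extremals and the vertical cone -/

section Main


variable {EM HM EU HU EQ HQ EK HK : Type*}
  [NormedAddCommGroup EM] [NormedSpace ℝ EM] [TopologicalSpace HM]
  [NormedAddCommGroup EU] [NormedSpace ℝ EU] [TopologicalSpace HU]
  [NormedAddCommGroup EQ] [NormedSpace ℝ EQ] [TopologicalSpace HQ]
  [NormedAddCommGroup EK] [NormedSpace ℝ EK] [TopologicalSpace HK]
  {IM : ModelWithCorners ℝ EM HM} {IU : ModelWithCorners ℝ EU HU}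
  {IQ : ModelWithCorners ℝ EQ HQ} {IK : ModelWithCorners ℝ EK HK}
  {M U Q K : Type*}
  [TopologicalSpace M] [ChartedSpace HM M] [IsManifold IM ∞ M]
  [TopologicalSpace U] [ChartedSpace HU U]
  [TopologicalSpace Q] [ChartedSpace HQ Q]
  [TopologicalSpace K] [ChartedSpace HK K]

namespace ControlStructure.FlowData

section Cone

variable {G : ControlStructure IM IU IQ IK M U Q K} {a b : ℝ} {u : ℝ → U} (P : G.FlowData a b u)

lemma zero_mem_verticalCone : 0 ∈ P.verticalCone :=
  ⟨0, fun _ ↦ 0, fun i ↦ i.elim0, fun i ↦ i.elim0, fun i ↦ i.elim0, fun i ↦ i.elim0,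
    fun i ↦ i.elim0, by simp⟩

lemma smul_mem_verticalCone (r : ℝ) (hr : 0 ≤ r) :
    ∀ w ∈ P.verticalCone, r • w ∈ P.verticalCone := by
  rintro w ⟨s, δ, t, Y, hδ, ht, hY, hw⟩
  refine ⟨s, fun i ↦ r * δ i, t, Y, fun i ↦ mul_nonneg hr (hδ i), ht, hY, ?_⟩
  rw [Submodule.coe_smul, hw, Finset.smul_sum]
  simp only [smul_smul]

lemma add_mem_verticalCone :
    ∀ w ∈ P.verticalCone, ∀ w' ∈ P.verticalCone, w + w' ∈ P.verticalCone := by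
  rintro w ⟨s, δ, t, Y, hδ, ht, hY, hw⟩ w' ⟨s', δ', t', Y', hδ', ht', hY', hw'⟩
  refine ⟨s + s', Fin.append δ δ', Fin.append t t', Fin.append Y Y', ?_, ?_, ?_, ?_⟩
  · intro i
    induction i using Fin.addCases <;> simp [hδ, hδ']
  · intro i
    induction i using Fin.addCases <;> simp [ht, ht']
  · intro i
    induction i using Fin.addCases with
    | left i => simpa using hY i
    | right i => simpa using hY' i
  -- Packing a term into one function of coefficient, instant and section lets `Fin.append` be
  -- rewritten although the tangent spaces depend on the instant.
  · let g : ℝ → ℝ → G.LocalSection → TangentSpace IM (G.ν (u b)) := fun d r Z ↦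
      d • P.transport r (G.field Z (G.ν (u r)) - G.vel (G.ν (u r)) (u r))
    rw [Submodule.coe_add, hw, hw', Fin.sum_univ_add]
    refine congrArg₂ (· + ·) (Finset.sum_congr rfl fun i _ ↦ ?_) (Finset.sum_congr rfl fun i _ ↦ ?_)
    · change g _ _ _ = g (Fin.append δ δ' _) (Fin.append t t' _) (Fin.append Y Y' _)
      rw [Fin.append_left, Fin.append_left, Fin.append_left]
    · change g _ _ _ = g (Fin.append δ δ' _) (Fin.append t t' _) (Fin.append Y Y' _)
      rw [Fin.append_right, Fin.append_right, Fin.append_right]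

lemma notMem_closure_verticalCone_iff {x : Vert IM G.τ (G.ν (u b))} :
    x ∉ closure P.verticalCone ↔
      ∃ f : CoVert IM G.τ (G.ν (u b)), (∀ y ∈ P.verticalCone, f y ≤ 0) ∧ 0 < f x :=
  Submodule.notMem_closure_cone_iff (X := EM) (V := Vert IM G.τ (G.ν (u b)))
    P.zero_mem_verticalCone P.smul_mem_verticalCone P.add_mem_verticalCone

lemma closure_verticalCone_ne_univ_iff :
    closure P.verticalCone ≠ univ ↔
      ∃ f : CoVert IM G.τ (G.ν (u b)), (∀ y ∈ P.verticalCone, f y ≤ 0) ∧ f ≠ 0 :=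
  Submodule.closure_cone_ne_univ_iff (X := EM) (V := Vert IM G.τ (G.ν (u b)))
    P.zero_mem_verticalCone P.smul_mem_verticalCone P.add_mem_verticalCone

lemma mem_frontier_closure_verticalCone_iff [FiniteDimensional ℝ EM]
    {x : Vert IM G.τ (G.ν (u b))} :
    x ∈ frontier (closure P.verticalCone) ↔ x ∈ closure P.verticalCone ∧
      ∃ f : CoVert IM G.τ (G.ν (u b)), (∀ y ∈ P.verticalCone, f y ≤ 0) ∧ f ≠ 0 ∧ f x = 0 :=
  Submodule.mem_frontier_closure_cone_iff (X := EM) (V := Vert IM G.τ (G.ν (u b)))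
    P.zero_mem_verticalCone P.smul_mem_verticalCone P.add_mem_verticalCone

end Cone

variable [IM.Boundaryless] [FiniteDimensional ℝ EM] [T2Space M] [T2Space U] [IK.Boundaryless]
  {G : OptimalControlStructure IM IU IQ IK M U Q K} {a b : ℝ} {u : ℝ → U}
  (P : G.FlowData a b u)

omit [IK.Boundaryless] in
-- After normalization the value on `ċ` is 0, so the maximum condition becomes a sign condition.
lemma hCov_pull_vel_le (hab : a < b) (hua : ContinuousWithinAt u (Icc a b) a)
    {κ : TangentSpace IM (G.ν (u b)) →L[ℝ] ℝ} (hκ : ∀ w ∈ P.verticalCone, κ w ≤ 0) {t : ℝ}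
    (ht : t ∈ Icc a b) {u' : U} (hu' : G.ν u' = G.ν (u t)) :
    G.hCov 0 (u t) (P.pull κ t) (G.vel (G.ν (u t)) u') ≤ 0 := by
  have h1 := P.max_of_cone_left hab hua hκ ht hu'
  have h2 : dAt IM G.τ (G.ν (u b)) (P.transport t (G.vel (G.ν (u t)) u')) = 1 :=
    (P.dAt_transport ht _).trans (dAt_vel hu')
  rw [P.hCov_pull κ ht]
  change κ (P.transport t (G.vel (G.ν (u t)) u')) - κ (P.transport t (G.ρ (u t)).1) *
    dAt IM G.τ (G.ν (u b)) (P.transport t (G.vel (G.ν (u t)) u')) ≤ 0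
  rw [h2, mul_one]
  exact sub_nonpos.2 h1

/-- A nonzero vertical covector that is nonpositive on the vertical cone yields a multiplier. -/
lemma isMultiplier_pull [IsManifold IU ∞ U] [IU.Boundaryless] (hab : a < b)
    (hu : G.IsControl a b u) {κ : TangentSpace IM (G.ν (u b)) →L[ℝ] ℝ}
    (hκ : ∀ w ∈ P.verticalCone, κ w ≤ 0) {v : Vert IM G.τ (G.ν (u b))} (hv : κ v ≠ 0) :
    G.IsMultiplier a b u (P.pull κ) 0 := by
  refine OptimalControlStructure.isMultiplier_of_adjointAt hu P.toSubdivision (fun i ↦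
    ⟨fun t ↦ κ.comp (P.transport t), P.contMDiffOn_comp_transport i κ, fun _ _ _ ↦ rfl⟩)
    (fun t ht ↦ ?_) (fun t ht u' hu' ↦ ?_) fun t ht h ↦ P.pull_ne_zero hv ht h.1
  · obtain ⟨i, hi⟩ := P.exists_mem_Ioc ht
    exact ⟨_, hi.1, (P.adjointAt_hCov_pull i hi κ fun u' hu' ↦ P.max_of_cone hκ ht hu').mono
      (Icc_subset_Icc_right hi.2)⟩
  · rw [zero_mul, add_zero]
    exact P.hCov_pull_vel_le hab (ControlStructure.IsControl.continuousWithinAt_left hab hu) hκ ht hu'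

end ControlStructure.FlowData

namespace OptimalControlStructure

variable [IM.Boundaryless] [FiniteDimensional ℝ EM] [T2Space M] [T2Space U] [IK.Boundaryless]
  [IsManifold IU ∞ U] [IU.Boundaryless]
  {G : OptimalControlStructure IM IU IQ IK M U Q K} {a b : ℝ} {u : ℝ → U}

omit [IM.Boundaryless] [FiniteDimensional ℝ EM] [T2Space M] [T2Space U] [IK.Boundaryless]
  [IsManifold IU ∞ U] [IU.Boundaryless] in
lemma isAbnormal_iff (hu : G.IsControl a b u) :
    G.IsAbnormal a b u ↔ ∃ η, G.IsMultiplier a b u η 0 := by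
  constructor
  · rintro ⟨-, η, lam, h, rfl⟩
    exact ⟨η, h⟩
  · rintro ⟨η, h⟩
    exact ⟨⟨hu, η, 0, h, le_rfl⟩, η, 0, h, rfl⟩

omit [IM.Boundaryless] [FiniteDimensional ℝ EM] [T2Space M] [T2Space U] [IK.Boundaryless]
  [IsManifold IU ∞ U] [IU.Boundaryless] in
lemma isNormal_iff (hu : G.IsControl a b u) :
    G.IsNormal a b u ↔ ∃ η, ∃ lam < 0, G.IsMultiplier a b u η lam := by
  constructor
  · rintro ⟨-, η, lam, h, hl⟩
    exact ⟨η, lam, hl, h⟩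
  · rintro ⟨η, lam, hl, h⟩
    exact ⟨⟨hu, η, lam, h, hl.le⟩, η, lam, h, hl⟩

/-- A multiplier with `λ = 0` has the nonzero final value `η b`, nonpositive on the cone; conversely
such a form is pulled back along the composite flow. -/
theorem isAbnormal_iff_closure_ne_univ (hab : a < b) (hu : G.IsControl a b u)
    (P : G.FlowData a b u) : G.IsAbnormal a b u ↔ closure P.verticalCone ≠ univ := by
  rw [isAbnormal_iff hu]
  rw [P.closure_verticalCone_ne_univ_iff]
  constructor
  · rintro ⟨η, h⟩
    obtain ⟨S, hS⟩ := h.piecewise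
    obtain ⟨F, hF, hadj⟩ := h.exists_adjointAt hu
    refine ⟨η b, fun w hw ↦ P.le_zero_of_mem_verticalCone hab S (fun i j ↦ ?_) hF hadj
      (fun t ht u' hu' ↦ ?_) hw, fun h0 ↦ h.ne_zero b ⟨hab.le, le_rfl⟩ ⟨h0, rfl⟩⟩
    · obtain ⟨A, hA, hAη⟩ := hS i
      exact ⟨A, hA.mono inter_subset_left, fun t ht v ↦ hAη t ht.1 v⟩
    · simpa using h.maximum t ht u' hu'
  · rintro ⟨ε, hε, hne⟩
    obtain ⟨v, hv⟩ : ∃ v, ε v ≠ 0 := by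
      by_contra! h
      exact hne (ContinuousLinearMap.ext h)
    -- `H_0` supplies an extension of the form from vertical vectors to the whole tangent space.
    refine ⟨_, P.isMultiplier_pull hab hu (κ := G.hCov 0 (u b) ε) (v := v) (fun w hw ↦ ?_) ?_⟩
    · exact (G.hCov_apply_vert 0 (u b) ε w).trans_le (hε w hw)
    · rw [G.hCov_apply_vert]
      exact hv

end OptimalControlStructure
end Main

/-! ### Strictly abnormal extremals and the extended cone -/

section Main


variable {EM HM EU HU EQ HQ EK HK : Type*}
  [NormedAddCommGroup EM] [NormedSpace ℝ EM] [TopologicalSpace HM]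
  [NormedAddCommGroup EU] [NormedSpace ℝ EU] [TopologicalSpace HU]
  [NormedAddCommGroup EQ] [NormedSpace ℝ EQ] [TopologicalSpace HQ]
  [NormedAddCommGroup EK] [NormedSpace ℝ EK] [TopologicalSpace HK]
  {IM : ModelWithCorners ℝ EM HM} {IU : ModelWithCorners ℝ EU HU}
  {IQ : ModelWithCorners ℝ EQ HQ} {IK : ModelWithCorners ℝ EK HK}
  {M U Q K : Type*}
  [TopologicalSpace M] [ChartedSpace HM M] [IsManifold IM ∞ M]
  [TopologicalSpace U] [ChartedSpace HU U]
  [TopologicalSpace Q] [ChartedSpace HQ Q]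
  [TopologicalSpace K] [ChartedSpace HK K]

lemma comp_fst_add_comp_inl {E : Type*} [NormedAddCommGroup E] [NormedSpace ℝ E] (A : E →L[ℝ] ℝ)
    (r : ℝ) : (A.comp (ContinuousLinearMap.fst ℝ E ℝ) +
      r • ContinuousLinearMap.snd ℝ E ℝ).comp (ContinuousLinearMap.inl ℝ E ℝ) = A := by
  ext v
  simp

lemma comp_fst_add_apply_zero_one {E : Type*} [NormedAddCommGroup E] [NormedSpace ℝ E]
    (A : E →L[ℝ] ℝ) (r : ℝ) : (A.comp (ContinuousLinearMap.fst ℝ E ℝ) +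
      r • ContinuousLinearMap.snd ℝ E ℝ) (0, 1) = r := by
  simp

namespace OptimalControlStructure

variable [IM.Boundaryless] [FiniteDimensional ℝ EM] [T2Space M] [T2Space U] [IK.Boundaryless]
  [IsManifold IU ∞ U] [IU.Boundaryless]
  {G : OptimalControlStructure IM IU IQ IK M U Q K} {a b : ℝ} {u : ℝ → U} {J : ℝ → ℝ}

omit [T2Space U] [IK.Boundaryless] [IsManifold IU ∞ U] [IU.Boundaryless] in
-- Continuity of `J` comes from the composite flow, on whose first piece the extended base curve
-- `(c, J)` is smooth; nothing about integrals is needed.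
lemma continuousWithinAt_lift_left (hab : a < b) (hu : G.IsControl a b u)
    (P : G.extendedZero.FlowData a b (fun r ↦ (u r, J r))) :
    ContinuousWithinAt (fun r ↦ (u r, J r)) (Icc a b) a := by
  refine (ControlStructure.IsControl.continuousWithinAt_left hab hu).prodMk ?_
  set i : Fin P.len := ⟨0, P.len_pos hab⟩ with hi
  have hi0 : P.pt i.castSucc = a := P.first
  have hlt := P.pt_lt i
  have h1 := (P.contMDiffOn_base i).continuousOn
  rw [hi0] at hlt h1
  have h2 : ContinuousWithinAt J (Icc a (P.pt i.succ)) a :=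
    continuous_snd.continuousAt.comp_continuousWithinAt (h1 a ⟨le_rfl, hlt.le⟩)
  refine h2.mono_of_mem_nhdsWithin ?_
  filter_upwards [self_mem_nhdsWithin, mem_nhdsWithin_of_mem_nhds (Iio_mem_nhds hlt)] with t h3 h4
  exact ⟨h3.1, h4.le⟩

omit [T2Space U] [IK.Boundaryless] in
/-- The final value of a multiplier `(η, λ)` defines a covector of the extended structure that is
nonpositive on the vertical cone. -/
lemma IsMultiplier.covExt_le_zero (hab : a < b) (hu : G.IsControl a b u)
    {η : ∀ t, CoVert IM G.τ (G.ν (u t))} {lam : ℝ} (h : G.IsMultiplier a b u η lam)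
    (P : G.extendedZero.FlowData a b (fun r ↦ (u r, J r))) :
    ∀ w ∈ P.verticalCone, G.covExt (G.ν (u b), J b) (η b) lam w ≤ 0 := by
  obtain ⟨S, hS⟩ := h.piecewise
  obtain ⟨F, hF, hadj⟩ := h.exists_adjointAt hu
  have hcov : ∀ t, (G.extendedZero.hCov 0 (u t, J t) (G.covExt (G.ν (u t), J t) (η t) lam) :
      EM × ℝ →L[ℝ] ℝ) = (G.hCov lam (u t) (η t) : EM →L[ℝ] ℝ).comp
        (ContinuousLinearMap.fst ℝ EM ℝ) + lam • ContinuousLinearMap.snd ℝ EM ℝ :=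
    fun t ↦ G.hCov_covExt (u t, J t) (η t) lam
  refine fun w hw ↦ P.le_zero_of_mem_verticalCone hab
    (η := fun t ↦ G.covExt (G.ν (u t), J t) (η t) lam) S (fun i j ↦ ?_) hF (fun t ht ↦ ?_)
    (fun t ht q hq ↦ ?_) hw
  -- `η` is smooth on the pieces of `S`, and `J` on those of `P`.
  · obtain ⟨A, hA, hAη⟩ := hS i
    exact smoothCovOn_covExt lam ⟨A, hA.mono inter_subset_left, fun t ht v ↦ hAη t ht.1 v⟩
      ((P.contMDiffOn_base j).mono inter_subset_right)
  · have hc : ContinuousWithinAt (fun r ↦ G.ν (u r)) univ t :=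
      (hu.continuousOn.continuousAt (Icc_mem_nhds ht.1.1 ht.1.2)).continuousWithinAt
    have h1 : ∀ r, G.extendedZero.hCov 0 (u r, J r) (G.covExt (G.ν (u r), J r) (η r) lam)
        ((0 : EM), (1 : ℝ)) = lam := by
      intro r
      exact (congrArg (fun L : EM × ℝ →L[ℝ] ℝ ↦ L (0, 1)) (hcov r)).trans
        (comp_fst_add_apply_zero_one (E := EM) _ _)
    refine (adjointAt_extendedZero_iff hc).2 ⟨?_, ?_⟩
    · rw [h1 t]
      refine (hadj t ht).congr (Filter.Eventually.of_forall fun r ↦ ?_) ?_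
      · exact (congrArg (fun L : EM × ℝ →L[ℝ] ℝ ↦ L.comp (ContinuousLinearMap.inl ℝ EM ℝ))
          (hcov r)).trans (comp_fst_add_comp_inl _ _)
      · exact (congrArg (fun L : EM × ℝ →L[ℝ] ℝ ↦ L.comp (ContinuousLinearMap.inl ℝ EM ℝ))
          (hcov t)).trans (comp_fst_add_comp_inl _ _)
    · simp only [h1]
      exact hasDerivWithinAt_const _ _ _
  -- The covector `α + λ dJ` on an extended velocity gives the Hamiltonian with its cost term, so
  -- the two maximum conditions coincide.
  · have hval : ∀ q : U × ℝ, G.extendedZero.hCov 0 (u t, J t)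
        (G.covExt (G.ν (u t), J t) (η t) lam)
        (G.extendedZero.vel (G.extendedZero.ν (u t, J t)) q) =
        G.hCov lam (u t) (η t) (G.vel (G.ν (u t)) q.1) + lam * G.L q.1 := fun q ↦
      congrArg (fun L : EM × ℝ →L[ℝ] ℝ ↦ L ((G.ρ q.1).1, G.L q.1)) (hcov t)
    refine (hval q).trans_le (le_trans ?_ (hval (u t, J t)).ge)
    exact h.maximum t ht q.1 (congrArg Prod.fst hq)

/-- A nonzero covector of the extended structure that is nonpositive on the vertical cone defines
a multiplier. -/
lemma exists_isMultiplier_of_extended (hab : a < b) (hu : G.IsControl a b u)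
    (P : G.extendedZero.FlowData a b (fun r ↦ (u r, J r)))
    {ε : CoVert (IM.prod 𝓘(ℝ, ℝ)) G.extendedZero.τ (G.ν (u b), J b)}
    (hε : ∀ w ∈ P.verticalCone, ε w ≤ 0) (hne : ε ≠ 0) :
    ∃ η, G.IsMultiplier a b u η (-ε (G.negDJ (G.ν (u b), J b))) := by
  set κ : TangentSpace (IM.prod 𝓘(ℝ, ℝ)) (G.extendedZero.ν (u b, J b)) →L[ℝ] ℝ :=
    G.extendedZero.hCov 0 (u b, J b) ε with hκdef
  have hκε : ∀ w : Vert (IM.prod 𝓘(ℝ, ℝ)) G.extendedZero.τ (G.extendedZero.ν (u b, J b)),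
      κ w = ε w := G.extendedZero.hCov_apply_vert 0 (u b, J b) ε
  have hκ : ∀ w ∈ P.verticalCone, κ w ≤ 0 := fun w hw ↦ (hκε w).trans_le (hε w hw)
  obtain ⟨v, hv⟩ : ∃ v, ε v ≠ 0 := by
    by_contra! h
    exact hne (ContinuousLinearMap.ext h)
  have hua := continuousWithinAt_lift_left hab hu P
  set lam : ℝ := -ε (G.negDJ (G.ν (u b), J b)) with hlam
  set η : ∀ t, CoVert IM G.τ (G.ν (u t)) := fun t ↦
    (P.pull κ t).comp (G.vertInl (G.ν (u t), J t)) with hη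
  -- The `dJ`-component of the pulled-back covector, for the moment a function of time; it is
  -- continuous and stationary off the breakpoints, hence equal to `lam`.
  set l : ℝ → ℝ := fun t ↦ -P.pull κ t (G.negDJ (G.ν (u t), J t)) with hl
  have hpull : ∀ t, P.pull κ t = G.covExt (G.ν (u t), J t) (η t) (l t) := fun t ↦
    (G.covExt_comp_vertInl (G.ν (u t), J t) (P.pull κ t)).symm
  have hcov : ∀ t, (G.extendedZero.hCov 0 (u t, J t) (P.pull κ t) : EM × ℝ →L[ℝ] ℝ) =
      (G.hCov (l t) (u t) (η t) : EM →L[ℝ] ℝ).comp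
        (ContinuousLinearMap.fst ℝ EM ℝ) + l t • ContinuousLinearMap.snd ℝ EM ℝ := by
    intro t
    rw [hpull t]
    exact G.hCov_covExt (u t, J t) (η t) (l t)
  have hcov1 : ∀ t, G.extendedZero.hCov 0 (u t, J t) (P.pull κ t) ((0 : EM), (1 : ℝ)) = l t := by
    intro t
    exact (congrArg (fun L : EM × ℝ →L[ℝ] ℝ ↦ L (0, 1)) (hcov t)).trans
        (comp_fst_add_apply_zero_one (E := EM) _ _)
  have hadj : ∀ (i : Fin P.len), ∀ t ∈ Ioc (P.pt i.castSucc) (P.pt i.succ),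
      G.AdjointAt (l t) u (fun r ↦ G.hCov (l r) (u r) (η r))
        (Icc (P.pt i.castSucc) (P.pt i.succ)) t ∧
      HasDerivWithinAt l 0 (Icc (P.pt i.castSucc) (P.pt i.succ)) t := by
    intro i t ht
    have htab := P.Icc_subset i (Ioc_subset_Icc_self ht)
    have h1 := P.adjointAt_hCov_pull i ht κ fun u' hu' ↦
      P.max_of_cone_left hab hua hκ htab hu'
    have hc : ContinuousWithinAt (fun r ↦ G.ν (u r)) (Icc (P.pt i.castSucc) (P.pt i.succ)) t :=
      (hu.continuousOn t htab).mono (P.Icc_subset i)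
    obtain ⟨h2, h3⟩ := (adjointAt_extendedZero_iff hc).1 h1
    simp only [hcov1] at h2 h3
    refine ⟨h2.congr (Filter.Eventually.of_forall fun r ↦ ?_) ?_, h3⟩
    · exact Eq.symm ((congrArg (fun L : EM × ℝ →L[ℝ] ℝ ↦
        L.comp (ContinuousLinearMap.inl ℝ EM ℝ)) (hcov r)).trans (comp_fst_add_comp_inl _ _))
    · exact Eq.symm ((congrArg (fun L : EM × ℝ →L[ℝ] ℝ ↦
        L.comp (ContinuousLinearMap.inl ℝ EM ℝ)) (hcov t)).trans (comp_fst_add_comp_inl _ _))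
  -- The vector `(0, 1)` has the same coordinates in every product chart, so `l` is the value at it
  -- of the covector in coordinates.
  have hlc : ContinuousOn l (Icc a b) := by
    refine P.continuousOn_of_inter hab subset_rfl fun i t ht ↦ ?_
    have hA := (contMDiffWithinAt_cotangent_iff (IM.prod 𝓘(ℝ, ℝ))).1
      (P.contMDiffOn_comp_transport i κ t ht.2)
    have h1 := hA.2.continuousWithinAt.clm_apply
      (continuousWithinAt_const (b := ((0 : EM), (1 : ℝ))))
    have hc : ContinuousWithinAt (fun r ↦ G.ν (u r)) (Icc (P.pt i.castSucc) (P.pt i.succ)) t :=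
      (hu.continuousOn t ht.1).mono (P.Icc_subset i)
    have hsrc := mem_chart_source HM (G.ν (u t))
    have hlr : ∀ r, G.ν (u r) ∈ (chartAt HM (G.ν (u t))).source →
        l r = (κ.comp (P.transport r)) (ofCoord (IM.prod 𝓘(ℝ, ℝ)) (G.ν (u t), J t)
          (G.ν (u r), J r) ((0 : EM), (1 : ℝ))) := by
      intro r hr
      have h2 := ofCoord_prod IM (J t) (J r) hr ((0 : EM), (1 : ℝ))
      have h3 : (ofCoord (IM.prod 𝓘(ℝ, ℝ)) (G.ν (u t), J t) (G.ν (u r), J r)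
          ((0 : EM), (1 : ℝ)) : EM × ℝ) = -((0 : EM), (-1 : ℝ)) := by
        rw [h2]
        refine Prod.ext ?_ ?_
        · exact (map_zero (ofCoord IM (G.ν (u t)) (G.ν (u r)))).trans neg_zero.symm
        · simp
      refine Eq.trans ?_ (congrArg (κ.comp (P.transport r)) h3).symm
      exact (map_neg (κ.comp (P.transport r)) _).symm
    refine (h1.congr_of_eventuallyEq ?_ (hlr t hsrc)).mono inter_subset_right
    filter_upwards [hc.preimage_mem_nhdsWithin
      ((chartAt HM (G.ν (u t))).open_source.mem_nhds hsrc)] with r hr using hlr r hr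
  have hllam : ∀ t ∈ Icc a b, l t = lam := by
    intro t ht
    refine (eq_right_of_hasDerivAt_zero (finite_range P.pt).countable hlc (fun r hr ↦ ?_) ht).trans ?_
    · obtain ⟨i, hi⟩ := P.exists_mem_Ioo hr
      exact (hadj i r (Ioo_subset_Ioc_self hi)).2.hasDerivAt (Icc_mem_nhds hi.1 hi.2)
    · exact congrArg Neg.neg ((P.pull_last κ _).trans (hκε _))
  refine ⟨η, isMultiplier_of_adjointAt hu P.toSubdivision (fun i ↦ ?_) (fun t ht ↦ ?_)
    (fun t ht u' hu' ↦ ?_) fun t ht h ↦ ?_⟩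
  · exact smoothCovOn_comp_vertInl (c := fun t ↦ G.ν (u t)) (J := J) (η := P.pull κ)
      ⟨fun t ↦ κ.comp (P.transport t), P.contMDiffOn_comp_transport i κ, fun _ _ _ ↦ rfl⟩
  · obtain ⟨i, hi⟩ := P.exists_mem_Ioc ht
    refine ⟨_, hi.1, AdjointAt.mono ?_ (Icc_subset_Icc_right hi.2)⟩
    have h1 := (hadj i t hi).1
    rw [hllam t (Ioc_subset_Icc_self ht)] at h1
    refine h1.congr ?_ (by rw [hllam t (Ioc_subset_Icc_self ht)])
    filter_upwards [self_mem_nhdsWithin] with r hr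
    rw [hllam r (P.Icc_subset i hr)]
  · have h1 := P.hCov_pull_vel_le hab hua hκ ht (u' := (u', J t)) (Prod.ext hu' rfl)
    have h2 := congrArg (fun L : EM × ℝ →L[ℝ] ℝ ↦ L ((G.ρ u').1, G.L u')) (hcov t)
    rw [hllam t ht] at h2
    exact h2.symm.trans_le h1
  -- If `η t` and `λ` both vanished, so would the pulled-back covector.
  · refine P.pull_ne_zero (v := v) (κ := κ) ((hκε v).trans_ne hv) ht ?_
    rw [hpull t, h.1, (hllam t ht).trans h.2, covExt_zero]
    rfl

/-- The form `η(b) + λ dJ` has the value `-λ` at `-∂/∂J`. Multipliers with `λ < 0` are thus the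
forms that separate this vector from the closure, and those with `λ = 0` the nonzero forms that
vanish at it; excluding the former and having one of the latter characterizes the boundary. -/
theorem isStrictlyAbnormal_iff (hab : a < b) (hu : G.IsControl a b u)
    (P : G.extendedZero.FlowData a b (fun r ↦ (u r, J r))) :
    G.IsStrictlyAbnormal a b u ↔
      G.negDJ (G.ν (u b), J b) ∈ frontier (closure P.verticalCone) := by
  have hb : b ∈ Icc a b := ⟨hab.le, le_rfl⟩
  have h1 : G.IsAbnormal a b u ↔
      ∃ f : CoVert (IM.prod 𝓘(ℝ, ℝ)) G.extendedZero.τ (G.ν (u b), J b),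
        (∀ y ∈ P.verticalCone, f y ≤ 0) ∧ f ≠ 0 ∧ f (G.negDJ (G.ν (u b), J b)) = 0 := by
    rw [isAbnormal_iff hu]
    constructor
    · rintro ⟨η, h⟩
      refine ⟨_, h.covExt_le_zero hab hu P, G.covExt_ne_zero (h.ne_zero b hb), ?_⟩
      rw [covExt_negDJ, neg_zero]
    · rintro ⟨f, hf, hne, h0⟩
      obtain ⟨η, h⟩ := exists_isMultiplier_of_extended hab hu P hf hne
      rw [h0, neg_zero] at h
      exact ⟨η, h⟩
  have h2 : G.IsNormal a b u ↔ G.negDJ (G.ν (u b), J b) ∉ closure P.verticalCone := by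
    rw [isNormal_iff hu]
    refine Iff.trans ?_ P.notMem_closure_verticalCone_iff.symm
    constructor
    · rintro ⟨η, lam, hlam, h⟩
      refine ⟨_, h.covExt_le_zero hab hu P, ?_⟩
      exact (neg_pos.2 hlam).trans_eq (G.covExt_negDJ _ _ _).symm
    · rintro ⟨f, hf, hpos⟩
      obtain ⟨η, h⟩ := exists_isMultiplier_of_extended hab hu P hf (by rintro rfl; exact lt_irrefl _ hpos)
      exact ⟨η, _, neg_lt_zero.2 hpos, h⟩
  rw [IsStrictlyAbnormal, h1, h2, not_not, and_comm]
  exact P.mem_frontier_closure_verticalCone_iff.symm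

end OptimalControlStructure
end Main

end GeomControl

end

theorem proposition7p5
    {EM HM EU HU EQ HQ EK HK M U Q K : Type*}
    [NormedAddCommGroup EM] [NormedSpace ℝ EM] [FiniteDimensional ℝ EM] [TopologicalSpace HM]
    [NormedAddCommGroup EU] [NormedSpace ℝ EU] [FiniteDimensional ℝ EU] [TopologicalSpace HU]
    [NormedAddCommGroup EQ] [NormedSpace ℝ EQ] [FiniteDimensional ℝ EQ] [TopologicalSpace HQ]
    [NormedAddCommGroup EK] [NormedSpace ℝ EK] [FiniteDimensional ℝ EK] [TopologicalSpace HK]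
    {IM : ModelWithCorners ℝ EM HM} [IM.Boundaryless]
    {IU : ModelWithCorners ℝ EU HU} [IU.Boundaryless]
    {IQ : ModelWithCorners ℝ EQ HQ} [IQ.Boundaryless]
    {IK : ModelWithCorners ℝ EK HK} [IK.Boundaryless]
    [TopologicalSpace M] [ChartedSpace HM M] [IsManifold IM ∞ M]
    [T2Space M] [SecondCountableTopology M]
    [TopologicalSpace U] [ChartedSpace HU U] [IsManifold IU ∞ U]
    [T2Space U] [SecondCountableTopology U]
    [TopologicalSpace Q] [ChartedSpace HQ Q] [IsManifold IQ ∞ Q]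
    [T2Space Q] [SecondCountableTopology Q]
    [TopologicalSpace K] [ChartedSpace HK K] [IsManifold IK ∞ K]
    [T2Space K] [SecondCountableTopology K]
    (G : GeomControl.OptimalControlStructure IM IU IQ IK M U Q K)
    (a b : ℝ) (hab : a < b) (u : ℝ → U) (hu : G.IsControl a b u) :
    (∀ P : G.FlowData a b u,
      G.IsAbnormal a b u ↔ closure P.verticalCone ≠ univ) ∧
    (∀ (J₀ : ℝ) (P : G.extended.FlowData a b (G.lift a u J₀)),
      G.IsStrictlyAbnormal a b u ↔
        G.negDJ (G.extended.ν (G.lift a u J₀ b)) ∈ frontier (closure P.verticalCone)) := by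
  exact ⟨fun P ↦ GeomControl.OptimalControlStructure.isAbnormal_iff_closure_ne_univ hab hu P,
    -- `lift` unfolds to the pair `(u, J)` with this `J`, and `extended` is the underlying control
    -- structure of `extendedZero`.
    fun J₀ P ↦ GeomControl.OptimalControlStructure.isStrictlyAbnormal_iff
      (J := fun t ↦ J₀ + ∫ s in a..t, G.L (u s)) hab hu P⟩
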